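/- Let $n\ge 2$ and let $B^{n+1}$ be the open unit ball of $\mathbb R^{n+1}$ with coordinates $(x^1,\dots,x^{n+1})$. A \emph{capillary hypersurface} in $B^{n+1}$ is a compact immersed hypersurface $x:M^n\to\mathbb R^{n+1}$, smooth up to its non-empty boundary, with unit normal field $N$, such that $x(\operatorname{int}M)\subset B^{n+1}$, $x(\partial M)\subset\partial B^{n+1}$, the mean curvature of $M$ is constant, and along $\partial M$ the normal $N$ makes a constant angle $\theta\in(0,\pi)$ (the contact angle) with the outward unit normal of $\partial B^{n+1}$. Let $\sigma$ be the second fundamental form of $M$ with respect to $N$, $\nu$ the outward unit conormal of $\partial M$ in $M$, and $q=\frac1{\sin\theta}+\cot\theta\,\sigma(\nu,\nu)$. The capillary hypersurface $M$ is called \emph{stable} if $$\int_M\big(|\nabla f|^2-|\sigma|^2f^2\big)\,da-\int_{\partial M}q f^2\,ds\ \ge 0\qquad\text{for all } f\in H^1(M)\text{ with }\int_M f\,da=0 .$$ A \emph{Delaunay capillary hypersurface} in $B^{n+1}$ is a capillary hypersurface $M$ in $B^{n+1}$ that is generated by revolving a connected curve $\Gamma$ about the $x^1$-axis ($M$ being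 a closed $n$-ball if $\Gamma$ starts on the axis, and $[a,b]\times\mathbb S^{n-1}$ if $\Gamma$ does not meet the axis) and that is symmetric with respect to the hyperplane $\{x^1=0\}$ or is a portion of a hyperplane or of a round sphere. (By the classification of rotational hypersurfaces of constant mean curvature these are portions of unduloids, cylinders, nodoids, catenoids, spheres and hyperplanes.) Then a Delaunay capillary hypersurface $M$ in $B^{n+1}$ is stable if and only if it is a totally geodesic disk, that is, the intersection of a hyperplane with $\overline{B^{n+1}}$, or a spherical cap, that is, the intersection of a round sphere with $\overline{B^{n+1}}$. In particular, all the other Delaunay capillary hypersurfaces are unstable. -/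

import Mathlib

open MeasureTheory Filter Topology
open scoped ContDiff

noncomputable section

/-! ### The parameter domain

Every compact hypersurface of revolution with boundary is parametrized by a closed ball or by a
closed spherical shell of `ℝⁿ`.  Both are written `shell n a b`; the ball is the case `a = 0`. -/

/-- The closed shell `{y ∈ ℝⁿ : a ≤ |y| ≤ b}`. -/
def shell (n : ℕ) (a b : ℝ) : Set (EuclideanSpace ℝ (Fin n)) :=
  {y | a ≤ ‖y‖ ∧ ‖y‖ ≤ b}

/-- The Euclidean surface measure of the sphere of radius `r` centred at the origin of `ℝⁿ`:
the surface measure of the unit sphere, pushed forward by `w ↦ r w` and multiplied by `r ^ (n - 1)`.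
For `n ≥ 2` and `r = 0` it is the zero measure. -/
def sphereMeasure (n : ℕ) (r : ℝ) : Measure (EuclideanSpace ℝ (Fin n)) :=
  ENNReal.ofReal (r ^ (n - 1)) •
    Measure.map (fun w : Metric.sphere (0 : EuclideanSpace ℝ (Fin n)) 1 =>
        r • (w : EuclideanSpace ℝ (Fin n)))
      (volume : Measure (EuclideanSpace ℝ (Fin n))).toSphere

/-- The Euclidean surface measure of the boundary of `shell n a b`. -/
def shellBoundaryMeasure (n : ℕ) (a b : ℝ) : Measure (EuclideanSpace ℝ (Fin n)) :=
  sphereMeasure n a + sphereMeasure n b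

/-- The outward Euclidean unit normal of `shell n a b` at a boundary point `y`. -/
def shellNormal {n : ℕ} (b : ℝ) (y : EuclideanSpace ℝ (Fin n)) : EuclideanSpace ℝ (Fin n) :=
  if ‖y‖ = b then ‖y‖⁻¹ • y else -(‖y‖⁻¹ • y)

/-! ### Geometry of a hypersurface `x : ℝⁿ ⊇ shell → ℝⁿ⁺¹` with unit normal field `N` -/

/-- The `i`-th coordinate tangent vector field `∂ᵢ x`. -/
def coordTangent {n : ℕ} (x : EuclideanSpace ℝ (Fin n) → EuclideanSpace ℝ (Fin (n + 1)))
    (i : Fin n) (y : EuclideanSpace ℝ (Fin n)) : EuclideanSpace ℝ (Fin (n + 1)) :=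
  fderiv ℝ x y (EuclideanSpace.single i 1)

/-- The induced metric `gᵢⱼ = ⟨∂ᵢ x, ∂ⱼ x⟩`. -/
def metricMatrix {n : ℕ} (x : EuclideanSpace ℝ (Fin n) → EuclideanSpace ℝ (Fin (n + 1)))
    (y : EuclideanSpace ℝ (Fin n)) : Matrix (Fin n) (Fin n) ℝ :=
  Matrix.of fun i j => inner ℝ (coordTangent x i y) (coordTangent x j y)

/-- The second fundamental form `σᵢⱼ = ⟨D_{∂ᵢ x} ∂ⱼ x, N⟩`. -/
def secondFundMatrix {n : ℕ} (x N : EuclideanSpace ℝ (Fin n) → EuclideanSpace ℝ (Fin (n + 1)))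
    (y : EuclideanSpace ℝ (Fin n)) : Matrix (Fin n) (Fin n) ℝ :=
  Matrix.of fun i j =>
    inner ℝ (fderiv ℝ (coordTangent x j) y (EuclideanSpace.single i 1)) (N y)

/-- The mean curvature `H = (1/n) tr (g⁻¹ σ)`. -/
def meanCurvature {n : ℕ} (x N : EuclideanSpace ℝ (Fin n) → EuclideanSpace ℝ (Fin (n + 1)))
    (y : EuclideanSpace ℝ (Fin n)) : ℝ :=
  (n : ℝ)⁻¹ * ((metricMatrix x y)⁻¹ * secondFundMatrix x N y).trace

/-- The squared norm `|σ|² = tr ((g⁻¹ σ)²)` of the second fundamental form. -/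
def secondFundNormSq {n : ℕ} (x N : EuclideanSpace ℝ (Fin n) → EuclideanSpace ℝ (Fin (n + 1)))
    (y : EuclideanSpace ℝ (Fin n)) : ℝ :=
  (((metricMatrix x y)⁻¹ * secondFundMatrix x N y) *
    ((metricMatrix x y)⁻¹ * secondFundMatrix x N y)).trace

/-- The density of the area element `da` with respect to Lebesgue measure. -/
def areaDensity {n : ℕ} (x : EuclideanSpace ℝ (Fin n) → EuclideanSpace ℝ (Fin (n + 1)))
    (y : EuclideanSpace ℝ (Fin n)) : ℝ :=
  Real.sqrt (metricMatrix x y).det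

/-- `gⁱʲ Vᵢ Vⱼ`, the squared length in the induced metric of the covector with components `V`.
If `V` is the coordinate gradient of `f`, this is `|∇f|²`. -/
def covectorNormSq {n : ℕ} (x : EuclideanSpace ℝ (Fin n) → EuclideanSpace ℝ (Fin (n + 1)))
    (y V : EuclideanSpace ℝ (Fin n)) : ℝ :=
  V.ofLp ⬝ᵥ ((metricMatrix x y)⁻¹.mulVec V.ofLp)

/-- The density of the boundary element `ds` with respect to the Euclidean surface measure of the
boundary of the parameter domain: `√(det g) · √(gⁱʲ mᵢ mⱼ)`, with `m` the Euclidean normal. -/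
def boundaryDensity {n : ℕ} (b : ℝ)
    (x : EuclideanSpace ℝ (Fin n) → EuclideanSpace ℝ (Fin (n + 1)))
    (y : EuclideanSpace ℝ (Fin n)) : ℝ :=
  areaDensity x y * Real.sqrt (covectorNormSq x y (shellNormal b y))

/-- The components `uⁱ` of the outward unit conormal `ν = uⁱ ∂ᵢ x` of the boundary:
`u = g⁻¹ m / √(gⁱʲ mᵢ mⱼ)`, with `m` the Euclidean normal of the parameter domain. -/
def conormalCoord {n : ℕ} (b : ℝ)
    (x : EuclideanSpace ℝ (Fin n) → EuclideanSpace ℝ (Fin (n + 1)))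
    (y : EuclideanSpace ℝ (Fin n)) : Fin n → ℝ :=
  (Real.sqrt (covectorNormSq x y (shellNormal b y)))⁻¹ •
    (metricMatrix x y)⁻¹.mulVec (shellNormal b y).ofLp

/-- `σ(ν, ν)` at a boundary point. -/
def secondFundConormal {n : ℕ} (b : ℝ)
    (x N : EuclideanSpace ℝ (Fin n) → EuclideanSpace ℝ (Fin (n + 1)))
    (y : EuclideanSpace ℝ (Fin n)) : ℝ :=
  conormalCoord b x y ⬝ᵥ ((secondFundMatrix x N y).mulVec (conormalCoord b x y))

/-- `x` is a smooth immersion of `shell n a b` (up to the boundary) and `N` is a continuous unit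
normal field along it. -/
structure IsImmersedHypersurface (n : ℕ) (a b : ℝ)
    (x N : EuclideanSpace ℝ (Fin n) → EuclideanSpace ℝ (Fin (n + 1))) : Prop where
  smooth : ∃ U : Set (EuclideanSpace ℝ (Fin n)), IsOpen U ∧ shell n a b ⊆ U ∧ ContDiffOn ℝ ∞ x U
  immersion : ∀ y ∈ shell n a b, Function.Injective (fderiv ℝ x y)
  normal_continuous : ContinuousOn N (shell n a b)
  normal_unit : ∀ y ∈ shell n a b, ‖N y‖ = 1
  normal_orthogonal : ∀ y ∈ shell n a b, ∀ v, inner ℝ (fderiv ℝ x y v) (N y) = 0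

/-- `x` is a capillary hypersurface in the unit ball with contact angle `θ ∈ (0, π)`: its interior
lies in the open ball and its boundary on the unit sphere, the mean curvature is constant, and
along the boundary the unit normal `N` makes the constant angle `θ` with the outward unit normal
of the ball, which at a point `x y` of the unit sphere is `x y` itself. -/
structure IsCapillaryInBall (n : ℕ) (a b : ℝ)
    (x N : EuclideanSpace ℝ (Fin n) → EuclideanSpace ℝ (Fin (n + 1))) (θ : ℝ) : Prop
    extends IsImmersedHypersurface n a b x N where
  interior_mem : ∀ y ∈ interior (shell n a b), ‖x y‖ < 1
  boundary_mem : ∀ y ∈ frontier (shell n a b), ‖x y‖ = 1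
  cmc : ∃ H : ℝ, ∀ y ∈ shell n a b, meanCurvature x N y = H
  angle_pos : 0 < θ
  angle_lt_pi : θ < Real.pi
  contact_angle : ∀ y ∈ frontier (shell n a b), InnerProductGeometry.angle (N y) (x y) = θ

/-! ### Stability -/

/-- `f ∈ H¹`, with weak (coordinate) gradient `G` and boundary trace `τ`: the triple is the limit
in `L²` of the triples `(φ, ∇φ, φ|_∂)` of functions `φ` that are smooth up to the boundary.
As the induced metric is smooth and positive definite on the compact parameter domain,
`H¹` of the hypersurface is `H¹` of the parameter domain. -/
structure IsSobolevTriple (n : ℕ) (a b : ℝ) (f : EuclideanSpace ℝ (Fin n) → ℝ)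
    (G : EuclideanSpace ℝ (Fin n) → EuclideanSpace ℝ (Fin n))
    (τ : EuclideanSpace ℝ (Fin n) → ℝ) : Prop where
  memLp_fun : MemLp f 2 (volume.restrict (shell n a b))
  memLp_grad : MemLp G 2 (volume.restrict (shell n a b))
  memLp_trace : MemLp τ 2 (shellBoundaryMeasure n a b)
  approx : ∃ φ : ℕ → EuclideanSpace ℝ (Fin n) → ℝ, (∀ k, ContDiff ℝ ∞ (φ k)) ∧
    Tendsto (fun k => eLpNorm (fun y => φ k y - f y) 2 (volume.restrict (shell n a b)))
      atTop (𝓝 0) ∧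
    Tendsto (fun k => eLpNorm (fun y => gradient (φ k) y - G y) 2
      (volume.restrict (shell n a b))) atTop (𝓝 0) ∧
    Tendsto (fun k => eLpNorm (fun y => φ k y - τ y) 2 (shellBoundaryMeasure n a b))
      atTop (𝓝 0)

/-- The boundary coefficient `q = Π(ν̄, ν̄) / sin θ + cot θ · σ(ν, ν)`, where `Π(ν̄, ν̄) = 1` for the
unit sphere. -/
def boundaryCoeff {n : ℕ} (b : ℝ)
    (x N : EuclideanSpace ℝ (Fin n) → EuclideanSpace ℝ (Fin (n + 1))) (θ : ℝ)
    (y : EuclideanSpace ℝ (Fin n)) : ℝ :=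
  1 / Real.sin θ + Real.cos θ / Real.sin θ * secondFundConormal b x N y

/-- The second variation of energy
`∂²E(f) = ∫_M (|∇f|² - |σ|² f²) da - ∫_∂M q f² ds`
for `f ∈ H¹` with gradient `G` and trace `τ`; for smooth `f` it equals
`-∫_M (Δf + |σ|² f) f da + ∫_∂M (∂f/∂ν - q f) f ds`. -/
def secondVariation (n : ℕ) (a b : ℝ)
    (x N : EuclideanSpace ℝ (Fin n) → EuclideanSpace ℝ (Fin (n + 1))) (θ : ℝ)
    (f : EuclideanSpace ℝ (Fin n) → ℝ)
    (G : EuclideanSpace ℝ (Fin n) → EuclideanSpace ℝ (Fin n))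
    (τ : EuclideanSpace ℝ (Fin n) → ℝ) : ℝ :=
  (∫ y in shell n a b,
      (covectorNormSq x y (G y) - secondFundNormSq x N y * f y ^ 2) * areaDensity x y) -
    ∫ y, boundaryCoeff b x N θ y * τ y ^ 2 * boundaryDensity b x y ∂(shellBoundaryMeasure n a b)

/-- (Weak) stability: `∂²E(f) ≥ 0` for all `f ∈ H¹(M)` with `∫_M f da = 0`. -/
def IsStable (n : ℕ) (a b : ℝ)
    (x N : EuclideanSpace ℝ (Fin n) → EuclideanSpace ℝ (Fin (n + 1))) (θ : ℝ) : Prop :=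
  ∀ f G τ, IsSobolevTriple n a b f G τ →
    ∫ y in shell n a b, f y * areaDensity x y = 0 →
    0 ≤ secondVariation n a b x N θ f G τ

/-! ### Delaunay capillary hypersurfaces -/

/-- The hypersurface of revolution about the first coordinate axis generated by the curve
`s ↦ (p s, r s)`, in polar coordinates `y = s w` of the parameter domain:
`s w ↦ (p s, r s • w)`. -/
def revolve {n : ℕ} (p r : ℝ → ℝ) (y : EuclideanSpace ℝ (Fin n)) :
    EuclideanSpace ℝ (Fin (n + 1)) :=
  WithLp.toLp 2 (Fin.cons (p ‖y‖) fun i => r ‖y‖ * (y i / ‖y‖))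

/-- The reflection of `ℝⁿ⁺¹` in the hyperplane `{x¹ = 0}`. -/
def reflectFirst {n : ℕ} (z : EuclideanSpace ℝ (Fin (n + 1))) : EuclideanSpace ℝ (Fin (n + 1)) :=
  z - (2 * z 0) • EuclideanSpace.single 0 1

/-- The immersed hypersurface `x` is symmetric with respect to the hyperplane `{x¹ = 0}`. -/
def IsSymmetric (n : ℕ) (a b : ℝ)
    (x : EuclideanSpace ℝ (Fin n) → EuclideanSpace ℝ (Fin (n + 1))) : Prop :=
  ∃ ρ : shell n a b ≃ₜ shell n a b, ∀ y : shell n a b, x (ρ y) = reflectFirst (x y)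

/-- A Delaunay capillary hypersurface in the unit ball: a capillary hypersurface generated by
revolving about the `x¹`-axis a curve `(p, r)`, parametrized by arc length, that lies
in the open upper half-plane (except for its initial point when `a = 0`, where it touches the axis);
it is symmetric with respect to `{x¹ = 0}`, or else is a portion of a hyperplane or of a sphere. -/
structure IsDelaunayCapillary (n : ℕ) (a b : ℝ) (p r : ℝ → ℝ)
    (N : EuclideanSpace ℝ (Fin n) → EuclideanSpace ℝ (Fin (n + 1))) (θ : ℝ) : Prop where
  capillary : IsCapillaryInBall n a b (revolve p r) N θ
  radius_pos : ∀ s ∈ Set.Icc a b, 0 < s → 0 < r s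
  arc_length : ∀ s ∈ Set.Ioo a b, deriv p s ^ 2 + deriv r s ^ 2 = 1
  type : IsSymmetric n a b (revolve p r) ∨
    (∃ (v : EuclideanSpace ℝ (Fin (n + 1))) (c : ℝ), v ≠ 0 ∧
      ∀ y ∈ shell n a b, inner ℝ v (revolve p r y) = c) ∨
    (∃ (z₀ : EuclideanSpace ℝ (Fin (n + 1))) (R : ℝ), 0 < R ∧
      ∀ y ∈ shell n a b, dist (revolve p r y) z₀ = R)

/-- The hypersurface is the full part, inside the closed unit ball, of a hyperplane. -/
def IsTotallyGeodesicDisk (n : ℕ) (a b : ℝ)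
    (x : EuclideanSpace ℝ (Fin n) → EuclideanSpace ℝ (Fin (n + 1))) : Prop :=
  ∃ (v : EuclideanSpace ℝ (Fin (n + 1))) (c : ℝ), v ≠ 0 ∧
    x '' shell n a b = {z | inner ℝ v z = c} ∩ Metric.closedBall 0 1

/-- The hypersurface is the full part, inside the closed unit ball, of a round sphere. -/
def IsSphericalCap (n : ℕ) (a b : ℝ)
    (x : EuclideanSpace ℝ (Fin n) → EuclideanSpace ℝ (Fin (n + 1))) : Prop :=
  ∃ (z₀ : EuclideanSpace ℝ (Fin (n + 1))) (R : ℝ), 0 < R ∧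
    x '' shell n a b = Metric.sphere z₀ R ∩ Metric.closedBall 0 1

end

/-! ### Tensorization of the variance -/

/-! The generating curve either stays off the axis (`0 < a`) or starts on it (`a = 0`). In the first
case both sides of the equivalence are false, in the second both are true.

Off the axis. A rotation of ℝⁿ⁺¹ mixing the axis with the j-th direction preserves the ball, so the
normal component of its velocity is a Jacobi field satisfying the Robin boundary condition. In polar
coordinates y = s w this field is, up to sign, u(s) wⱼ with u = p p' + r r' = ½(|x|²)'. Concretely,
u solves the Jacobi equation of degree one (`IsDelaunayProfile.hasDerivAt_jacobi`), takes the values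
-sin θ and sin θ at the two ends because |x| is maximal there, and q = u'/sin θ on the boundary;
thus the index form vanishes on u wⱼ. As u changes sign, |u| wⱼ heuristically has index zero too
without being a smooth Jacobi field, and rounding it to √(u² + η²) wⱼ lowers the index form: after
summation over j it is negative for a suitable η (`exists_jacobi_perturbation_neg`). These functions
are odd in w, hence have mean zero, and M is unstable (`IsDelaunayCapillary.not_isStable`). Nor can
M be a disk or a cap: a full disk or cap that is invariant under w ↦ -w contains a point of the
axis.

On the axis. The first integral rⁿ⁻¹p' - k rⁿ, with c = n k, vanishes because r → 0, so p' = k r and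
the curve is a segment or a circular arc (`IsDelaunayProfile.eq_cap`). On it |x|² is an increasing
affine function of the primitive ρ of the radius R, whence M is the whole part of the hyperplane or
sphere inside the ball.

Stability of caps. By density only smooth functions matter (`isStable_of_contDiff`). On each sphere
s = const a function splits into its mean A and a remainder with variance V. The remainder is
controlled by the Poincaré inequality of the sphere together with the Jacobi field R wⱼ, which
already satisfies the Robin condition. For the mean part, let g be the radial solution of the
inhomogeneous Jacobi equation with constant right-hand side and the Robin condition; it is
orthogonal, for the index form, to every function of mean zero. Subtracting the multiple c g that
makes B = A - c g vanish at the boundary, or at the equator for caps larger than a hemisphere,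
leaves a function whose index form is nonnegative by comparison with the Jacobi field R'
(`cap_inequality`).

The Poincaré inequality on the sphere, with sharp constant n - 1, comes from Gauss space: the
one-dimensional Gaussian Poincaré inequality is tensorized by Efron–Stein and applied to the
degree-one extension ‖x‖ ψ(x/‖x‖), for which the radial integrals factor out with ratio n. -/

open ProbabilityTheory in
theorem memLp_two_section {α β : Type*} [MeasurableSpace α] [MeasurableSpace β]
    {μ : Measure α} {ν : Measure β} [IsProbabilityMeasure μ] [IsProbabilityMeasure ν]
    {F : α × β → ℝ} (hF : MemLp F 2 (μ.prod ν)) :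
    ∀ᵐ x ∂μ, MemLp (fun y => F (x, y)) 2 ν := by
  filter_upwards [hF.integrable_sq.prod_right_ae, hF.aestronglyMeasurable.prodMk_left] with x h1 h2
  exact (memLp_two_iff_integrable_sq h2).2 h1

open ProbabilityTheory in
theorem memLp_two_marginal {α β : Type*} [MeasurableSpace α] [MeasurableSpace β]
    {μ : Measure α} {ν : Measure β} [IsProbabilityMeasure μ] [IsProbabilityMeasure ν]
    {F : α × β → ℝ} (hF : MemLp F 2 (μ.prod ν)) :
    MemLp (fun x => ∫ y, F (x, y) ∂ν) 2 μ := by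
  have hm : AEStronglyMeasurable (fun x => ∫ y, F (x, y) ∂ν) μ :=
    hF.aestronglyMeasurable.integral_prod_right'
  rw [memLp_two_iff_integrable_sq hm]
  refine (hF.integrable_sq.integral_prod_left).mono' (hm.pow 2) ?_
  filter_upwards [memLp_two_section hF] with x hx
  have h := variance_nonneg (fun y => F (x, y)) ν
  rw [variance_eq_sub hx] at h
  simp only [Pi.pow_apply] at h
  rw [Real.norm_of_nonneg (sq_nonneg _)]
  linarith

open ProbabilityTheory in
theorem integral_variance_section {α β : Type*} [MeasurableSpace α] [MeasurableSpace β]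
    {μ : Measure α} {ν : Measure β} [IsProbabilityMeasure μ] [IsProbabilityMeasure ν]
    {F : α × β → ℝ} (hF : MemLp F 2 (μ.prod ν)) :
    ∫ x, Var[fun y => F (x, y); ν] ∂μ =
      ∫ z, F z ^ 2 ∂(μ.prod ν) - ∫ x, (∫ y, F (x, y) ∂ν) ^ 2 ∂μ := by
  have h1 : ∀ᵐ x ∂μ, Var[fun y => F (x, y); ν] =
      (∫ y, F (x, y) ^ 2 ∂ν) - (∫ y, F (x, y) ∂ν) ^ 2 := by
    filter_upwards [memLp_two_section hF] with x hx
    rw [variance_eq_sub hx]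
    simp
  rw [integral_congr_ae h1, integral_sub hF.integrable_sq.integral_prod_left
    (memLp_two_marginal hF).integrable_sq, integral_prod _ hF.integrable_sq]

open ProbabilityTheory in
/-- The variance of a function of two independent variables is at most the sum of the mean
variances in each variable. -/
theorem variance_prod_le {α β : Type*} [MeasurableSpace α] [MeasurableSpace β]
    {μ : Measure α} {ν : Measure β} [IsProbabilityMeasure μ] [IsProbabilityMeasure ν]
    {F : α × β → ℝ} (hF : MemLp F 2 (μ.prod ν)) :
    Var[F; μ.prod ν] ≤
      ∫ y, Var[fun x => F (x, y); μ] ∂ν + ∫ x, Var[fun y => F (x, y); ν] ∂μ := by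
  have hs : MemLp (F ∘ Prod.swap) 2 (ν.prod μ) :=
    hF.comp_measurePreserving Measure.measurePreserving_swap
  have e1 := integral_variance_section hF
  have e2 := integral_variance_section hs
  have e3 : ∫ z, (F ∘ Prod.swap) z ^ 2 ∂(ν.prod μ) = ∫ z, F z ^ 2 ∂(μ.prod ν) :=
    integral_prod_swap (fun z => F z ^ 2)
  rw [e3] at e2
  simp only [Function.comp_apply, Prod.swap_prod_mk] at e2
  rw [e1, e2, variance_eq_sub hF]
  simp only [Pi.pow_apply]
  set k : α → ℝ := fun x => ∫ y, F (x, y) ∂ν with hk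
  set h : β → ℝ := fun y => ∫ x, F (x, y) ∂μ with hh
  set m : ℝ := ∫ z, F z ∂(μ.prod ν) with hm
  have hk2 : MemLp k 2 μ := memLp_two_marginal hF
  have hh2 : MemLp h 2 ν := memLp_two_marginal hs
  have hkP : MemLp (fun z : α × β => k z.1) 2 (μ.prod ν) := hk2.comp_fst ν
  have hhP : MemLp (fun z : α × β => h z.2) 2 (μ.prod ν) := hh2.comp_snd μ
  have hFi : Integrable F (μ.prod ν) := hF.integrable (by norm_num)
  have mk : ∫ x, k x ∂μ = m := (integral_prod _ hFi).symm
  have mh : ∫ y, h y ∂ν = m := (integral_prod_symm _ hFi).symm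
  have Fk : ∫ z, F z * k z.1 ∂(μ.prod ν) = ∫ x, k x ^ 2 ∂μ := by
    rw [integral_prod _ (show Integrable (fun z => F z * k z.1) _ from hF.integrable_mul hkP)]
    refine integral_congr_ae (Eventually.of_forall fun x => ?_)
    simp only
    rw [integral_mul_const]
    ring
  have Fh : ∫ z, F z * h z.2 ∂(μ.prod ν) = ∫ y, h y ^ 2 ∂ν := by
    rw [integral_prod_symm _ (show Integrable (fun z => F z * h z.2) _ from hF.integrable_mul hhP)]
    refine integral_congr_ae (Eventually.of_forall fun x => ?_)
    simp only
    rw [integral_mul_const]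
    ring
  have kh : ∫ z, k z.1 * h z.2 ∂(μ.prod ν) = m ^ 2 := by
    rw [integral_prod_mul, mk, mh]; ring
  have kk : ∫ z, k z.1 ^ 2 ∂(μ.prod ν) = ∫ x, k x ^ 2 ∂μ := by
    rw [integral_fun_fst (fun x => k x ^ 2)]; simp
  have hh' : ∫ z, h z.2 ^ 2 ∂(μ.prod ν) = ∫ y, h y ^ 2 ∂ν := by
    rw [integral_fun_snd (fun x => h x ^ 2)]; simp
  -- Nonnegativity of the variance of F - k - h is the whole inequality. Its mean is -m and all
  -- mixed moments reduce by Fubini to those of k, h and m.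
  have expand : ∫ z, (F z - k z.1 - h z.2) ^ 2 ∂(μ.prod ν) =
      ∫ z, F z ^ 2 ∂(μ.prod ν) - ∫ x, k x ^ 2 ∂μ - ∫ y, h y ^ 2 ∂ν + 2 * m ^ 2 := by
    have i1 := hF.integrable_sq
    have i2 := hkP.integrable_sq
    have i3 := hhP.integrable_sq
    have i4 : Integrable (fun z => F z * k z.1) (μ.prod ν) := hF.integrable_mul hkP
    have i5 : Integrable (fun z => F z * h z.2) (μ.prod ν) := hF.integrable_mul hhP
    have i6 : Integrable (fun z => k z.1 * h z.2) (μ.prod ν) := hkP.integrable_mul hhP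
    have : ∀ z, (F z - k z.1 - h z.2) ^ 2 =
        (F z ^ 2 + (k z.1 ^ 2 + h z.2 ^ 2)) - (2 * (F z * k z.1) + (2 * (F z * h z.2) -
          2 * (k z.1 * h z.2))) := fun z => by ring
    simp_rw [this]
    rw [integral_sub, integral_add, integral_add, integral_add, integral_sub, integral_const_mul,
      integral_const_mul, integral_const_mul, Fk, Fh, kh, kk, hh']
    · ring
    all_goals first
      | exact i1 | exact i2 | exact i3 | exact i5.const_mul 2 | exact i6.const_mul 2
      | exact i4.const_mul 2 | exact i2.add i3 | exact (i5.const_mul 2).sub (i6.const_mul 2)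
      | exact i1.add (i2.add i3)
      | exact (i4.const_mul 2).add ((i5.const_mul 2).sub (i6.const_mul 2))
  have hL : MemLp (fun z => F z - k z.1 - h z.2) 2 (μ.prod ν) := (hF.sub hkP).sub hhP
  have mean : ∫ z, (F z - k z.1 - h z.2) ∂(μ.prod ν) = -m := by
    have j1 := hkP.integrable one_le_two
    have j2 := hhP.integrable one_le_two
    rw [integral_sub (show Integrable (fun z => F z - k z.1) _ from hFi.sub j1) j2,
      integral_sub hFi j1, integral_fun_fst k, integral_fun_snd h,
      mk, mh]
    simp [← hm]
  have v := variance_nonneg (fun z => F z - k z.1 - h z.2) (μ.prod ν)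
  rw [variance_eq_sub hL] at v
  simp only [Pi.pow_apply] at v
  rw [mean, expand] at v
  linarith

open ProbabilityTheory in
/-- **Efron–Stein**, in the form that bounds the variance by a sum of partial energies. -/
theorem variance_pi_le {Ω : Type*} [MeasurableSpace Ω] (γ : Measure Ω) [IsProbabilityMeasure γ] :
    ∀ (n : ℕ) (f : (Fin n → Ω) → ℝ) (G : Fin n → (Fin n → Ω) → ℝ),
      MemLp f 2 (Measure.pi fun _ => γ) →
      (∀ i, Integrable (G i) (Measure.pi fun _ => γ)) →
      (∀ i, ∀ᵐ x ∂(Measure.pi fun _ => γ), Var[fun t => f (Function.update x i t); γ] ≤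
        ∫ t, G i (Function.update x i t) ∂γ) →
      Var[f; Measure.pi fun _ => γ] ≤ ∑ i, ∫ x, G i x ∂(Measure.pi fun _ => γ) := by
  intro n
  induction n with
  | zero =>
    intro f G hf _ _
    rw [Measure.pi_of_empty (fun _ : Fin 0 => γ) Fin.elim0, variance_dirac]
    simp
  | succ n ih =>
    intro f G hf hG hV
    set π := Measure.pi fun _ : Fin n => γ with hπ
    have mp := (measurePreserving_piFinSuccAbove (fun _ : Fin (n + 1) => γ) 0).symm
    set e := (MeasurableEquiv.piFinSuccAbove (fun _ : Fin (n + 1) => Ω) 0).symm with he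
    have hecons : ∀ z, e z = Fin.cons z.1 z.2 := by
      intro z
      simp [he, MeasurableEquiv.piFinSuccAbove, Fin.insertNthEquiv]
    have hFm : MemLp (f ∘ e) 2 (γ.prod π) := hf.comp_measurePreserving mp
    have hGm : ∀ i, Integrable (G i ∘ e) (γ.prod π) := fun i =>
      (mp.integrable_comp_emb e.measurableEmbedding).2 (hG i)
    have hGi : ∀ i, ∫ x, G i x ∂(Measure.pi fun _ : Fin (n + 1) => γ) =
        ∫ z, (G i ∘ e) z ∂(γ.prod π) := fun i =>
      (mp.integral_comp e.measurableEmbedding (G i)).symm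
    have hvar : Var[f; Measure.pi fun _ : Fin (n + 1) => γ] = Var[f ∘ e; γ.prod π] := by
      rw [← mp.map_eq, variance_map]
      · rw [mp.map_eq]; exact hf.aestronglyMeasurable.aemeasurable
      · exact e.measurable.aemeasurable
    have hVp : ∀ i, ∀ᵐ z ∂(γ.prod π), Var[fun t => f (Function.update (e z) i t); γ] ≤
        ∫ t, G i (Function.update (e z) i t) ∂γ := fun i => mp.quasiMeasurePreserving.ae (hV i)
    rw [hvar, Fin.sum_univ_succ]
    refine (variance_prod_le hFm).trans (add_le_add ?_ ?_)
    · rw [hGi, integral_prod_symm _ (hGm 0)]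
      have h0 : ∀ᵐ y ∂π, Var[fun x => (f ∘ e) (x, y); γ] ≤ ∫ x, (G 0 ∘ e) (x, y) ∂γ := by
        have hsw : ∀ᵐ z ∂(π.prod γ), Var[fun t => f (Function.update (e z.swap) 0 t); γ] ≤
          ∫ t, G 0 (Function.update (e z.swap) 0 t) ∂γ :=
          Measure.measurePreserving_swap.quasiMeasurePreserving.ae (hVp 0)
        filter_upwards [Measure.ae_ae_of_ae_prod hsw] with y hy
        -- Updating coordinate 0 erases its old value, so the inequality for one good x is the
        -- inequality for the whole slice.
        obtain ⟨x, hx⟩ := hy.exists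
        simpa [hecons, Fin.cons_zero, Fin.update_cons_zero] using hx
      refine integral_mono_of_nonneg (Eventually.of_forall fun y => variance_nonneg _ _)
        (hGm 0).integral_prod_right h0
    · have hsum : ∑ i : Fin n, ∫ x, G i.succ x ∂(Measure.pi fun _ : Fin (n + 1) => γ) =
          ∫ x, ∑ i : Fin n, ∫ y, (G i.succ ∘ e) (x, y) ∂π ∂γ := by
        rw [integral_finsetSum _ fun i _ => (hGm i.succ).integral_prod_left]
        exact Finset.sum_congr rfl fun i _ => by rw [hGi, integral_prod _ (hGm i.succ)]
      rw [hsum]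
      have hall : ∀ᵐ x ∂γ, ∀ i : Fin n, Integrable (fun y => (G i.succ ∘ e) (x, y)) π :=
        ae_all_iff.2 fun i => (hGm i.succ).prod_right_ae
      have hall2 : ∀ᵐ x ∂γ, ∀ i : Fin n, ∀ᵐ y ∂π,
          Var[fun t => f (Function.update (e (x, y)) i.succ t); γ] ≤
            ∫ t, G i.succ (Function.update (e (x, y)) i.succ t) ∂γ :=
        ae_all_iff.2 fun i => Measure.ae_ae_of_ae_prod (hVp i.succ)
      refine integral_mono_of_nonneg (Eventually.of_forall fun y => variance_nonneg _ _)
        (integrable_finsetSum _ fun i _ => (hGm i.succ).integral_prod_left) ?_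
      filter_upwards [memLp_two_section hFm, hall, hall2] with x h1 h2 h3
      refine ih (fun y => (f ∘ e) (x, y)) (fun i y => (G i.succ ∘ e) (x, y)) h1 h2 fun i => ?_
      filter_upwards [h3 i] with y hy
      simpa [hecons, ← Fin.cons_update] using hy

/-! ### The Gaussian Poincaré inequality on the line -/

open ProbabilityTheory in
theorem hasDerivAt_gaussianPDFReal (x : ℝ) :
    HasDerivAt (gaussianPDFReal 0 1) (-x * gaussianPDFReal 0 1 x) x := by
  have h : HasDerivAt (fun x : ℝ => -(x - 0) ^ 2 / (2 * ((1 : NNReal) : ℝ))) (-x) x := by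
    have := (((hasDerivAt_id x).sub_const 0).pow 2).neg.div_const (2 * ((1 : NNReal) : ℝ))
    refine this.congr_deriv ?_
    simp [neg_div]
  have h2 := (h.exp).const_mul (√(2 * Real.pi * ((1 : NNReal) : ℝ)))⁻¹
  rw [gaussianPDFReal_def]
  refine h2.congr_deriv ?_
  ring

open ProbabilityTheory in
theorem integrable_mul_gaussianPDFReal {f : ℝ → ℝ} (hf : Continuous f) {C : ℝ}
    (hC : ∀ x, |f x| ≤ C * (1 + x ^ 2)) :
    Integrable (fun x => f x * gaussianPDFReal 0 1 x) := by
  have h1 : Integrable (fun x : ℝ => (1 + x ^ 2)) (gaussianReal 0 1) := by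
    have := (memLp_id_gaussianReal (μ := 0) (v := 1) 2).integrable_sq
    exact (integrable_const 1).add this
  have h2 : Integrable f (gaussianReal 0 1) := by
    refine (h1.const_mul C).mono' hf.aestronglyMeasurable (Eventually.of_forall fun x => ?_)
    exact hC x
  rw [gaussianReal_of_var_ne_zero _ one_ne_zero, integrable_withDensity_iff_integrable_smul'
    (measurable_gaussianPDF _ _) (ae_of_all _ fun _ ↦ gaussianPDF_lt_top)] at h2
  refine h2.congr (Eventually.of_forall fun x => ?_)
  simp [toReal_gaussianPDF, mul_comm]

open ProbabilityTheory in
-- The function x is an eigenfunction of the Ornstein–Uhlenbeck operator, positive on the half-line,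
-- so g can be compared with it: (g² φ / x)' is at most (g'² - g²) φ, the difference being the
-- square (g' - g/x)² φ. The boundary term is nonnegative at T and zero at 0.
theorem gaussian_halfLine_nonneg {g g' : ℝ → ℝ} (hg : ∀ x, HasDerivAt g (g' x) x)
    (hc : Continuous g') (h0 : g 0 = 0) {C : ℝ} (hC : ∀ x, |g' x| ≤ C) :
    Integrable (fun x => (g' x ^ 2 - g x ^ 2) * gaussianPDFReal 0 1 x) ∧
    0 ≤ ∫ x in Set.Ioi 0, (g' x ^ 2 - g x ^ 2) * gaussianPDFReal 0 1 x := by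
  have hC0 : 0 ≤ C := (abs_nonneg _).trans (hC 0)
  have hgc : Continuous g := continuous_iff_continuousAt.2 fun x => (hg x).continuousAt
  have hgx : ∀ x, |g x| ≤ C * |x| := by
    intro x
    have := Convex.norm_image_sub_le_of_norm_hasDerivWithin_le (f := g) (f' := g') (s := Set.univ)
      (x := 0) (y := x) (C := C) (fun y _ => (hg y).hasDerivWithinAt) (fun y _ => hC y) convex_univ
      (Set.mem_univ _) (Set.mem_univ _)
    simpa [h0] using this
  have hgx2 : ∀ x, g x ^ 2 ≤ C ^ 2 * x ^ 2 := fun x => by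
    have := mul_self_le_mul_self (abs_nonneg _) (hgx x)
    rw [abs_mul_abs_self] at this
    have h3 := abs_mul_abs_self x
    nlinarith
  have hgx' : ∀ x, g' x ^ 2 ≤ C ^ 2 := fun x => by
    rw [← sq_abs]; exact pow_le_pow_left₀ (abs_nonneg _) (hC x) 2
  set φ := gaussianPDFReal 0 1 with hφ
  have hφc : Continuous φ :=
    continuous_iff_continuousAt.2 fun x => (hasDerivAt_gaussianPDFReal x).continuousAt
  have hφ0 : ∀ x, 0 ≤ φ x := gaussianPDFReal_nonneg 0 1
  have hint : Integrable (fun x => (g' x ^ 2 - g x ^ 2) * φ x) := by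
    refine integrable_mul_gaussianPDFReal (C := C ^ 2) (by fun_prop) fun x => ?_
    rw [abs_le]
    constructor <;> nlinarith [hgx2 x, hgx' x, sq_nonneg (g x), sq_nonneg (g' x), sq_nonneg C,
      mul_nonneg (sq_nonneg C) (sq_nonneg x)]
  refine ⟨hint, ?_⟩
  refine ge_of_tendsto (intervalIntegral_tendsto_integral_Ioi 0 hint.integrableOn tendsto_id) ?_
  filter_upwards [eventually_gt_atTop 0] with T hT
  simp only [id]
  have hmain := intervalIntegral.sub_le_integral_of_hasDeriv_right_of_le
    (g := fun x => g x ^ 2 * φ x / x)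
    (g' := fun x => (2 * g x * g' x / x - g x ^ 2 / x ^ 2 - g x ^ 2) * φ x)
    (φ := fun x => (g' x ^ 2 - g x ^ 2) * φ x) hT.le ?_ ?_ hint.integrableOn ?_
  · refine le_trans ?_ hmain
    simp only [h0]
    have : 0 ≤ g T ^ 2 * φ T / T := div_nonneg (mul_nonneg (sq_nonneg _) (hφ0 _)) hT.le
    simpa using this
  · intro x hx
    -- At 0 the quotient has the default value 0, which is also its limit because |g x| ≤ C |x|.
    rcases hx.1.eq_or_lt with rfl | hx0
    · refine ContinuousAt.continuousWithinAt ?_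
      unfold ContinuousAt
      simp only [div_zero]
      refine squeeze_zero_norm (a := fun x => C ^ 2 * |x| * φ x) (fun x => ?_) ?_
      · rw [Real.norm_eq_abs, abs_div, abs_mul, abs_of_nonneg (hφ0 x), abs_of_nonneg (sq_nonneg _)]
        rcases eq_or_ne x 0 with rfl | hx
        · simp
        · rw [div_le_iff₀ (abs_pos.2 hx)]
          have h3 := abs_mul_abs_self x
          have : g x ^ 2 * φ x ≤ C ^ 2 * x ^ 2 * φ x :=
            mul_le_mul_of_nonneg_right (hgx2 x) (hφ0 x)
          calc _ ≤ _ := this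
            _ = C ^ 2 * (|x| * |x|) * φ x := by rw [h3]; ring
            _ = _ := by ring
      · have : Continuous (fun x => C ^ 2 * |x| * φ x) := by fun_prop
        simpa using this.tendsto 0
    · exact (((hgc.pow 2).mul hφc).continuousAt.div continuousAt_id hx0.ne').continuousWithinAt
  · intro x hx
    have hx0 : x ≠ 0 := hx.1.ne'
    have := ((((hg x).pow 2).mul (hasDerivAt_gaussianPDFReal x)).div (hasDerivAt_id x) hx0)
    refine (this.congr_deriv ?_).hasDerivWithinAt
    simp only [id, Pi.pow_apply, Pi.mul_apply, ← hφ]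
    field_simp
    push_cast
    ring
  · intro x hx
    have hx0 : x ≠ 0 := hx.1.ne'
    refine mul_le_mul_of_nonneg_right ?_ (hφ0 x)
    have := sq_nonneg (g' x - g x / x)
    have e : (g' x - g x / x) ^ 2 = g' x ^ 2 - 2 * g x * g' x / x + g x ^ 2 / x ^ 2 := by
      field_simp
      ring
    linarith

open ProbabilityTheory in
/-- The **Gaussian Poincaré inequality** on the line. -/
theorem gaussianReal_variance_le {f f' : ℝ → ℝ} (hf : ∀ x, HasDerivAt f (f' x) x)
    (hc : Continuous f') {C : ℝ} (hC : ∀ x, |f' x| ≤ C) :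
    Var[f; gaussianReal 0 1] ≤ ∫ x, f' x ^ 2 ∂(gaussianReal 0 1) := by
  have hfc : Continuous f := continuous_iff_continuousAt.2 fun x => (hf x).continuousAt
  set g : ℝ → ℝ := fun x => f x - f 0 with hgdef
  have hg : ∀ x, HasDerivAt g (f' x) x := fun x => (hf x).sub_const _
  have hgn : ∀ x, HasDerivAt (fun x => g (-x)) (-f' (-x)) x := fun x => by
    refine ((hg (-x)).comp x (hasDerivAt_neg x)).congr_deriv ?_
    simp
  obtain ⟨hi, h1⟩ := gaussian_halfLine_nonneg hg hc (by simp [g]) hC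
  obtain ⟨_, h2⟩ := gaussian_halfLine_nonneg hgn (hc.comp continuous_neg).neg (by simp [g])
    (C := C) (fun x => by rw [abs_neg]; exact hC _)
  have hsym : ∀ x, gaussianPDFReal 0 1 (-x) = gaussianPDFReal 0 1 x := fun x => by
    simp [gaussianPDFReal_def]
  have e2 : ∫ x in Set.Ioi 0, ((-f' (-x)) ^ 2 - g (-x) ^ 2) * gaussianPDFReal 0 1 x =
      ∫ x in Set.Iic 0, (f' x ^ 2 - g x ^ 2) * gaussianPDFReal 0 1 x := by
    have := integral_comp_neg_Ioi 0 (fun x => (f' x ^ 2 - g x ^ 2) * gaussianPDFReal 0 1 x)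
    simpa [hsym] using this
  rw [e2] at h2
  have htot : 0 ≤ ∫ x, (f' x ^ 2 - g x ^ 2) * gaussianPDFReal 0 1 x := by
    rw [← intervalIntegral.integral_Iic_add_Ioi (b := (0 : ℝ)) hi.integrableOn hi.integrableOn]
    exact add_nonneg h2 h1
  have hgs : Var[f; gaussianReal 0 1] = Var[g; gaussianReal 0 1] :=
    (variance_sub_const hfc.aestronglyMeasurable _).symm
  rw [hgs]
  -- The variance is at most the second moment about any point. Centring at f 0 rather than at the
  -- mean makes g vanish at 0, as the two half-line inequalities require.
  refine (variance_le_expectation_sq (by fun_prop)).trans ?_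
  have hf'i : Integrable (fun x => f' x ^ 2 * gaussianPDFReal 0 1 x) := by
    refine integrable_mul_gaussianPDFReal (C := C ^ 2) (by fun_prop) fun x => ?_
    have := pow_le_pow_left₀ (abs_nonneg _) (hC x) 2
    rw [abs_pow]
    nlinarith [mul_nonneg (sq_nonneg C) (sq_nonneg x)]
  have hgi : Integrable (fun x => g x ^ 2 * gaussianPDFReal 0 1 x) :=
    (hf'i.sub hi).congr (Eventually.of_forall fun x => by simp only [Pi.sub_apply]; ring)
  rw [integral_gaussianReal_eq_integral_smul one_ne_zero,
    integral_gaussianReal_eq_integral_smul one_ne_zero]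
  have : ∫ x, (f' x ^ 2 - g x ^ 2) * gaussianPDFReal 0 1 x =
      (∫ x, f' x ^ 2 * gaussianPDFReal 0 1 x) - ∫ x, g x ^ 2 * gaussianPDFReal 0 1 x := by
    rw [← integral_sub hf'i hgi]
    exact integral_congr_ae (Eventually.of_forall fun x => by simp only; ring)
  rw [this] at htot
  simp only [smul_eq_mul, Pi.pow_apply, mul_comm (gaussianPDFReal 0 1 _)]
  linarith

/-! ### Polar coordinates -/

theorem integral_polar_aux {E : Type*} [NormedAddCommGroup E] [NormedSpace ℝ E]
    [FiniteDimensional ℝ E] [Nontrivial E] [MeasurableSpace E] [BorelSpace E] (μ : Measure E)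
    [μ.IsAddHaarMeasure] {F : E → ℝ} (hF : Integrable F μ) :
    Integrable (fun z : Metric.sphere (0 : E) 1 × Set.Ioi (0 : ℝ) => F ((z.2 : ℝ) • (z.1 : E)))
      (μ.toSphere.prod (.volumeIoiPow (Module.finrank ℝ E - 1))) ∧
    ∫ x, F x ∂μ = ∫ z : Metric.sphere (0 : E) 1 × Set.Ioi (0 : ℝ), F ((z.2 : ℝ) • (z.1 : E))
      ∂(μ.toSphere.prod (.volumeIoiPow (Module.finrank ℝ E - 1))) := by
  have mp := μ.measurePreserving_homeomorphUnitSphereProd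
  have emb := (homeomorphUnitSphereProd E).measurableEmbedding
  have hcomp : ∀ x : ({0}ᶜ : Set E), (((homeomorphUnitSphereProd E x).2 : ℝ) •
      ((homeomorphUnitSphereProd E x).1 : E)) = x := by
    intro x
    have : ‖(x : E)‖ ≠ 0 := norm_ne_zero_iff.2 x.2
    simp [smul_smul, this]
  constructor
  · rw [← mp.integrable_comp_emb emb]
    simp only [Function.comp_def, hcomp]
    have := (integrableOn_iff_comap_subtypeVal (μ := μ) (s := ({0}ᶜ : Set E)) (f := F)
      (measurableSet_singleton _).compl).1 hF.integrableOn
    exact this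
  · rw [← mp.integral_comp emb]
    simp only [hcomp]
    rw [integral_subtype_comap (measurableSet_singleton _).compl F, restrict_compl_singleton]

/-- Integration in polar coordinates. -/
theorem integral_polar {E : Type*} [NormedAddCommGroup E] [NormedSpace ℝ E]
    [FiniteDimensional ℝ E] [Nontrivial E] [MeasurableSpace E] [BorelSpace E] (μ : Measure E)
    [μ.IsAddHaarMeasure] {F : E → ℝ} (hF : Integrable F μ) :
    IntegrableOn (fun s : ℝ => s ^ (Module.finrank ℝ E - 1) *
      ∫ w : Metric.sphere (0 : E) 1, F (s • (w : E)) ∂μ.toSphere) (Set.Ioi 0) ∧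
    ∫ x, F x ∂μ = ∫ s in Set.Ioi (0 : ℝ), s ^ (Module.finrank ℝ E - 1) *
      ∫ w : Metric.sphere (0 : E) 1, F (s • (w : E)) ∂μ.toSphere := by
  obtain ⟨h1, h2⟩ := integral_polar_aux μ hF
  set k := Module.finrank ℝ E - 1
  have hmeas : Measurable fun r : Set.Ioi (0 : ℝ) => (r.1 ^ k).toNNReal :=
    (measurable_subtype_coe.pow_const _).real_toNNReal
  have h3 := h1.integral_prod_right
  simp only at h3
  constructor
  · rw [integrableOn_iff_comap_subtypeVal measurableSet_Ioi]
    rw [Measure.volumeIoiPow] at h3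
    simp only [ENNReal.ofReal] at h3
    rw [integrable_withDensity_iff_integrable_smul hmeas] at h3
    refine h3.congr (Eventually.of_forall fun s => ?_)
    simp only [Function.comp_apply]
    rw [NNReal.smul_def, Real.coe_toNNReal _ (pow_nonneg s.2.out.le _), smul_eq_mul]
  · rw [h2, integral_prod_symm _ h1, Measure.volumeIoiPow]
    simp only [ENNReal.ofReal]
    rw [integral_withDensity_eq_integral_smul hmeas,
      ← integral_subtype_comap measurableSet_Ioi fun s : ℝ => s ^ k *
      ∫ w : Metric.sphere (0 : E) 1, F (s • (w : E)) ∂μ.toSphere]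
    refine integral_congr_ae (Eventually.of_forall fun s => ?_)
    simp only
    rw [NNReal.smul_def, Real.coe_toNNReal _ (pow_nonneg s.2.out.le _), smul_eq_mul]

theorem hasFDerivAt_norm_of_ne_zero {E : Type*} [NormedAddCommGroup E] [InnerProductSpace ℝ E]
    {x : E} (hx : x ≠ 0) : HasFDerivAt (fun y : E => ‖y‖) (‖x‖⁻¹ • innerSL ℝ x) x := by
  have hn : ‖x‖ ≠ 0 := norm_ne_zero_iff.2 hx
  have h := ((hasStrictFDerivAt_norm_sq x).hasFDerivAt).sqrt (by positivity)
  simp only [Real.sqrt_sq (norm_nonneg _)] at h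
  refine h.congr_fderiv ?_
  ext v
  simp
  field_simp

/-! ### The Gaussian measure in polar coordinates -/

open ProbabilityTheory in
theorem pi_gaussianReal_eq_withDensity (n : ℕ) :
    Measure.pi (fun _ : Fin n => gaussianReal 0 1) =
      volume.withDensity fun x : Fin n → ℝ => ENNReal.ofReal (∏ i, gaussianPDFReal 0 1 (x i)) := by
  refine Measure.pi_eq fun s hs => ?_
  rw [withDensity_apply _ (MeasurableSet.univ_pi hs), volume_pi, Measure.restrict_pi_pi,
    ← ofReal_integral_eq_lintegral_ofReal, integral_fintype_prod_eq_prod,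
    ENNReal.ofReal_prod_of_nonneg]
  · exact Finset.prod_congr rfl fun i _ => (gaussianReal_apply_eq_integral 0 one_ne_zero _).symm
  · exact fun i _ => integral_nonneg fun x => gaussianPDFReal_nonneg 0 1 x
  · exact Integrable.fintype_prod fun i => (integrable_gaussianPDFReal 0 1).integrableOn
  · exact Eventually.of_forall fun x => Finset.prod_nonneg fun i _ => gaussianPDFReal_nonneg 0 1 _

open ProbabilityTheory in
theorem prod_gaussianPDFReal (n : ℕ) (y : EuclideanSpace ℝ (Fin n)) :
    ∏ i, gaussianPDFReal 0 1 (y i) = (√(2 * Real.pi))⁻¹ ^ n * Real.exp (-‖y‖ ^ 2 / 2) := by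
  simp only [gaussianPDFReal_def, Finset.prod_mul_distrib, Finset.prod_const, Finset.card_univ,
    Fintype.card_fin, ← Real.exp_sum, EuclideanSpace.norm_sq_eq]
  simp only [NNReal.coe_one, mul_one, sub_zero, ← Finset.sum_div, Finset.sum_neg_distrib,
    Real.norm_eq_abs, sq_abs]

open ProbabilityTheory in
/-- The Gaussian integral of a function that is homogeneous of degree `k`. -/
theorem integral_pi_gaussianReal_homogeneous {n : ℕ} (hn : 0 < n) (k : ℕ)
    (Ψ : EuclideanSpace ℝ (Fin n) → ℝ)
    (hint : Integrable (fun x : Fin n → ℝ => ‖WithLp.toLp 2 x‖ ^ k *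
      Ψ (‖WithLp.toLp 2 x‖⁻¹ • WithLp.toLp 2 x)) (Measure.pi fun _ => gaussianReal 0 1)) :
    ∫ x : Fin n → ℝ, ‖WithLp.toLp 2 x‖ ^ k * Ψ (‖WithLp.toLp 2 x‖⁻¹ • WithLp.toLp 2 x)
        ∂(Measure.pi fun _ => gaussianReal 0 1) =
      (√(2 * Real.pi))⁻¹ ^ n * (∫ s in Set.Ioi (0 : ℝ), s ^ (n - 1 + k) * Real.exp (-s ^ 2 / 2)) *
        ∫ w : Metric.sphere (0 : EuclideanSpace ℝ (Fin n)) 1, Ψ w ∂volume.toSphere := by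
  have : NeZero n := ⟨hn.ne'⟩
  set c := (√(2 * Real.pi))⁻¹ ^ n with hc
  set F : EuclideanSpace ℝ (Fin n) → ℝ := fun y => ‖y‖ ^ k * Ψ (‖y‖⁻¹ • y) with hFdef
  have hmeas : Measurable fun x : Fin n → ℝ => (∏ i, gaussianPDFReal 0 1 (x i)).toNNReal := by
    refine (Finset.measurable_prod _ fun i _ => ?_).real_toNNReal
    exact (measurable_gaussianPDFReal 0 1).comp (measurable_pi_apply i)
  have hpos : ∀ x : Fin n → ℝ, 0 ≤ ∏ i, gaussianPDFReal 0 1 (x i) := fun x =>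
    Finset.prod_nonneg fun i _ => gaussianPDFReal_nonneg 0 1 _
  have hprod : ∀ x : Fin n → ℝ, ((∏ i, gaussianPDFReal 0 1 (x i)).toNNReal) •
      F (WithLp.toLp 2 x) = (fun y => c * Real.exp (-‖y‖ ^ 2 / 2) * F y) (WithLp.toLp 2 x) := by
    intro x
    rw [NNReal.smul_def, Real.coe_toNNReal _ (hpos x), smul_eq_mul]
    have := prod_gaussianPDFReal n (WithLp.toLp 2 x)
    simp only at this
    rw [this]
  have mp := PiLp.volume_preserving_toLp (Fin n)
  have emb : MeasurableEmbedding (WithLp.toLp 2 : (Fin n → ℝ) → EuclideanSpace ℝ (Fin n)) :=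
    (MeasurableEquiv.toLp 2 (Fin n → ℝ)).measurableEmbedding
  change Integrable (fun x => F (WithLp.toLp 2 x)) _ at hint
  change ∫ x, F (WithLp.toLp 2 x) ∂_ = _
  rw [pi_gaussianReal_eq_withDensity] at hint ⊢
  simp only [ENNReal.ofReal] at hint ⊢
  rw [integrable_withDensity_iff_integrable_smul hmeas] at hint
  rw [integral_withDensity_eq_integral_smul hmeas]
  simp only [hprod] at hint ⊢
  have hint2 : Integrable (fun y : EuclideanSpace ℝ (Fin n) =>
      c * Real.exp (-‖y‖ ^ 2 / 2) * F y) := (mp.integrable_comp_emb emb).1 hint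
  rw [mp.integral_comp emb (fun y => c * Real.exp (-‖y‖ ^ 2 / 2) * F y),
    (integral_polar volume hint2).2, mul_assoc c, ← integral_mul_const, ← integral_const_mul]
  refine setIntegral_congr_fun measurableSet_Ioi fun s hs => ?_
  have hs0 : (0 : ℝ) < s := hs
  simp only [finrank_euclideanSpace, Fintype.card_fin]
  have : ∀ w : Metric.sphere (0 : EuclideanSpace ℝ (Fin n)) 1,
      c * Real.exp (-‖s • (w : EuclideanSpace ℝ (Fin n))‖ ^ 2 / 2) * F (s • w) =
      c * Real.exp (-s ^ 2 / 2) * s ^ k * Ψ w := by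
    intro w
    have hw : ‖s • (w : EuclideanSpace ℝ (Fin n))‖ = s := by
      simp [norm_smul, abs_of_pos hs0]
    simp only [hFdef, hw, smul_smul, inv_mul_cancel₀ hs0.ne', one_smul]
    ring
  simp only [this]
  rw [integral_const_mul]
  ring

/-- The recursion Γ(n/2 + 1) = (n/2) Γ(n/2). The factor n is the Gaussian second moment of the norm;
it becomes the constant n - 1 of the sphere once the radial derivative is subtracted. -/
theorem integral_pow_mul_exp_neg_sq_div_two_succ {n : ℕ} (hn : 0 < n) :
    0 < ∫ s in Set.Ioi (0 : ℝ), s ^ (n - 1) * Real.exp (-s ^ 2 / 2) ∧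
    ∫ s in Set.Ioi (0 : ℝ), s ^ (n - 1 + 2) * Real.exp (-s ^ 2 / 2) =
      n * ∫ s in Set.Ioi (0 : ℝ), s ^ (n - 1) * Real.exp (-s ^ 2 / 2) := by
  have key : ∀ m : ℕ, ∫ s in Set.Ioi (0 : ℝ), s ^ m * Real.exp (-s ^ 2 / 2) =
      (1 / 2 : ℝ) ^ (-((m : ℝ) + 1) / 2) * (1 / 2) * Real.Gamma (((m : ℝ) + 1) / 2) := by
    intro m
    rw [← integral_rpow_mul_exp_neg_mul_rpow two_pos
      (show (-1 : ℝ) < m by linarith [(Nat.cast_nonneg m : (0 : ℝ) ≤ m)]) (by norm_num : (0 : ℝ) < 1 / 2)]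
    refine setIntegral_congr_fun measurableSet_Ioi fun s hs => ?_
    simp only [Real.rpow_natCast, Real.rpow_two]
    congr 2
    ring
  have hn' : ((n - 1 : ℕ) : ℝ) = n - 1 := by
    rw [Nat.cast_sub hn]; simp
  have hnpos : (0 : ℝ) < n := by exact_mod_cast hn
  rw [key, key]
  push_cast
  rw [hn']
  have e1 : ((n : ℝ) - 1 + 2 + 1) / 2 = n / 2 + 1 := by ring
  have e2 : ((n : ℝ) - 1 + 1) / 2 = n / 2 := by ring
  have e3 : -((n : ℝ) - 1 + 2 + 1) / 2 = -((n : ℝ) - 1 + 1) / 2 - 1 := by ring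
  rw [e1, e2, e3, Real.Gamma_add_one (by positivity), Real.rpow_sub_one (by norm_num)]
  constructor
  · have := Real.Gamma_pos_of_pos (show (0 : ℝ) < n / 2 by positivity)
    positivity
  · ring

/-! ### The Poincaré inequality on the sphere -/

section SpherePoincare

variable {E : Type*} [NormedAddCommGroup E] [InnerProductSpace ℝ E]

/-- The gradient of `x ↦ ‖x‖ ψ (x / ‖x‖)`, as a function of `w = x / ‖x‖`. -/
noncomputable def homogeneousGradient [CompleteSpace E] (ψ : E → ℝ) (w : E) : E :=
  ψ w • w + (gradient ψ w - inner ℝ (gradient ψ w) w • w)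

/-- The gradient of a degree-one function depends only on x/‖x‖, so it is bounded and the Gaussian
inequality applies on every line that misses the origin. -/
theorem hasFDerivAt_homogeneous [CompleteSpace E] {ψ : E → ℝ} (hψ : ContDiff ℝ 1 ψ) {x : E}
    (hx : x ≠ 0) :
    HasFDerivAt (fun y => ‖y‖ * ψ (‖y‖⁻¹ • y))
      (innerSL ℝ (homogeneousGradient ψ (‖x‖⁻¹ • x))) x := by
  have hn : ‖x‖ ≠ 0 := norm_ne_zero_iff.2 hx
  have h1 := hasFDerivAt_norm_of_ne_zero hx
  have hinv : HasFDerivAt (fun y : E => ‖y‖⁻¹) (-(‖x‖ ^ 2)⁻¹ • (‖x‖⁻¹ • innerSL ℝ x)) x :=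
    (hasDerivAt_inv hn).comp_hasFDerivAt x h1
  have h2 : HasFDerivAt (fun y : E => ‖y‖⁻¹ • y) _ x := hinv.smul (hasFDerivAt_id x)
  have h3 : HasFDerivAt ψ (innerSL ℝ (gradient ψ (‖x‖⁻¹ • x))) (‖x‖⁻¹ • x) :=
    (hψ.differentiable one_ne_zero _).hasGradientAt.hasFDerivAt
  have h4 := h1.mul (HasFDerivAt.comp (f := fun y : E => ‖y‖⁻¹ • y) x h3 h2)
  refine h4.congr_fderiv ?_
  ext v
  simp only [homogeneousGradient, innerSL_apply_apply, inner_add_left, inner_sub_left,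
    real_inner_smul_left, add_apply, smul_apply,
    ContinuousLinearMap.comp_apply, ContinuousLinearMap.smulRight_apply, Function.comp_apply,
    ContinuousLinearMap.id_apply, inner_add_right,
    real_inner_smul_right, smul_eq_mul]
  field_simp
  ring

/-- The radial part ψ w • w and the tangential part of the gradient are orthogonal. -/
theorem norm_homogeneousGradient_sq [CompleteSpace E] (ψ : E → ℝ) {w : E} (hw : ‖w‖ = 1) :
    ‖homogeneousGradient ψ w‖ ^ 2 =
      ψ w ^ 2 + (‖gradient ψ w‖ ^ 2 - inner ℝ (gradient ψ w) w ^ 2) := by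
  have hww : inner ℝ w w = (1 : ℝ) := by rw [real_inner_self_eq_norm_sq, hw]; norm_num
  rw [← real_inner_self_eq_norm_sq, ← real_inner_self_eq_norm_sq]
  simp only [homogeneousGradient, inner_add_left, inner_sub_left, inner_add_right, inner_sub_right,
    real_inner_smul_left, real_inner_smul_right, hww, real_inner_comm w (gradient ψ w)]
  ring

theorem continuous_gradient [CompleteSpace E] {ψ : E → ℝ} (hψ : ContDiff ℝ 1 ψ) :
    Continuous (gradient ψ) := by
  unfold gradient
  exact (InnerProductSpace.toDual ℝ E).symm.continuous.comp (hψ.continuous_fderiv one_ne_zero)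

theorem continuous_homogeneousGradient [CompleteSpace E] {ψ : E → ℝ} (hψ : ContDiff ℝ 1 ψ) :
    Continuous (homogeneousGradient ψ) := by
  have h1 := continuous_gradient hψ
  have h2 := hψ.continuous
  unfold homogeneousGradient
  fun_prop

end SpherePoincare

theorem integral_sphere_const_mul_sub {α : Type*} [MeasurableSpace α] {μ : Measure α}
    [IsFiniteMeasure μ] {f : α → ℝ} (hf : Integrable f μ) (hf2 : Integrable (fun x => f x ^ 2) μ)
    (c : ℝ) : ∫ x, (f x - c) ^ 2 ∂μ =
      ∫ x, f x ^ 2 ∂μ - 2 * c * ∫ x, f x ∂μ + c ^ 2 * μ.real Set.univ := by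
  have : ∀ x, (f x - c) ^ 2 = f x ^ 2 - 2 * c * f x + c ^ 2 := fun x => by ring
  simp only [this]
  rw [integral_add (show Integrable (fun x => f x ^ 2 - 2 * c * f x) μ from
    hf2.sub (hf.const_mul _)) (integrable_const _),
    integral_sub hf2 (hf.const_mul _), integral_const_mul, integral_const]
  simp [mul_comm]

open ProbabilityTheory in
/-- The **Poincaré inequality** on the unit sphere of `ℝⁿ`, with its sharp constant `n - 1`. -/
theorem sphere_poincare_of_integral_eq_zero {n : ℕ} (hn : 2 ≤ n)
    {ψ : EuclideanSpace ℝ (Fin n) → ℝ} (hψ : ContDiff ℝ 1 ψ)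
    (h0 : ∫ w : Metric.sphere (0 : EuclideanSpace ℝ (Fin n)) 1, ψ w ∂volume.toSphere = 0) :
    ((n : ℝ) - 1) * ∫ w : Metric.sphere (0 : EuclideanSpace ℝ (Fin n)) 1, ψ w ^ 2
        ∂volume.toSphere ≤
      ∫ w : Metric.sphere (0 : EuclideanSpace ℝ (Fin n)) 1,
        (‖gradient ψ w‖ ^ 2 - inner ℝ (gradient ψ w) (w : EuclideanSpace ℝ (Fin n)) ^ 2)
        ∂volume.toSphere := by
  set γ := Measure.pi fun _ : Fin n => gaussianReal 0 1 with hγ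
  set Γ := homogeneousGradient ψ with hΓ
  have hΓc : Continuous Γ := continuous_homogeneousGradient hψ
  have hψc : Continuous ψ := hψ.continuous
  have hgc := continuous_gradient hψ
  have hcomp : IsCompact (Metric.sphere (0 : EuclideanSpace ℝ (Fin n)) 1) := isCompact_sphere _ _
  obtain ⟨C1, hC1⟩ := hcomp.exists_bound_of_continuousOn hψc.continuousOn
  obtain ⟨C2, hC2⟩ := hcomp.exists_bound_of_continuousOn hΓc.continuousOn
  have hnz : Nontrivial (Fin n) := Fin.nontrivial_iff_two_le.2 hn
  have hcoord : ∀ x : Fin n → ℝ, ∀ i, x i ≠ 0 → WithLp.toLp 2 x ≠ 0 := by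
    intro x i hi h
    exact hi (by simpa using congrArg (fun z : EuclideanSpace ℝ (Fin n) => z i) h)
  have hunit : ∀ y : EuclideanSpace ℝ (Fin n), y ≠ 0 →
      ‖y‖⁻¹ • y ∈ Metric.sphere (0 : EuclideanSpace ℝ (Fin n)) 1 := by
    intro y hy
    have := norm_ne_zero_iff.2 hy
    simp [norm_smul, this]
  have hae : ∀ i : Fin n, ∀ᵐ x ∂γ, x i ≠ 0 := by
    intro i
    have : ∀ᵐ t ∂(gaussianReal 0 1), t ≠ 0 := by
      have := nullSingletonClass_gaussianReal (μ := 0) (v := 1) one_ne_zero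
      simp [ae_iff]
    exact (Measure.quasiMeasurePreserving_eval (fun _ => gaussianReal 0 1) i).ae this
  have hne : ∀ᵐ x ∂γ, WithLp.toLp 2 x ≠ 0 := by
    filter_upwards [hae ⟨0, by omega⟩] with x hx using hcoord x _ hx
  set f : (Fin n → ℝ) → ℝ := fun x =>
    ‖WithLp.toLp 2 x‖ * ψ (‖WithLp.toLp 2 x‖⁻¹ • WithLp.toLp 2 x) with hf
  set G : Fin n → (Fin n → ℝ) → ℝ := fun i x =>
    (Γ (‖WithLp.toLp 2 x‖⁻¹ • WithLp.toLp 2 x) i) ^ 2 with hG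
  have hmW : Measurable fun x : Fin n → ℝ =>
      (‖WithLp.toLp 2 x‖⁻¹ • WithLp.toLp 2 x : EuclideanSpace ℝ (Fin n)) := by
    have : Measurable (WithLp.toLp 2 : (Fin n → ℝ) → EuclideanSpace ℝ (Fin n)) :=
      (MeasurableEquiv.toLp 2 (Fin n → ℝ)).measurable
    exact this.norm.inv.smul this
  have hmN : Measurable fun x : Fin n → ℝ => ‖(WithLp.toLp 2 x : EuclideanSpace ℝ (Fin n))‖ :=
    (MeasurableEquiv.toLp 2 (Fin n → ℝ)).measurable.norm
  have hfm : Measurable f := hmN.mul (hψc.measurable.comp hmW)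
  have hnormint : Integrable (fun x : Fin n → ℝ =>
      ‖(WithLp.toLp 2 x : EuclideanSpace ℝ (Fin n))‖ ^ 2) γ := by
    simp only [EuclideanSpace.norm_sq_eq, Real.norm_eq_abs, sq_abs]
    refine integrable_finsetSum _ fun i _ => ?_
    exact integrable_comp_eval (μ := fun _ : Fin n => gaussianReal 0 1) (i := i)
      (f := fun t : ℝ => t ^ 2) (memLp_id_gaussianReal (μ := 0) (v := 1) 2).integrable_sq
  have hfL : MemLp f 2 γ := by
    rw [memLp_two_iff_integrable_sq hfm.aestronglyMeasurable]
    refine (hnormint.const_mul (C1 ^ 2)).mono' (hfm.pow_const 2).aestronglyMeasurable ?_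
    filter_upwards [hne] with x hx
    have := hC1 _ (hunit _ hx)
    rw [Real.norm_eq_abs, abs_of_nonneg (sq_nonneg _), hf, mul_pow, mul_comm]
    refine mul_le_mul_of_nonneg_right ?_ (sq_nonneg _)
    rw [← sq_abs]
    exact pow_le_pow_left₀ (abs_nonneg _) this 2
  have hcoordle : ∀ (v : EuclideanSpace ℝ (Fin n)) i, |v i| ≤ ‖v‖ := fun v i =>
    PiLp.norm_apply_le v i
  have hGint : ∀ i, Integrable (G i) γ := by
    intro i
    have hm : Measurable (G i) := by
      have h : Continuous fun v : EuclideanSpace ℝ (Fin n) => (Γ v i) ^ 2 := by fun_prop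
      exact h.measurable.comp hmW
    refine (integrable_const (C2 ^ 2)).mono' hm.aestronglyMeasurable ?_
    filter_upwards [hne] with x hx
    rw [Real.norm_eq_abs, abs_of_nonneg (sq_nonneg _), hG]
    simp only
    rw [← sq_abs (Γ _ i)]
    exact pow_le_pow_left₀ (abs_nonneg _) ((hcoordle _ i).trans (hC2 _ (hunit _ hx))) 2
  have hslice : ∀ i, ∀ᵐ x ∂γ, Var[fun t => f (Function.update x i t); gaussianReal 0 1] ≤
      ∫ t, G i (Function.update x i t) ∂(gaussianReal 0 1) := by
    intro i
    -- A line in direction i misses the singularity at the origin as soon as another coordinate is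
    -- nonzero; such a coordinate exists because n ≥ 2.
    obtain ⟨j, hj⟩ := exists_ne i
    filter_upwards [hae j] with x hx
    set ℓ : ℝ → EuclideanSpace ℝ (Fin n) := fun t => WithLp.toLp 2 (Function.update x i t) with hℓ
    have hℓ0 : ∀ t, ℓ t ≠ 0 := fun t => hcoord _ j (by rwa [Function.update_of_ne hj])
    have hℓe : ∀ t, ℓ t = ℓ 0 + t • EuclideanSpace.single i (1 : ℝ) := by
      intro t
      ext k
      rcases eq_or_ne k i with rfl | hk
      · simp [hℓ]
      · simp [hℓ, hk]
    have hℓd : ∀ t, HasDerivAt ℓ (EuclideanSpace.single i (1 : ℝ)) t := by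
      intro t
      have h := ((hasDerivAt_id t).smul_const (EuclideanSpace.single i (1 : ℝ))).const_add (ℓ 0)
      rw [funext hℓe]
      simpa using h
    have hℓc : Continuous ℓ := continuous_iff_continuousAt.2 fun t => (hℓd t).continuousAt
    refine gaussianReal_variance_le (f := fun t => f (Function.update x i t))
      (f' := fun t => Γ (‖ℓ t‖⁻¹ • ℓ t) i) (C := C2) (fun t => ?_) ?_ fun t => ?_
    · have h := (hasFDerivAt_homogeneous hψ (hℓ0 t)).comp_hasDerivAt t (hℓd t)
      refine h.congr_deriv ?_
      simp [hΓ, innerSL_apply_apply, EuclideanSpace.inner_single_right]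
    · have h1 : Continuous fun t => ‖ℓ t‖⁻¹ • ℓ t :=
        (hℓc.norm.inv₀ fun t => norm_ne_zero_iff.2 (hℓ0 t)).smul hℓc
      have h2 : Continuous fun v : EuclideanSpace ℝ (Fin n) => Γ v i := by fun_prop
      exact h2.comp h1
    · exact (hcoordle _ i).trans (hC2 _ (hunit _ (hℓ0 t)))
  -- In polar coordinates this reads n ∫ψ² ≤ ∫ψ² + ∫|tangential gradient|², up to a common positive
  -- factor, the mean being zero by `h0`.
  have hES := variance_pi_le (gaussianReal 0 1) n f G hfL hGint hslice
  rw [variance_eq_sub hfL, ← integral_finsetSum _ fun i _ => hGint i] at hES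
  have hn0 : 0 < n := by omega
  obtain ⟨hapos, ha⟩ := integral_pow_mul_exp_neg_sq_div_two_succ hn0
  have hmean : ∫ x, f x ∂γ = 0 := by
    have hi : Integrable f γ := hfL.integrable one_le_two
    have := integral_pi_gaussianReal_homogeneous hn0 1 ψ (by simpa only [pow_one] using hi)
    simp only [pow_one, h0, mul_zero] at this
    exact this
  have hsq : ∫ x, (f ^ 2) x ∂γ = (√(2 * Real.pi))⁻¹ ^ n *
      (n * ∫ s in Set.Ioi (0 : ℝ), s ^ (n - 1) * Real.exp (-s ^ 2 / 2)) *
        ∫ w : Metric.sphere (0 : EuclideanSpace ℝ (Fin n)) 1, ψ w ^ 2 ∂volume.toSphere := by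
    rw [← ha]
    have e : ∀ x, (f ^ 2) x = ‖WithLp.toLp 2 x‖ ^ 2 *
        (fun v => ψ v ^ 2) (‖WithLp.toLp 2 x‖⁻¹ • WithLp.toLp 2 x) := fun x => by
      simp only [Pi.pow_apply, hf, mul_pow]
    have hi : Integrable (f ^ 2) γ := hfL.integrable_sq
    simp only [funext e] at hi ⊢
    exact integral_pi_gaussianReal_homogeneous hn0 2 (fun v => ψ v ^ 2) hi
  have hgrad : ∫ x, ∑ i, G i x ∂γ = (√(2 * Real.pi))⁻¹ ^ n *
      (∫ s in Set.Ioi (0 : ℝ), s ^ (n - 1) * Real.exp (-s ^ 2 / 2)) *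
        ∫ w : Metric.sphere (0 : EuclideanSpace ℝ (Fin n)) 1, ‖Γ w‖ ^ 2 ∂volume.toSphere := by
    have e : ∀ x, ∑ i, G i x = ‖WithLp.toLp 2 x‖ ^ 0 *
        (fun v => ‖Γ v‖ ^ 2) (‖WithLp.toLp 2 x‖⁻¹ • WithLp.toLp 2 x) := fun x => by
      simp only [hG, EuclideanSpace.norm_sq_eq (Γ _), Real.norm_eq_abs, sq_abs, pow_zero, one_mul]
    have hi : Integrable (fun x => ∑ i, G i x) γ := integrable_finsetSum _ fun i _ => hGint i
    simp only [funext e] at hi ⊢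
    exact integral_pi_gaussianReal_homogeneous hn0 0 (fun v => ‖Γ v‖ ^ 2) hi
  rw [hmean, hsq, hgrad] at hES
  have hsplit : ∫ w : Metric.sphere (0 : EuclideanSpace ℝ (Fin n)) 1, ‖Γ w‖ ^ 2
      ∂volume.toSphere = (∫ w : Metric.sphere (0 : EuclideanSpace ℝ (Fin n)) 1, ψ w ^ 2
      ∂volume.toSphere) + ∫ w : Metric.sphere (0 : EuclideanSpace ℝ (Fin n)) 1,
        (‖gradient ψ w‖ ^ 2 - inner ℝ (gradient ψ w) (w : EuclideanSpace ℝ (Fin n)) ^ 2)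
        ∂volume.toSphere := by
    rw [← integral_add]
    · exact integral_congr_ae (Eventually.of_forall fun w =>
        norm_homogeneousGradient_sq ψ (by simp))
    · exact Continuous.integrable_of_hasCompactSupport (by fun_prop)
        (HasCompactSupport.of_compactSpace _)
    · exact Continuous.integrable_of_hasCompactSupport (by fun_prop)
        (HasCompactSupport.of_compactSpace _)
  rw [hsplit] at hES
  set I1 := ∫ w : Metric.sphere (0 : EuclideanSpace ℝ (Fin n)) 1, ψ w ^ 2 ∂volume.toSphere
  set a := ∫ s in Set.Ioi (0 : ℝ), s ^ (n - 1) * Real.exp (-s ^ 2 / 2)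
  have hcpos : 0 < (√(2 * Real.pi))⁻¹ ^ n * a := by positivity
  refine le_of_mul_le_mul_left ?_ hcpos
  linarith

/-- The **Poincaré inequality** on the unit sphere of `ℝⁿ`, for functions of arbitrary mean. -/
theorem sphere_poincare {n : ℕ} (hn : 2 ≤ n)
    {ψ : EuclideanSpace ℝ (Fin n) → ℝ} (hψ : ContDiff ℝ 1 ψ) (c : ℝ)
    (hc : ∫ w : Metric.sphere (0 : EuclideanSpace ℝ (Fin n)) 1, ψ w ∂volume.toSphere =
      c * (volume : Measure (EuclideanSpace ℝ (Fin n))).toSphere.real Set.univ) :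
    ((n : ℝ) - 1) * (∫ w : Metric.sphere (0 : EuclideanSpace ℝ (Fin n)) 1, ψ w ^ 2
        ∂volume.toSphere -
        c ^ 2 * (volume : Measure (EuclideanSpace ℝ (Fin n))).toSphere.real Set.univ) ≤
      ∫ w : Metric.sphere (0 : EuclideanSpace ℝ (Fin n)) 1,
        (‖gradient ψ w‖ ^ 2 - inner ℝ (gradient ψ w) (w : EuclideanSpace ℝ (Fin n)) ^ 2)
        ∂volume.toSphere := by
  have hψc := hψ.continuous
  have hi : Integrable (fun w : Metric.sphere (0 : EuclideanSpace ℝ (Fin n)) 1 => ψ w)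
      volume.toSphere := Continuous.integrable_of_hasCompactSupport (by fun_prop)
        (HasCompactSupport.of_compactSpace _)
  have hi2 : Integrable (fun w : Metric.sphere (0 : EuclideanSpace ℝ (Fin n)) 1 => ψ w ^ 2)
      volume.toSphere := Continuous.integrable_of_hasCompactSupport (by fun_prop)
        (HasCompactSupport.of_compactSpace _)
  have h := sphere_poincare_of_integral_eq_zero hn (ψ := fun y => ψ y - c)
    (hψ.sub contDiff_const) (by
      rw [integral_sub hi (integrable_const _), hc, integral_const]; simp [mul_comm])
  rw [integral_sphere_const_mul_sub hi hi2, hc] at h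
  have hg : ∀ y, gradient (fun y => ψ y - c) y = gradient ψ y := fun y => by
    simp only [gradient, fderiv_sub_const]
  simp only [hg] at h
  refine le_trans (le_of_eq ?_) h
  ring

/-! ### The radial inequality behind the stability of spherical caps -/

/-- `R` is the radius of a spherical cap (of curvature `√K`) as a function of the distance to its
pole, up to the distance `b`; `ρ` is its primitive. -/
structure IsCapProfile (K b : ℝ) (R ρ : ℝ → ℝ) : Prop where
  curvature_nonneg : 0 ≤ K
  length_pos : 0 < b
  hasDerivAt_primitive : ∀ s, HasDerivAt ρ (R s) s
  hasDerivAt_radius : ∀ s, HasDerivAt R (1 - K * ρ s) s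
  primitive_zero : ρ 0 = 0
  radius_zero : R 0 = 0
  radius_pos : ∀ s ∈ Set.Ioc 0 b, 0 < R s

namespace IsCapProfile

variable {K b : ℝ} {R ρ : ℝ → ℝ}

/-- A conserved quantity of the system ρ' = R, R' = 1 - Kρ. Equivalently R'² + K R² = 1, the
Pythagorean identity for sine and cosine, in a form valid also for K = 0. -/
theorem radius_sq (h : IsCapProfile K b R ρ) (s : ℝ) : R s ^ 2 = 2 * ρ s - K * ρ s ^ 2 := by
  have hd : ∀ s, HasDerivAt (fun s => R s ^ 2 - (2 * ρ s - K * ρ s ^ 2)) 0 s := by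
    intro s
    have h1 := h.hasDerivAt_radius s
    have h2 := h.hasDerivAt_primitive s
    refine ((h1.pow 2).sub ((h2.const_mul 2).sub ((h2.pow 2).const_mul K))).congr_deriv ?_
    push_cast
    ring
  have := is_const_of_deriv_eq_zero (fun s => (hd s).differentiableAt) (fun s => (hd s).deriv) s 0
  simp only [h.radius_zero, h.primitive_zero] at this
  linarith

theorem continuous_radius (h : IsCapProfile K b R ρ) : Continuous R :=
  continuous_iff_continuousAt.2 fun s => (h.hasDerivAt_radius s).continuousAt

theorem continuous_primitive (h : IsCapProfile K b R ρ) : Continuous ρ :=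
  continuous_iff_continuousAt.2 fun s => (h.hasDerivAt_primitive s).continuousAt

theorem strictMonoOn_primitive (h : IsCapProfile K b R ρ) : StrictMonoOn ρ (Set.Icc 0 b) := by
  refine strictMonoOn_of_deriv_pos (convex_Icc 0 b) h.continuous_primitive.continuousOn ?_
  intro s hs
  rw [interior_Icc] at hs
  rw [(h.hasDerivAt_primitive s).deriv]
  exact h.radius_pos s ⟨hs.1, hs.2.le⟩

theorem primitive_pos (h : IsCapProfile K b R ρ) {s : ℝ} (hs : s ∈ Set.Ioc 0 b) : 0 < ρ s := by
  have := h.strictMonoOn_primitive ⟨le_rfl, h.length_pos.le⟩ ⟨hs.1.le, hs.2⟩ hs.1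
  rwa [h.primitive_zero] at this

end IsCapProfile

/-- At a simple zero of g the numerator vanishes to second order, so the quotient tends to 0, which
is also the value that division by zero assigns to it. -/
theorem continuousAt_sq_div {f g : ℝ → ℝ} {f' g' x : ℝ} (hf : HasDerivAt f f' x)
    (hg : HasDerivAt g g' x) (hfx : f x = 0) (hgx : g x ≠ 0 ∨ g' ≠ 0) :
    ContinuousAt (fun s => f s ^ 2 / g s) x := by
  by_cases hg0 : g x = 0
  · have hg' : g' ≠ 0 := hgx.resolve_left (not_not.2 hg0)
    rw [← continuousWithinAt_compl_self]
    have h1 := hasDerivAt_iff_tendsto_slope.1 hf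
    have h2 := hasDerivAt_iff_tendsto_slope.1 hg
    have h3 : Tendsto (fun s => s - x) (𝓝[≠] x) (𝓝 0) := by
      have : Tendsto (fun s => s - x) (𝓝 x) (𝓝 (x - x)) := tendsto_id.sub_const x
      rw [sub_self] at this
      exact this.mono_left nhdsWithin_le_nhds
    have h4 := (h3.mul (h1.pow 2)).div h2 hg'
    unfold ContinuousWithinAt
    simp only [hfx, hg0, zero_mul, zero_div, ne_eq, OfNat.ofNat_ne_zero, not_false_eq_true, zero_pow] at h4 ⊢
    refine h4.congr' ?_
    filter_upwards [self_mem_nhdsWithin] with s hs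
    have hs' : s - x ≠ 0 := sub_ne_zero.2 hs
    simp only [slope_def_field, hfx, hg0, sub_zero, Pi.div_apply]
    field_simp
  · exact (hf.continuousAt.pow 2).div hg.continuousAt hg0

/-! ### The index form of a cap in one radial variable. -/

section CapInequality

variable {k : ℕ} {K b : ℝ} {R ρ : ℝ → ℝ} {A A₁ V V₁ D I : ℝ → ℝ} {S₀ : ℝ}

/-- Comparison with the Jacobi field R wⱼ: the two sides differ by Rᵏ⁺¹ times the form D - l V₁ + l²
V at l = R'/R, the curvature terms cancelling by R'² + K R² = 1. The left side is the derivative of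
R' Rᵏ V. -/
theorem cap_tangential_pointwise (h : IsCapProfile K b R ρ) {s : ℝ} (hs : 0 < R s)
    (hD : ∀ l, 0 ≤ D s - l * V₁ s + l ^ 2 * V s) :
    -K * R s * R s ^ k * V s + (1 - K * ρ s) * (k * R s ^ (k - 1) * (1 - K * ρ s)) * V s +
        (1 - K * ρ s) * R s ^ k * V₁ s ≤
      R s ^ (k + 1) * (D s + (k + 1) * V s / R s ^ 2 - (k + 2) * K * V s) := by
  have hsq : (1 - K * ρ s) ^ 2 + K * R s ^ 2 = 1 := by rw [h.radius_sq]; ring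
  have hpk : (k : ℝ) * R s ^ (k - 1) = k * R s ^ k / R s := by
    rcases k with _ | k
    · simp
    · simp [pow_succ]; field_simp
  rw [hpk]
  set x := R s with hx
  set y := 1 - K * ρ s with hy
  have h1 := mul_nonneg (pow_nonneg hs.le (k + 1)) (hD (y / x))
  have e : x ^ (k + 1) * (D s + (k + 1) * V s / x ^ 2 - (k + 2) * K * V s) -
      (-K * x * x ^ k * V s + y * (k * x ^ k / x * y) * V s + y * x ^ k * V₁ s) =
      x ^ (k + 1) * (D s - y / x * V₁ s + (y / x) ^ 2 * V s) +
        (k + 1) * x ^ k / x * V s * (1 - (y ^ 2 + K * x ^ 2)) := by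
    field_simp
    ring
  rw [hsq] at e
  linarith

/-- The cross terms with g integrate exactly, since g solves the inhomogeneous Jacobi equation; for
B the comparison is with the Jacobi field y = R', and the two sides differ by the square (B' - B
y'/y)², where y' = -K R. The left side is the derivative of the radial part of the function E in
`cap_inequality`. -/
theorem cap_radial_pointwise {x y a a₁ B B₁ c g q : ℝ} (hx : 0 ≤ x) (hy : y ≠ 0)
    (ha : a = B + c * g) (ha₁ : a₁ = B₁ + c * (q * x)) (hg : 1 - K * g = q * y) :
    -K * (2 * B * B₁ * x ^ (k + 2) / y + B ^ 2 * ((k + 2) * x ^ (k + 1)) +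
          B ^ 2 * x ^ (k + 2) * (K * x) / y ^ 2) +
        q * ((k + 2) * x ^ (k + 1) * y * (2 * c * B + c ^ 2 * g) +
          x ^ (k + 2) * (2 * c * B₁ + c ^ 2 * (q * x))) ≤
      x ^ (k + 1) * (a₁ ^ 2 - (k + 2) * K * a ^ 2) -
        x ^ (k + 1) * (-2 * c * (k + 2) * a + c ^ 2 * (k + 2) * g) := by
  have h1 := mul_nonneg (pow_nonneg hx (k + 1)) (sq_nonneg (B₁ + K * B * x / y))
  have e : x ^ (k + 1) * (a₁ ^ 2 - (k + 2) * K * a ^ 2) -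
        x ^ (k + 1) * (-2 * c * (k + 2) * a + c ^ 2 * (k + 2) * g) -
      (-K * (2 * B * B₁ * x ^ (k + 2) / y + B ^ 2 * ((k + 2) * x ^ (k + 1)) +
          B ^ 2 * x ^ (k + 2) * (K * x) / y ^ 2) +
        q * ((k + 2) * x ^ (k + 1) * y * (2 * c * B + c ^ 2 * g) +
          x ^ (k + 2) * (2 * c * B₁ + c ^ 2 * (q * x)))) =
      x ^ (k + 1) * (B₁ + K * B * x / y) ^ 2 +
        (k + 2) * x ^ (k + 1) * (2 * c * B + c ^ 2 * g) * ((1 - K * g) - q * y) := by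
    rw [ha, ha₁]
    field_simp
    ring
  rw [hg] at e
  linarith

/-- The point at which the radial test function is made to vanish: the boundary if the cap is at
most a hemisphere, otherwise the equator. -/
theorem IsCapProfile.exists_equator (h : IsCapProfile K b R ρ) :
    ∃ t ∈ Set.Ioc 0 b, (∀ s ∈ Set.Ioo 0 t, 1 - K * ρ s ≠ 0) ∧
      (∀ s ∈ Set.Ioo t b, 1 - K * ρ s ≠ 0) ∧
      (1 - K * ρ t ≠ 0 ∨ -(K * R t) ≠ 0) ∧ (t = b ∨ 1 - K * ρ b < 0) ∧
      0 < ρ b + (1 - K * ρ b) * ρ t := by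
  have hK := h.curvature_nonneg
  have hb := h.length_pos
  have hbb : b ∈ Set.Ioc 0 b := ⟨hb, le_rfl⟩
  have hR := h.radius_sq b
  have hdis : ∀ t ∈ Set.Ioc 0 b, 1 - K * ρ t ≠ 0 ∨ -(K * R t) ≠ 0 := by
    intro t ht
    by_contra! hc
    have h1 := h.radius_pos t ht
    rcases mul_eq_zero.1 (neg_eq_zero.1 hc.2) with h2 | h2
    · rw [h2] at hc; simp at hc
    · exact h1.ne' h2
  by_cases hc : 0 ≤ 1 - K * ρ b
  · refine ⟨b, hbb, fun s hs => ?_, fun s hs => absurd hs.1 (not_lt.2 hs.2.le), hdis b hbb,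
      Or.inl rfl, ?_⟩
    · have h1 := h.strictMonoOn_primitive ⟨hs.1.le, hs.2.le⟩ ⟨hb.le, le_rfl⟩ hs.2
      rcases hK.eq_or_lt with h0 | h0
      · rw [← h0]; simp
      · have := mul_lt_mul_of_pos_left h1 h0
        intro h3; linarith
    · have := h.radius_pos b hbb
      have h2 : 0 < R b ^ 2 := by positivity
      nlinarith
  · push Not at hc
    have hK0 : 0 < K := by
      rcases hK.eq_or_lt with h0 | h0
      · rw [← h0] at hc; simp at hc; linarith
      · exact h0
    have hcont : ContinuousOn (fun s => 1 - K * ρ s) (Set.Icc 0 b) := by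
      have := h.continuous_primitive
      fun_prop
    obtain ⟨t, ht, ht0⟩ := intermediate_value_Icc' hb.le hcont
      (show (0 : ℝ) ∈ Set.Icc _ _ from ⟨hc.le, by simp [h.primitive_zero]⟩)
    simp only at ht0
    have htpos : 0 < t := by
      rcases ht.1.eq_or_lt with h0 | h0
      · rw [← h0, h.primitive_zero] at ht0; simp at ht0
      · exact h0
    refine ⟨t, ⟨htpos, ht.2⟩, fun s hs => ?_, fun s hs => ?_, hdis t ⟨htpos, ht.2⟩, Or.inr hc, ?_⟩
    · have h1 := h.strictMonoOn_primitive ⟨hs.1.le, hs.2.le.trans ht.2⟩ ht hs.2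
      have := mul_lt_mul_of_pos_left h1 hK0
      intro h3; linarith
    · have h1 := h.strictMonoOn_primitive ht ⟨ht.1.trans hs.1.le, hs.2.le⟩ hs.1
      have := mul_lt_mul_of_pos_left h1 hK0
      intro h3; linarith
    · have hp := h.primitive_pos ⟨htpos, ht.2⟩
      have : ρ b + (1 - K * ρ b) * ρ t = ρ t + ρ b * (1 - K * ρ t) := by ring
      rw [this, ht0]
      linarith

/-- Stability of spherical caps, in terms of the spherical mean `A` of a test function and of its
spherical variance `V`. -/
theorem cap_inequality (h : IsCapProfile K b R ρ) (hS₀ : 0 ≤ S₀)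
    (hA : ∀ s, HasDerivAt A (A₁ s) s) (hV : ∀ s, HasDerivAt V (V₁ s) s) (hV0 : V 0 = 0)
    (hD : ∀ s l, 0 ≤ D s - l * V₁ s + l ^ 2 * V s)
    (hI : ∀ s ∈ Set.Ioo 0 b, R s ^ (k + 1) * (D s + S₀ * A₁ s ^ 2 + (k + 1) * V s / R s ^ 2 -
      (k + 2) * K * (V s + S₀ * A s ^ 2)) ≤ I s)
    (hIint : IntegrableOn I (Set.Icc 0 b))
    (hmean : ∫ s in (0 : ℝ)..b, R s ^ (k + 1) * A s = 0) :
    (1 - K * ρ b) * R b ^ k * (V b + S₀ * A b ^ 2) ≤ ∫ s in (0 : ℝ)..b, I s := by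
  obtain ⟨t, ht, hne1, hne2, hnet, htb, hgt⟩ := h.exists_equator
  have hb := h.length_pos
  have hK := h.curvature_nonneg
  set q := 1 - K * ρ b with hq
  -- g solves g'' + (k+1)(R'/R) g' + (k+2) K g = k+2 with g'(b)/g(b) = q/R(b), so its cross term
  -- with a function A of weighted mean zero vanishes. The index form of A is then that of B = A - c
  -- g plus a nonnegative multiple of c² ∫ Rᵏ⁺¹ g. The choice of t ensures g t > 0, so c can be
  -- chosen to make B t = 0.
  set g : ℝ → ℝ := fun s => ρ b + q * ρ s with hg
  set c := A t / g t with hc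
  set B : ℝ → ℝ := fun s => A s - c * g s with hB
  have hBt : B t = 0 := by
    have : g t ≠ 0 := hgt.ne'
    simp only [hB, hc]
    field_simp
    ring
  have hgd : ∀ s, HasDerivAt g (q * R s) s := fun s =>
    ((h.hasDerivAt_primitive s).const_mul q).const_add _
  have hBd : ∀ s, HasDerivAt B (A₁ s - c * (q * R s)) s := fun s => (hA s).sub ((hgd s).const_mul c)
  have hyd : ∀ s, HasDerivAt (fun s => 1 - K * ρ s) (-(K * R s)) s := fun s =>
    ((h.hasDerivAt_primitive s).const_mul K).const_sub 1
  have hcA : Continuous A := continuous_iff_continuousAt.2 fun s => (hA s).continuousAt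
  have hcV : Continuous V := continuous_iff_continuousAt.2 fun s => (hV s).continuousAt
  have hcR := h.continuous_radius
  have hcρ := h.continuous_primitive
  have hcB : Continuous B := continuous_iff_continuousAt.2 fun s => (hBd s).continuousAt
  have hcg : Continuous g := continuous_iff_continuousAt.2 fun s => (hgd s).continuousAt
  -- The boundary terms of all the integrations by parts together: V against R, B against R', and
  -- the cross terms with g. It vanishes at 0, and E' ≤ J wherever R' ≠ 0.
  set E : ℝ → ℝ := fun s => (1 - K * ρ s) * R s ^ k * V s +
    S₀ * (-K * (B s ^ 2 / (1 - K * ρ s) * R s ^ (k + 2)) +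
      q * (R s ^ (k + 2) * (2 * c * B s + c ^ 2 * g s))) with hE
  set J : ℝ → ℝ := fun s => I s -
    S₀ * (R s ^ (k + 1) * (-2 * c * (k + 2) * A s + c ^ 2 * (k + 2) * g s)) with hJ
  have hEc : ∀ s, (s = t ∨ 1 - K * ρ s ≠ 0) → ContinuousAt E s := by
    intro s hs
    have h1 : ContinuousAt (fun s => B s ^ 2 / (1 - K * ρ s)) s := by
      rcases hs with rfl | hs
      · exact continuousAt_sq_div (hBd _) (hyd _) hBt hnet
      · exact ((hBd s).continuousAt.pow 2).div (hyd s).continuousAt hs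
    have h2 : ContinuousAt (fun s => (1 - K * ρ s) * R s ^ k * V s) s :=
      Continuous.continuousAt (by fun_prop)
    have h3 : ContinuousAt (fun s => q * (R s ^ (k + 2) * (2 * c * B s + c ^ 2 * g s))) s :=
      Continuous.continuousAt (by fun_prop)
    have h4 : ContinuousAt (fun s => R s ^ (k + 2)) s := Continuous.continuousAt (by fun_prop)
    exact h2.add ((((h1.mul h4).const_mul (-K)).add h3).const_mul S₀)
  have hcorr : Continuous fun s =>
      S₀ * (R s ^ (k + 1) * (-2 * c * (k + 2) * A s + c ^ 2 * (k + 2) * g s)) := by fun_prop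
  have hJint : IntegrableOn J (Set.Icc 0 b) := hIint.sub hcorr.integrableOn_Icc
  -- At the equator R' = 0 and E is only known to be continuous, so the interval is cut at t and the
  -- inequality E' ≤ J is used on the open pieces only.
  have step : ∀ α β, 0 ≤ α → α ≤ β → β ≤ b → (∀ s ∈ Set.Ioo α β, 1 - K * ρ s ≠ 0) →
      (∀ s ∈ Set.Icc α β, s = t ∨ 1 - K * ρ s ≠ 0) → E β - E α ≤ ∫ s in α..β, J s := by
    intro α β hα hαβ hβ hne hcl
    refine intervalIntegral.sub_le_integral_of_hasDeriv_right_of_le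
      (g' := fun s => (-K * R s * R s ^ k * V s +
        (1 - K * ρ s) * (k * R s ^ (k - 1) * (1 - K * ρ s)) * V s +
        (1 - K * ρ s) * R s ^ k * V₁ s) + S₀ *
        (-K * (2 * B s * (A₁ s - c * (q * R s)) * R s ^ (k + 2) / (1 - K * ρ s) +
          B s ^ 2 * ((k + 2) * R s ^ (k + 1)) +
          B s ^ 2 * R s ^ (k + 2) * (K * R s) / (1 - K * ρ s) ^ 2) +
        q * ((k + 2) * R s ^ (k + 1) * (1 - K * ρ s) * (2 * c * B s + c ^ 2 * g s) +
          R s ^ (k + 2) * (2 * c * (A₁ s - c * (q * R s)) + c ^ 2 * (q * R s))))) hαβ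
      (fun s hs => (hEc s (hcl s hs)).continuousWithinAt) ?_
      (hJint.mono_set (Set.Icc_subset_Icc hα hβ)) ?_
    · intro s hs
      have hy0 := hne s hs
      have d1 := ((hyd s).mul ((h.hasDerivAt_radius s).pow k)).mul (hV s)
      have d2 := ((((hBd s).pow 2).div (hyd s) hy0).mul
        ((h.hasDerivAt_radius s).pow (k + 2))).const_mul (-K)
      have d3 := (((h.hasDerivAt_radius s).pow (k + 2)).mul
        (((hBd s).const_mul (2 * c)).add ((hgd s).const_mul (c ^ 2)))).const_mul q
      refine ((d1.add ((d2.add d3).const_mul S₀)).congr_deriv ?_).hasDerivWithinAt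
      simp only [Pi.pow_apply, Pi.mul_apply, Pi.div_apply, Pi.add_apply]
      have e1 : k + 2 - 1 = k + 1 := rfl
      rw [e1]
      push_cast
      field_simp
      ring
    · intro s hs
      have hs' : s ∈ Set.Ioo 0 b := ⟨hα.trans_lt hs.1, hs.2.trans_le hβ⟩
      have hRs := h.radius_pos s ⟨hs'.1, hs'.2.le⟩
      have p1 := cap_tangential_pointwise (k := k) h hRs (hD s)
      have p2 := cap_radial_pointwise (k := k) (K := K) (x := R s) (y := 1 - K * ρ s) (a := A s)
        (a₁ := A₁ s) (B := B s) (B₁ := A₁ s - c * (q * R s)) (c := c) (g := g s) (q := q) hRs.le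
        (hne s hs) (by simp only [hB]; ring) (by ring) (by simp only [hg, hq]; ring)
      have p3 := mul_le_mul_of_nonneg_left p2 hS₀
      have p4 := hI s hs'
      simp only [hJ]
      have e : R s ^ (k + 1) * (D s + S₀ * A₁ s ^ 2 + (k + 1) * V s / R s ^ 2 -
          (k + 2) * K * (V s + S₀ * A s ^ 2)) =
          R s ^ (k + 1) * (D s + (k + 1) * V s / R s ^ 2 - (k + 2) * K * V s) +
          S₀ * (R s ^ (k + 1) * (A₁ s ^ 2 - (k + 2) * K * A s ^ 2)) := by ring
      rw [e] at p4
      linarith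
  have st1 := step 0 t le_rfl ht.1.le ht.2 hne1 fun s hs => by
    rcases hs.2.eq_or_lt with h0 | h0
    · exact Or.inl h0
    · right
      rcases hs.1.eq_or_lt with h1 | h1
      · rw [← h1, h.primitive_zero]; simp
      · exact hne1 s ⟨h1, h0⟩
  have st2 := step t b ht.1.le ht.2 le_rfl hne2 fun s hs => by
    rcases hs.1.eq_or_lt with h0 | h0
    · exact Or.inl h0.symm
    · right
      rcases hs.2.eq_or_lt with h1 | h1
      · rcases htb with h2 | h2
        · linarith
        · rw [h1]; exact h2.ne
      · exact hne2 s ⟨h0, h1⟩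
  have hJii : ∀ α β, 0 ≤ α → α ≤ β → β ≤ b → IntervalIntegrable J volume α β :=
    fun α β hα hαβ hβ => (intervalIntegrable_iff_integrableOn_Icc_of_le hαβ).2
      (hJint.mono_set (Set.Icc_subset_Icc hα hβ))
  have hadd := intervalIntegral.integral_add_adjacent_intervals
    (hJii 0 t le_rfl ht.1.le ht.2) (hJii t b ht.1.le ht.2 le_rfl)
  have hgint : 0 ≤ ∫ s in (0 : ℝ)..b, R s ^ (k + 1) * g s := by
    refine intervalIntegral.integral_nonneg hb.le fun s hs => mul_nonneg (pow_nonneg ?_ _) ?_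
    · rcases hs.1.eq_or_lt with h0 | h0
      · rw [← h0, h.radius_zero]
      · exact (h.radius_pos s ⟨h0, hs.2⟩).le
    · have hρs : ρ s ≤ ρ b := h.strictMonoOn_primitive.monotoneOn hs ⟨hb.le, le_rfl⟩ hs.2
      have hρ0 : 0 ≤ ρ s := by
        have := h.strictMonoOn_primitive.monotoneOn ⟨le_rfl, hb.le⟩ hs hs.1
        rwa [h.primitive_zero] at this
      have hRb := h.radius_sq b
      simp only [hg]
      rcases le_total 0 q with h0 | h0
      · have := mul_nonneg h0 hρ0
        linarith
      · have := mul_le_mul_of_nonpos_left hρs h0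
        have h2 : ρ b + q * ρ b = R b ^ 2 := by rw [hRb, hq]; ring
        nlinarith [sq_nonneg (R b)]
  have hJI : ∫ s in (0 : ℝ)..b, J s = (∫ s in (0 : ℝ)..b, I s) -
      S₀ * c ^ 2 * (k + 2) * ∫ s in (0 : ℝ)..b, R s ^ (k + 1) * g s := by
    have hIii : IntervalIntegrable I volume 0 b :=
      (intervalIntegrable_iff_integrableOn_Icc_of_le hb.le).2 hIint
    have hc1 : Continuous fun s => R s ^ (k + 1) * A s := by fun_prop
    have hc2 : Continuous fun s => R s ^ (k + 1) * g s := by fun_prop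
    rw [intervalIntegral.integral_sub hIii (hcorr.intervalIntegrable _ _)]
    have e : ∀ s, S₀ * (R s ^ (k + 1) * (-2 * c * (k + 2) * A s + c ^ 2 * (k + 2) * g s)) =
      (-2 * c * (k + 2) * S₀) * (R s ^ (k + 1) * A s) +
        (S₀ * c ^ 2 * (k + 2)) * (R s ^ (k + 1) * g s) := fun s => by ring
    simp only [e]
    rw [intervalIntegral.integral_add ((hc1.intervalIntegrable _ _).const_mul _)
      ((hc2.intervalIntegrable _ _).const_mul _), intervalIntegral.integral_const_mul,
      intervalIntegral.integral_const_mul, hmean]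
    ring
  have hE0 : E 0 = 0 := by
    simp [hE, hV0, h.radius_zero]
  have hRb := h.radius_pos b ⟨hb, le_rfl⟩
  have hgb : g b = R b ^ 2 := by simp only [hg]; rw [h.radius_sq, hq]; ring
  -- The excess of E b is S₀ (-K B(b)² Rᵏ⁺²/q - q Rᵏ B(b)²). It is zero when t = b, since then B b =
  -- 0, and both terms are nonnegative when the cap exceeds a hemisphere, since then q < 0.
  have hEb : q * R b ^ k * (V b + S₀ * A b ^ 2) ≤ E b := by
    have hAb : A b = B b + c * R b ^ 2 := by rw [← hgb]; simp only [hB]; ring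
    have e : E b - q * R b ^ k * (V b + S₀ * A b ^ 2) =
        S₀ * (-K * (B b ^ 2 / q * R b ^ (k + 2)) - q * R b ^ k * B b ^ 2) := by
      simp only [hE]
      rw [hAb, hgb, ← hq]
      ring
    have : 0 ≤ -K * (B b ^ 2 / q * R b ^ (k + 2)) - q * R b ^ k * B b ^ 2 := by
      rcases htb with h1 | h1
      · rw [← h1, hBt]; simp
      · have i1 : B b ^ 2 / q ≤ 0 := div_nonpos_of_nonneg_of_nonpos (sq_nonneg _) h1.le
        have i2 : B b ^ 2 / q * R b ^ (k + 2) ≤ 0 :=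
          mul_nonpos_of_nonpos_of_nonneg i1 (pow_nonneg hRb.le _)
        have i3 := mul_nonpos_of_nonneg_of_nonpos hK i2
        have i4 : q * R b ^ k * B b ^ 2 ≤ 0 := mul_nonpos_of_nonpos_of_nonneg
          (mul_nonpos_of_nonpos_of_nonneg h1.le (pow_nonneg hRb.le _)) (sq_nonneg _)
        linarith
    have := mul_nonneg hS₀ this
    linarith
  have hfin : 0 ≤ S₀ * c ^ 2 * (k + 2) * ∫ s in (0 : ℝ)..b, R s ^ (k + 1) * g s := by positivity
  linarith

end CapInequality

/-! ### Spherical means -/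

theorem hasDerivAt_integral_sphere {n : ℕ} {φ : EuclideanSpace ℝ (Fin n) → ℝ}
    (hφ : ContDiff ℝ 1 φ) (s : ℝ) :
    HasDerivAt (fun s : ℝ => ∫ w : Metric.sphere (0 : EuclideanSpace ℝ (Fin n)) 1,
      φ (s • (w : EuclideanSpace ℝ (Fin n))) ∂volume.toSphere)
      (∫ w : Metric.sphere (0 : EuclideanSpace ℝ (Fin n)) 1,
        inner ℝ (gradient φ (s • (w : EuclideanSpace ℝ (Fin n))))
          (w : EuclideanSpace ℝ (Fin n)) ∂volume.toSphere) s := by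
  have hc := hφ.continuous
  have hg := continuous_gradient hφ
  obtain ⟨C, hC⟩ := (isCompact_closedBall (0 : EuclideanSpace ℝ (Fin n))
    (|s| + 1)).exists_bound_of_continuousOn hg.continuousOn
  refine (hasDerivAt_integral_of_dominated_loc_of_deriv_le (bound := fun _ => C)
    (F' := fun t (w : Metric.sphere (0 : EuclideanSpace ℝ (Fin n)) 1) =>
      inner ℝ (gradient φ (t • (w : EuclideanSpace ℝ (Fin n)))) (w : EuclideanSpace ℝ (Fin n)))
    (Metric.ball_mem_nhds s one_pos)
    (Eventually.of_forall fun t => Continuous.aestronglyMeasurable (by fun_prop))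
    (Continuous.integrable_of_hasCompactSupport (by fun_prop) (HasCompactSupport.of_compactSpace _))
    (Continuous.aestronglyMeasurable (by fun_prop)) ?_ (integrable_const C) ?_).2
  · refine Eventually.of_forall fun w t ht => ?_
    have hw : ‖(w : EuclideanSpace ℝ (Fin n))‖ = 1 := by simp
    refine (norm_inner_le_norm _ _).trans ?_
    rw [hw, mul_one]
    refine hC _ ?_
    rw [mem_closedBall_zero_iff, norm_smul, hw, mul_one, Real.norm_eq_abs]
    have h1 : |t - s| < 1 := ht
    have h2 := abs_sub_abs_le_abs_sub t s
    linarith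
  · refine Eventually.of_forall fun w t _ => ?_
    have h1 : HasDerivAt (fun t : ℝ => t • (w : EuclideanSpace ℝ (Fin n)))
        (w : EuclideanSpace ℝ (Fin n)) t := by
      simpa using (hasDerivAt_id t).smul_const (w : EuclideanSpace ℝ (Fin n))
    have h2 := (hφ.differentiable one_ne_zero
      (t • (w : EuclideanSpace ℝ (Fin n)))).hasGradientAt.hasFDerivAt
    have h3 := h2.comp_hasDerivAt t h1
    refine h3.congr_deriv ?_
    simp

theorem gradient_sq {n : ℕ} {φ : EuclideanSpace ℝ (Fin n) → ℝ} (hφ : ContDiff ℝ 1 φ)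
    (y : EuclideanSpace ℝ (Fin n)) :
    gradient (fun y => φ y ^ 2) y = (2 * φ y) • gradient φ y := by
  have h := (hφ.differentiable one_ne_zero y).hasGradientAt.hasFDerivAt.pow 2
  refine HasGradientAt.gradient (hasGradientAt_iff_hasFDerivAt.2 (h.congr_fderiv ?_))
  simp

theorem gradient_comp_smul {n : ℕ} {φ : EuclideanSpace ℝ (Fin n) → ℝ} (hφ : ContDiff ℝ 1 φ)
    (s : ℝ) (y : EuclideanSpace ℝ (Fin n)) :
    gradient (fun y => φ (s • y)) y = s • gradient φ (s • y) := by
  have h := (hφ.differentiable one_ne_zero (s • y)).hasGradientAt.hasFDerivAt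
  have h2 := h.comp y ((hasFDerivAt_id (𝕜 := ℝ) y).const_smul s)
  refine HasGradientAt.gradient (hasGradientAt_iff_hasFDerivAt.2 (h2.congr_fderiv ?_))
  ext v
  simp

/-- Stability of spherical caps for a `C¹` function, in geodesic polar coordinates. -/
theorem cap_inequality_of_contDiff {n : ℕ} (hn : 2 ≤ n) {K b : ℝ} {R ρ : ℝ → ℝ}
    (h : IsCapProfile K b R ρ) {φ : EuclideanSpace ℝ (Fin n) → ℝ} (hφ : ContDiff ℝ 1 φ)
    {I : ℝ → ℝ}
    (hI : ∀ s ∈ Set.Ioo 0 b, I s = R s ^ (n - 1) *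
      ∫ w : Metric.sphere (0 : EuclideanSpace ℝ (Fin n)) 1,
        (inner ℝ (gradient φ (s • (w : EuclideanSpace ℝ (Fin n))))
          (w : EuclideanSpace ℝ (Fin n)) ^ 2 + (s / R s) ^ 2 *
          (‖gradient φ (s • (w : EuclideanSpace ℝ (Fin n)))‖ ^ 2 -
          inner ℝ (gradient φ (s • (w : EuclideanSpace ℝ (Fin n))))
          (w : EuclideanSpace ℝ (Fin n)) ^ 2) -
          n * K * φ (s • (w : EuclideanSpace ℝ (Fin n))) ^ 2) ∂volume.toSphere)
    (hIint : IntegrableOn I (Set.Icc 0 b))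
    (hmean : ∫ s in (0 : ℝ)..b, R s ^ (n - 1) *
      ∫ w : Metric.sphere (0 : EuclideanSpace ℝ (Fin n)) 1,
        φ (s • (w : EuclideanSpace ℝ (Fin n))) ∂volume.toSphere = 0) :
    (1 - K * ρ b) * R b ^ (n - 2) * ∫ w : Metric.sphere (0 : EuclideanSpace ℝ (Fin n)) 1,
        φ (b • (w : EuclideanSpace ℝ (Fin n))) ^ 2 ∂volume.toSphere ≤
      ∫ s in (0 : ℝ)..b, I s := by
  obtain ⟨k, rfl⟩ : ∃ k, n = k + 2 := ⟨n - 2, by omega⟩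
  have e1 : k + 2 - 1 = k + 1 := rfl
  have e2 : k + 2 - 2 = k := rfl
  rw [e1] at hI hmean
  rw [e2]
  have hc := hφ.continuous
  have hg := continuous_gradient hφ
  set μ := (volume : Measure (EuclideanSpace ℝ (Fin (k + 2)))).toSphere with hμ
  set S₀ := μ.real Set.univ with hS₀
  have hS₀pos : 0 < S₀ := by
    rw [hS₀, measureReal_def]
    refine ENNReal.toReal_pos ?_ (measure_ne_top _ _)
    rw [Measure.measure_univ_ne_zero]
    exact Measure.toSphere_ne_zero _
  have hint : ∀ {f : Metric.sphere (0 : EuclideanSpace ℝ (Fin (k + 2))) 1 → ℝ}, Continuous f →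
      Integrable f μ := fun hf =>
    hf.integrable_of_hasCompactSupport (HasCompactSupport.of_compactSpace _)
  have hadd : ∀ {f g : Metric.sphere (0 : EuclideanSpace ℝ (Fin (k + 2))) 1 → ℝ}, Integrable f μ →
      Integrable g μ → Integrable (fun w => f w + g w) μ := fun hf hg => hf.add hg
  set f : ℝ → Metric.sphere (0 : EuclideanSpace ℝ (Fin (k + 2))) 1 → ℝ :=
    fun s w => φ (s • (w : EuclideanSpace ℝ (Fin (k + 2)))) with hf
  set d : ℝ → Metric.sphere (0 : EuclideanSpace ℝ (Fin (k + 2))) 1 → ℝ := fun s w =>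
    inner ℝ (gradient φ (s • (w : EuclideanSpace ℝ (Fin (k + 2)))))
          (w : EuclideanSpace ℝ (Fin (k + 2))) with hd
  set N : ℝ → Metric.sphere (0 : EuclideanSpace ℝ (Fin (k + 2))) 1 → ℝ := fun s w =>
    ‖gradient φ (s • (w : EuclideanSpace ℝ (Fin (k + 2))))‖ ^ 2 with hN
  have hfc : ∀ s, Continuous (f s) := fun s => by fun_prop
  have hdc : ∀ s, Continuous (d s) := fun s => by fun_prop
  have hNc : ∀ s, Continuous (N s) := fun s => by fun_prop
  set A : ℝ → ℝ := fun s => (∫ w, f s w ∂μ) / S₀ with hA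
  set A₁ : ℝ → ℝ := fun s => (∫ w, d s w ∂μ) / S₀ with hA₁
  have hmA : ∀ s, ∫ w, f s w ∂μ = A s * S₀ := fun s => by simp only [hA]; field_simp
  have hmA₁ : ∀ s, ∫ w, d s w ∂μ = A₁ s * S₀ := fun s => by simp only [hA₁]; field_simp
  have hAd : ∀ s, HasDerivAt A (A₁ s) s := fun s => (hasDerivAt_integral_sphere hφ s).div_const S₀
  have hMd : ∀ s, HasDerivAt (fun s => ∫ w, f s w ^ 2 ∂μ) (2 * ∫ w, f s w * d s w ∂μ) s := by
    intro s
    have := hasDerivAt_integral_sphere (φ := fun y => φ y ^ 2) (hφ.pow 2) s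
    refine this.congr_deriv ?_
    rw [← integral_const_mul]
    refine integral_congr_ae (Eventually.of_forall fun w => ?_)
    simp only [gradient_sq hφ, real_inner_smul_left, hf, hd]
    ring
  set V : ℝ → ℝ := fun s => (∫ w, f s w ^ 2 ∂μ) - S₀ * A s ^ 2 with hV
  have hVd : ∀ s, HasDerivAt V (2 * (∫ w, f s w * d s w ∂μ) - S₀ * (2 * A s * A₁ s)) s := by
    intro s
    refine ((hMd s).sub (((hAd s).pow 2).const_mul S₀)).congr_deriv ?_
    push_cast
    ring
  have hV0 : V 0 = 0 := by
    simp only [hV, hA, hf, zero_smul, integral_const, smul_eq_mul, ← hS₀]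
    field_simp
    ring
  have hmain := cap_inequality (k := k) (D := fun s => (∫ w, d s w ^ 2 ∂μ) - S₀ * A₁ s ^ 2)
    (I := I) h hS₀pos.le hAd hVd hV0 ?_ ?_ hIint ?_
  · refine le_trans (le_of_eq ?_) hmain
    simp only [hV, sub_add_cancel]
    rfl
  · intro s l
    -- With D the variance of the radial derivative and V₁ twice its covariance with the function,
    -- the form D - l V₁ + l² V is the integral of this square.
    have hnn : 0 ≤ ∫ w, (d s w - A₁ s - l * (f s w - A s)) ^ 2 ∂μ :=
      integral_nonneg fun w => sq_nonneg _
    have e : ∀ w, (d s w - A₁ s - l * (f s w - A s)) ^ 2 =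
        d s w ^ 2 + ((-2 * l) * (f s w * d s w) + (l ^ 2 * f s w ^ 2 +
          ((-2 * (A₁ s - l * A s)) * d s w + (2 * l * (A₁ s - l * A s) * f s w +
            (A₁ s - l * A s) ^ 2)))) := fun w => by ring
    have i1 : Integrable (fun w => d s w ^ 2) μ := hint ((hdc s).pow 2)
    have i2 : Integrable (fun w => (-2 * l) * (f s w * d s w)) μ :=
      (hint ((hfc s).mul (hdc s))).const_mul _
    have i3 : Integrable (fun w => l ^ 2 * f s w ^ 2) μ := (hint ((hfc s).pow 2)).const_mul _
    have i4 : Integrable (fun w => (-2 * (A₁ s - l * A s)) * d s w) μ :=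
      (hint (hdc s)).const_mul _
    have i5 : Integrable (fun w => 2 * l * (A₁ s - l * A s) * f s w) μ :=
      (hint (hfc s)).const_mul _
    have i6 : Integrable (fun _ => (A₁ s - l * A s) ^ 2) μ := integrable_const _
    simp only [e] at hnn
    rw [integral_add i1 (hadd i2 (hadd i3 (hadd i4 (hadd i5 i6)))),
      integral_add i2 (hadd i3 (hadd i4 (hadd i5 i6))), integral_add i3 (hadd i4 (hadd i5 i6)),
      integral_add i4 (hadd i5 i6), integral_add i5 i6, integral_const_mul, integral_const_mul,
      integral_const_mul, integral_const_mul, integral_const, smul_eq_mul, ← hS₀, hmA, hmA₁] at hnn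
    simp only [hV]
    refine hnn.trans (le_of_eq ?_)
    ring
  · intro s hs
    have hR := h.radius_pos s ⟨hs.1, hs.2.le⟩
    rw [hI s hs]
    refine mul_le_mul_of_nonneg_left ?_ (pow_nonneg hR.le _)
    have hφs : ContDiff ℝ 1 fun y : EuclideanSpace ℝ (Fin (k + 2)) => φ (s • y) :=
      hφ.comp (contDiff_const_smul s)
    -- Rescaling to the unit sphere multiplies the tangential energy by s²; together with 1/R² this
    -- produces the factor (s/R)² of the induced metric.
    have hP := sphere_poincare hn hφs (A s) (hmA s)
    simp only [gradient_comp_smul hφ, norm_smul, real_inner_smul_left, Real.norm_eq_abs, mul_pow,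
      sq_abs, ← mul_sub] at hP
    rw [integral_const_mul] at hP
    change (((k + 2 : ℕ) : ℝ) - 1) * (∫ w, f s w ^ 2 ∂μ - A s ^ 2 * S₀) ≤
      s ^ 2 * ∫ w, (N s w - d s w ^ 2) ∂μ at hP
    change _ ≤ ∫ w, (d s w ^ 2 + (s / R s) ^ 2 * (N s w - d s w ^ 2) -
      ((k + 2 : ℕ) : ℝ) * K * f s w ^ 2) ∂μ
    have i1 : Integrable (fun w => d s w ^ 2) μ := hint ((hdc s).pow 2)
    have i2 : Integrable (fun w => (s / R s) ^ 2 * (N s w - d s w ^ 2)) μ :=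
      (hint ((hNc s).sub ((hdc s).pow 2))).const_mul _
    have i3 : Integrable (fun w => ((k + 2 : ℕ) : ℝ) * K * f s w ^ 2) μ :=
      (hint ((hfc s).pow 2)).const_mul _
    rw [integral_sub (hadd i1 i2) i3, integral_add i1 i2, integral_const_mul, integral_const_mul]
    have hP' : (k + 1) * V s / R s ^ 2 ≤ (s / R s) ^ 2 * ∫ w, (N s w - d s w ^ 2) ∂μ := by
      rw [div_pow, div_mul_eq_mul_div]
      refine div_le_div_of_nonneg_right ?_ (sq_nonneg _)
      refine le_trans (le_of_eq ?_) hP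
      simp only [hV]
      push_cast
      ring
    push_cast
    simp only [hV] at hP' ⊢
    linarith
  · have : ∀ s, R s ^ (k + 1) * A s = (R s ^ (k + 1) * ∫ w, f s w ∂μ) / S₀ := fun s => by
      simp only [hA]; ring
    simp only [this]
    rw [intervalIntegral.integral_div]
    rw [hmean, zero_div]

noncomputable section

/-! ### Matrices that are invariant under the rotations fixing a unit vector -/

/-- The matrix with eigenvalue `α` on the unit vector `w` and `β` on its orthogonal complement. -/
def radialMatrix {n : ℕ} (w : EuclideanSpace ℝ (Fin n)) (α β : ℝ) : Matrix (Fin n) (Fin n) ℝ :=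
  β • 1 + (α - β) • Matrix.vecMulVec w.ofLp w.ofLp

section RadialMatrix

variable {n : ℕ} {w : EuclideanSpace ℝ (Fin n)}

theorem dotProduct_eq_inner (u v : EuclideanSpace ℝ (Fin n)) :
    u.ofLp ⬝ᵥ v.ofLp = inner ℝ u v := by
  simp only [PiLp.inner_apply, dotProduct, RCLike.inner_apply, conj_trivial]
  exact Finset.sum_congr rfl fun i _ => mul_comm _ _

theorem dotProduct_self_of_norm_eq_one (hw : ‖w‖ = 1) : w.ofLp ⬝ᵥ w.ofLp = 1 := by
  rw [dotProduct_eq_inner, real_inner_self_eq_norm_sq, hw, one_pow]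

/-- For a unit vector w these matrices act as the scalars α on w and β on its complement, so they
multiply entrywise in the pair (α, β). All the geometry of a hypersurface of revolution takes place
in this algebra. -/
theorem radialMatrix_mul (hw : ‖w‖ = 1) (α β α' β' : ℝ) :
    radialMatrix w α β * radialMatrix w α' β' = radialMatrix w (α * α') (β * β') := by
  simp only [radialMatrix, mul_add, add_mul, Matrix.smul_mul, Matrix.mul_smul, mul_one, one_mul,
    Matrix.vecMulVec_mul_vecMulVec, dotProduct_self_of_norm_eq_one hw, one_smul, smul_smul]
  rw [add_assoc, ← add_smul, ← add_smul]
  congr 2 <;> ring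

theorem radialMatrix_one_one : radialMatrix w 1 1 = 1 := by simp [radialMatrix]

theorem radialMatrix_inv (hw : ‖w‖ = 1) {α β : ℝ} (hα : α ≠ 0) (hβ : β ≠ 0) :
    (radialMatrix w α β)⁻¹ = radialMatrix w α⁻¹ β⁻¹ := by
  refine Matrix.inv_eq_right_inv ?_
  rw [radialMatrix_mul hw, mul_inv_cancel₀ hα, mul_inv_cancel₀ hβ, radialMatrix_one_one]

theorem trace_radialMatrix (hw : ‖w‖ = 1) (α β : ℝ) :
    (radialMatrix w α β).trace = α + (n - 1) * β := by
  simp only [radialMatrix, Matrix.trace_add, Matrix.trace_smul, Matrix.trace_one,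
    Matrix.trace_vecMulVec, dotProduct_self_of_norm_eq_one hw, Fintype.card_fin, smul_eq_mul]
  ring

theorem det_radialMatrix (hn : 0 < n) (hw : ‖w‖ = 1) (α : ℝ) {β : ℝ} (hβ : β ≠ 0) :
    (radialMatrix w α β).det = α * β ^ (n - 1) := by
  have h : radialMatrix w α β = β • (1 + Matrix.replicateCol Unit (((α - β) / β) • w.ofLp) *
      Matrix.replicateRow Unit w.ofLp) := by
    rw [radialMatrix, smul_add, ← Matrix.vecMulVec_eq, Matrix.smul_vecMulVec, smul_smul,
      mul_div_cancel₀ _ hβ]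
  rw [h, Matrix.det_smul, Matrix.det_one_add_replicateCol_mul_replicateRow, dotProduct_smul,
    dotProduct_self_of_norm_eq_one hw, Fintype.card_fin]
  obtain ⟨m, rfl⟩ : ∃ m, n = m + 1 := ⟨n - 1, by omega⟩
  simp only [Nat.add_sub_cancel, pow_succ, smul_eq_mul]
  field_simp
  ring

theorem radialMatrix_mulVec (α β : ℝ) (V : EuclideanSpace ℝ (Fin n)) :
    (radialMatrix w α β).mulVec V.ofLp = β • V.ofLp + ((α - β) * inner ℝ w V) • w.ofLp := by
  simp only [radialMatrix, Matrix.add_mulVec, Matrix.smul_mulVec, Matrix.one_mulVec,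
    Matrix.vecMulVec_mulVec, dotProduct_eq_inner]
  ext i
  simp
  ring

theorem dotProduct_radialMatrix_mulVec (α β : ℝ) (V : EuclideanSpace ℝ (Fin n)) :
    V.ofLp ⬝ᵥ (radialMatrix w α β).mulVec V.ofLp =
      α * inner ℝ w V ^ 2 + β * (‖V‖ ^ 2 - inner ℝ w V ^ 2) := by
  rw [radialMatrix_mulVec, dotProduct_add, dotProduct_smul, dotProduct_smul, dotProduct_eq_inner,
    dotProduct_eq_inner, real_inner_self_eq_norm_sq, real_inner_comm V w]
  simp only [smul_eq_mul]
  ring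

end RadialMatrix

/-! ### The geometry of a hypersurface of revolution -/

/-- The inclusion of `ℝⁿ` as the hyperplane `{x¹ = 0}` of `ℝⁿ⁺¹`. -/
def hyperplaneInclusion (n : ℕ) :
    EuclideanSpace ℝ (Fin n) →L[ℝ] EuclideanSpace ℝ (Fin (n + 1)) :=
  LinearMap.toContinuousLinearMap
    { toFun := fun y => WithLp.toLp 2 (Fin.cons 0 y.ofLp)
      map_add' := fun x y => by
        ext i
        refine Fin.cases ?_ (fun j => ?_) i <;> simp
      map_smul' := fun c y => by
        ext i
        refine Fin.cases ?_ (fun j => ?_) i <;> simp }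

/-- The unit vector of the axis of revolution. -/
def axisVector (n : ℕ) : EuclideanSpace ℝ (Fin (n + 1)) := EuclideanSpace.single 0 1

section Revolve

variable {n : ℕ}

@[simp]
theorem hyperplaneInclusion_zero_apply (y : EuclideanSpace ℝ (Fin n)) :
    hyperplaneInclusion n y 0 = 0 := rfl

@[simp]
theorem hyperplaneInclusion_succ_apply (y : EuclideanSpace ℝ (Fin n)) (i : Fin n) :
    hyperplaneInclusion n y i.succ = y i := rfl

@[simp]
theorem inner_hyperplaneInclusion (u v : EuclideanSpace ℝ (Fin n)) :
    inner ℝ (hyperplaneInclusion n u) (hyperplaneInclusion n v) = inner ℝ u v := by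
  simp [PiLp.inner_apply, Fin.sum_univ_succ]

@[simp]
theorem inner_axisVector (v : EuclideanSpace ℝ (Fin (n + 1))) :
    inner ℝ (axisVector n) v = v 0 := by
  simp [axisVector, EuclideanSpace.inner_single_left]

@[simp]
theorem inner_axisVector_right (v : EuclideanSpace ℝ (Fin (n + 1))) :
    inner ℝ v (axisVector n) = v 0 := by
  rw [real_inner_comm, inner_axisVector]

@[simp]
theorem axisVector_zero_apply : axisVector n 0 = 1 := by simp [axisVector]

@[simp]
theorem axisVector_succ_apply (i : Fin n) : axisVector n i.succ = 0 := by
  simp [axisVector]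

@[simp]
theorem norm_axisVector : ‖axisVector n‖ = 1 := by simp [axisVector]

@[simp]
theorem norm_hyperplaneInclusion (u : EuclideanSpace ℝ (Fin n)) :
    ‖hyperplaneInclusion n u‖ = ‖u‖ := by
  rw [norm_eq_sqrt_real_inner, inner_hyperplaneInclusion, ← norm_eq_sqrt_real_inner]

theorem hasDerivAt_div_self {f : ℝ → ℝ} {f' x : ℝ} (hf : HasDerivAt f f' x) (hx : x ≠ 0) :
    HasDerivAt (fun s => f s / s) ((f' * x - f x) / x ^ 2) x :=
  (hf.div (hasDerivAt_id x) hx).congr_deriv (by simp)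

/-- In this vector form only the norm has to be differentiated. It holds at the origin as well,
where the second summand vanishes. -/
theorem revolve_eq (p r : ℝ → ℝ) (y : EuclideanSpace ℝ (Fin n)) :
    revolve p r y = p ‖y‖ • axisVector n + (r ‖y‖ / ‖y‖) • hyperplaneInclusion n y := by
  ext i
  refine Fin.cases ?_ (fun j => ?_) i
  · simp [revolve]
  · simp [revolve]
    ring

/-- `p` and `r` are twice differentiable on the open set `J` of positive numbers, with derivatives
`p₁`, `p₂` and `r₁`, `r₂`. -/
structure IsProfile (J : Set ℝ) (p p₁ p₂ r r₁ r₂ : ℝ → ℝ) : Prop where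
  isOpen : IsOpen J
  pos : ∀ s ∈ J, 0 < s
  hasDerivAt_p : ∀ s ∈ J, HasDerivAt p (p₁ s) s
  hasDerivAt_p₁ : ∀ s ∈ J, HasDerivAt p₁ (p₂ s) s
  hasDerivAt_r : ∀ s ∈ J, HasDerivAt r (r₁ s) s
  hasDerivAt_r₁ : ∀ s ∈ J, HasDerivAt r₁ (r₂ s) s

variable {J : Set ℝ} {p p₁ p₂ r r₁ r₂ : ℝ → ℝ} {y : EuclideanSpace ℝ (Fin n)}

theorem hasFDerivAt_comp_norm {f : ℝ → ℝ} {f' : ℝ} (hy : y ≠ 0) (hf : HasDerivAt f f' ‖y‖) :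
    HasFDerivAt (fun z : EuclideanSpace ℝ (Fin n) => f ‖z‖) (f' • (‖y‖⁻¹ • innerSL ℝ y)) y :=
  hf.comp_hasFDerivAt y (hasFDerivAt_norm_of_ne_zero hy)

theorem IsProfile.ne_zero (h : IsProfile J p p₁ p₂ r r₁ r₂) (hy : ‖y‖ ∈ J) : y ≠ 0 :=
  norm_pos_iff.1 (h.pos _ hy)

theorem IsProfile.hasFDerivAt_revolve (h : IsProfile J p p₁ p₂ r r₁ r₂) (hy : ‖y‖ ∈ J) :
    HasFDerivAt (revolve (n := n) p r)
      ((p₁ ‖y‖ • (‖y‖⁻¹ • innerSL ℝ y)).smulRight (axisVector n) +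
        ((r ‖y‖ / ‖y‖) • hyperplaneInclusion n +
          (((r₁ ‖y‖ * ‖y‖ - r ‖y‖) / ‖y‖ ^ 2) • (‖y‖⁻¹ • innerSL ℝ y)).smulRight
            (hyperplaneInclusion n y))) y := by
  have hy0 := h.ne_zero hy
  have hs := (h.pos _ hy).ne'
  have h1 := (hasFDerivAt_comp_norm hy0 (h.hasDerivAt_p _ hy)).smul_const (axisVector n)
  have h2 : HasDerivAt (fun s => r s / s) ((r₁ ‖y‖ * ‖y‖ - r ‖y‖) / ‖y‖ ^ 2) ‖y‖ := by
    exact hasDerivAt_div_self (h.hasDerivAt_r _ hy) hs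
  have h3 := (hasFDerivAt_comp_norm hy0 h2).smul (hyperplaneInclusion n).hasFDerivAt
  rw [show revolve (n := n) p r = fun z => p ‖z‖ • axisVector n +
    (r ‖z‖ / ‖z‖) • hyperplaneInclusion n z from funext (revolve_eq p r)]
  exact h1.add h3

theorem IsProfile.coordTangent_eq (h : IsProfile J p p₁ p₂ r r₁ r₂) (hy : ‖y‖ ∈ J) (j : Fin n) :
    coordTangent (revolve p r) j y = (p₁ ‖y‖ / ‖y‖ * y j) • axisVector n +
      ((r ‖y‖ / ‖y‖) • hyperplaneInclusion n (EuclideanSpace.single j 1) +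
        ((r₁ ‖y‖ * ‖y‖ - r ‖y‖) / ‖y‖ ^ 3 * y j) • hyperplaneInclusion n y) := by
  have hs := (h.pos _ hy).ne'
  rw [coordTangent, (h.hasFDerivAt_revolve hy).fderiv]
  simp only [add_apply, ContinuousLinearMap.smulRight_apply, smul_apply, innerSL_apply_apply,
    EuclideanSpace.inner_single_right, smul_eq_mul, conj_trivial, one_mul]
  congr 2
  · field_simp
  · congr 1
    field_simp

theorem IsProfile.metricMatrix_eq (h : IsProfile J p p₁ p₂ r r₁ r₂) (hy : ‖y‖ ∈ J)
    (harc : p₁ ‖y‖ ^ 2 + r₁ ‖y‖ ^ 2 = 1) :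
    metricMatrix (revolve p r) y = radialMatrix (‖y‖⁻¹ • y) 1 ((r ‖y‖ / ‖y‖) ^ 2) := by
  have hs := (h.pos _ hy).ne'
  ext i j
  simp only [metricMatrix, Matrix.of_apply, h.coordTangent_eq hy, radialMatrix, Matrix.add_apply,
    Matrix.smul_apply, Matrix.vecMulVec_apply, inner_add_left, inner_add_right,
    real_inner_smul_left, real_inner_smul_right, inner_hyperplaneInclusion, inner_axisVector,
    inner_axisVector_right, hyperplaneInclusion_zero_apply,
    EuclideanSpace.inner_single_left, EuclideanSpace.inner_single_right, Matrix.one_apply,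
    real_inner_self_eq_norm_sq, smul_eq_mul, PiLp.smul_apply, PiLp.single_apply, conj_trivial]
  have hp : p₁ ‖y‖ ^ 2 = 1 - r₁ ‖y‖ ^ 2 := by linarith
  by_cases hij : i = j
  · subst hij
    simp
    field_simp
    rw [hp]
    ring
  · simp [hij, Ne.symm hij]
    field_simp
    rw [hp]
    ring

theorem IsProfile.fderiv_coordTangent (h : IsProfile J p p₁ p₂ r r₁ r₂) (hy : ‖y‖ ∈ J)
    (i j : Fin n) :
    fderiv ℝ (coordTangent (revolve p r) j) y (EuclideanSpace.single i 1) =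
      ((p₂ ‖y‖ * ‖y‖ - p₁ ‖y‖) / ‖y‖ ^ 3 * y i * y j +
          p₁ ‖y‖ / ‖y‖ * if i = j then 1 else 0) • axisVector n +
      (((r₁ ‖y‖ * ‖y‖ - r ‖y‖) / ‖y‖ ^ 3 * y i) •
          hyperplaneInclusion n (EuclideanSpace.single j 1) +
        (((r₁ ‖y‖ * ‖y‖ - r ‖y‖) / ‖y‖ ^ 3 * y j) •
          hyperplaneInclusion n (EuclideanSpace.single i 1) +
        ((r₂ ‖y‖ * ‖y‖ ^ 2 - 3 * (r₁ ‖y‖ * ‖y‖ - r ‖y‖)) / ‖y‖ ^ 5 * y i * y j +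
          (r₁ ‖y‖ * ‖y‖ - r ‖y‖) / ‖y‖ ^ 3 * if i = j then 1 else 0) •
          hyperplaneInclusion n y)) := by
  have hy0 := h.ne_zero hy
  have hs := (h.pos _ hy).ne'
  have hev : coordTangent (revolve (n := n) p r) j =ᶠ[𝓝 y] fun z =>
      (p₁ ‖z‖ / ‖z‖ * z j) • axisVector n +
      ((r ‖z‖ / ‖z‖) • hyperplaneInclusion n (EuclideanSpace.single j 1) +
        ((r₁ ‖z‖ * ‖z‖ - r ‖z‖) / ‖z‖ ^ 3 * z j) • hyperplaneInclusion n z) := by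
    filter_upwards [(h.isOpen.preimage continuous_norm).mem_nhds hy] with z hz
    exact h.coordTangent_eq hz j
  rw [hev.fderiv_eq]
  have hP : HasDerivAt (fun s => p₁ s / s) ((p₂ ‖y‖ * ‖y‖ - p₁ ‖y‖) / ‖y‖ ^ 2) ‖y‖ := by
    exact hasDerivAt_div_self (h.hasDerivAt_p₁ _ hy) hs
  have hϱ : HasDerivAt (fun s => r s / s) ((r₁ ‖y‖ * ‖y‖ - r ‖y‖) / ‖y‖ ^ 2) ‖y‖ := by
    exact hasDerivAt_div_self (h.hasDerivAt_r _ hy) hs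
  have hQ : HasDerivAt (fun s => (r₁ s * s - r s) / s ^ 3)
      ((r₂ ‖y‖ * ‖y‖ ^ 2 - 3 * (r₁ ‖y‖ * ‖y‖ - r ‖y‖)) / ‖y‖ ^ 4) ‖y‖ := by
    have := ((((h.hasDerivAt_r₁ _ hy).mul (hasDerivAt_id _)).sub (h.hasDerivAt_r _ hy)).div
      ((hasDerivAt_id ‖y‖).pow 3) (pow_ne_zero 3 hs))
    refine this.congr_deriv ?_
    simp only [id, Pi.mul_apply, Pi.sub_apply, Pi.pow_apply]
    push_cast
    field_simp
    ring
  have hcoord : HasFDerivAt (fun z : EuclideanSpace ℝ (Fin n) => z j)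
      (EuclideanSpace.proj j : EuclideanSpace ℝ (Fin n) →L[ℝ] ℝ) y :=
    (EuclideanSpace.proj j : EuclideanSpace ℝ (Fin n) →L[ℝ] ℝ).hasFDerivAt
  have d1 := ((hasFDerivAt_comp_norm hy0 hP).mul hcoord).smul_const (axisVector n)
  have d2 := (hasFDerivAt_comp_norm hy0 hϱ).smul_const
    (hyperplaneInclusion n (EuclideanSpace.single j 1))
  have d3 := ((hasFDerivAt_comp_norm hy0 hQ).mul hcoord).smul
    (hyperplaneInclusion n).hasFDerivAt
  have d := d1.add (d2.add d3)
  have hd := d.fderiv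
  refine (congrArg (fun L : EuclideanSpace ℝ (Fin n) →L[ℝ] EuclideanSpace ℝ (Fin (n + 1)) =>
    L (EuclideanSpace.single i 1)) hd).trans ?_
  simp only [add_apply, ContinuousLinearMap.smulRight_apply, smul_apply, innerSL_apply_apply,
    EuclideanSpace.inner_single_right, smul_eq_mul, conj_trivial, one_mul, PiLp.proj_apply,
    PiLp.single_apply, Pi.mul_apply]
  by_cases hij : i = j
  · subst hij
    simp only [if_true]
    congr 1
    · congr 1
      field_simp
      ring
    · congr 1
      · congr 1
        field_simp
      · congr 2
        field_simp
        ring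
  · simp only [hij, Ne.symm hij, if_false]
    congr 1
    · congr 1
      field_simp
      ring
    · congr 1
      · congr 1
        field_simp
      · congr 2
        field_simp
        ring

end Revolve

end

noncomputable section

/-! ### Principal curvatures and densities of a hypersurface of revolution. -/

section RevolveCurvature

variable {n : ℕ} {J : Set ℝ} {p p₁ p₂ r r₁ r₂ : ℝ → ℝ} {y : EuclideanSpace ℝ (Fin n)}

/-- The unit normal `(r', -p' w)` of a hypersurface of revolution at the point `y = s w`. -/
def revolveNormal (p₁ r₁ : ℝ → ℝ) (y : EuclideanSpace ℝ (Fin n)) :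
    EuclideanSpace ℝ (Fin (n + 1)) :=
  r₁ ‖y‖ • axisVector n - p₁ ‖y‖ • hyperplaneInclusion n (‖y‖⁻¹ • y)

/-- The tangent space is spanned by (p', r' w) and by the (0, v) with v ⟂ w, because r ≠ 0; its unit
normals are ±(r', -p' w). The sign may depend on y; the arguments that follow retain only ε² = 1. -/
theorem IsProfile.normal_eq (h : IsProfile J p p₁ p₂ r r₁ r₂) (hy : ‖y‖ ∈ J)
    (harc : p₁ ‖y‖ ^ 2 + r₁ ‖y‖ ^ 2 = 1) (hr : r ‖y‖ ≠ 0) {M : EuclideanSpace ℝ (Fin (n + 1))}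
    (hM : ‖M‖ = 1) (horth : ∀ v, inner ℝ (fderiv ℝ (revolve p r) y v) M = 0) :
    ∃ ε : ℝ, ε ^ 2 = 1 ∧ M = ε • revolveNormal p₁ r₁ y := by
  have hs := (h.pos _ hy).ne'
  set s := ‖y‖ with hsdef
  set lam := inner ℝ (hyperplaneInclusion n y) M / s with hlam
  have hL : ∀ v, p₁ s * (s⁻¹ * inner ℝ y v) * M 0 + (r s / s * inner ℝ (hyperplaneInclusion n v) M +
      (r₁ s * s - r s) / s ^ 2 * (s⁻¹ * inner ℝ y v) * inner ℝ (hyperplaneInclusion n y) M) = 0 := by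
    intro v
    have := horth v
    rw [(h.hasFDerivAt_revolve hy).fderiv] at this
    simpa only [add_apply, ContinuousLinearMap.smulRight_apply, smul_apply, innerSL_apply_apply,
      smul_eq_mul, inner_add_left, real_inner_smul_left, inner_axisVector] using this
  have hyM : inner ℝ (hyperplaneInclusion n y) M = lam * s := by rw [hlam]; field_simp
  have h1 : p₁ s * M 0 + r₁ s * lam = 0 := by
    have := hL y
    rw [hyM, real_inner_self_eq_norm_sq, ← hsdef] at this
    field_simp at this
    refine (mul_eq_zero.1 (?_ : s * (p₁ s * M 0 + r₁ s * lam) = 0)).resolve_left hs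
    linarith
  have h2 : ∀ v, inner ℝ (hyperplaneInclusion n v) M = lam * (s⁻¹ * inner ℝ y v) := by
    intro v
    have := hL v
    rw [hyM] at this
    have e : p₁ s * M 0 = -(r₁ s * lam) := by linarith
    have e2 : r s / s * (inner ℝ (hyperplaneInclusion n v) M - lam * (s⁻¹ * inner ℝ y v)) =
        p₁ s * (s⁻¹ * inner ℝ y v) * M 0 + (r s / s * inner ℝ (hyperplaneInclusion n v) M +
      (r₁ s * s - r s) / s ^ 2 * (s⁻¹ * inner ℝ y v) * (lam * s)) := by
      rw [show p₁ s * (s⁻¹ * inner ℝ y v) * M 0 = (p₁ s * M 0) * (s⁻¹ * inner ℝ y v) by ring, e]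
      field_simp
      ring
    rw [this] at e2
    have := (mul_eq_zero.1 e2).resolve_left (div_ne_zero hr hs)
    linarith
  have h3 : ∀ i : Fin n, M i.succ = lam * (s⁻¹ * y i) := by
    intro i
    have := h2 (EuclideanSpace.single i 1)
    rw [EuclideanSpace.inner_single_right] at this
    simp only [conj_trivial, one_mul] at this
    rw [← this, PiLp.inner_apply, Fin.sum_univ_succ]
    simp [PiLp.single_apply]
  have hMn : M 0 ^ 2 + lam ^ 2 = 1 := by
    have e := EuclideanSpace.norm_sq_eq M
    rw [hM, Fin.sum_univ_succ] at e
    simp only [h3, Real.norm_eq_abs, sq_abs, mul_pow, ← Finset.mul_sum] at e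
    have e2 := EuclideanSpace.norm_sq_eq y
    simp only [Real.norm_eq_abs, sq_abs] at e2
    rw [← e2, ← hsdef] at e
    field_simp at e
    linarith
  refine ⟨r₁ s * M 0 - p₁ s * lam, ?_, ?_⟩
  · have e : (r₁ s * M 0 - p₁ s * lam) ^ 2 + (p₁ s * M 0 + r₁ s * lam) ^ 2 =
        (p₁ s ^ 2 + r₁ s ^ 2) * (M 0 ^ 2 + lam ^ 2) := by ring
    rw [h1, harc, hMn] at e
    linarith
  · have e1 : (r₁ s * M 0 - p₁ s * lam) * r₁ s = M 0 := by
      linear_combination (M 0) * harc - p₁ s * h1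
    have e2 : (r₁ s * M 0 - p₁ s * lam) * p₁ s = -lam := by
      linear_combination r₁ s * h1 - lam * harc
    ext i
    refine Fin.cases ?_ (fun j => ?_) i
    · simp [revolveNormal, ← hsdef, e1]
    · rw [h3]
      simp only [revolveNormal, ← hsdef, PiLp.smul_apply, PiLp.sub_apply, smul_eq_mul,
        axisVector_succ_apply, hyperplaneInclusion_succ_apply]
      linear_combination (s⁻¹ * y j) * e2

theorem norm_inv_smul_self_of_ne_zero (hy : y ≠ 0) : ‖‖y‖⁻¹ • y‖ = 1 := by
  rw [norm_smul, norm_inv, norm_norm, inv_mul_cancel₀ (norm_ne_zero_iff.2 hy)]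

variable {N : EuclideanSpace ℝ (Fin n) → EuclideanSpace ℝ (Fin (n + 1))} {ε : ℝ}

theorem IsProfile.secondFundMatrix_eq (h : IsProfile J p p₁ p₂ r r₁ r₂) (hy : ‖y‖ ∈ J)
    (hN : N y = ε • revolveNormal p₁ r₁ y) :
    secondFundMatrix (revolve p r) N y = radialMatrix (‖y‖⁻¹ • y)
      (ε * (p₂ ‖y‖ * r₁ ‖y‖ - r₂ ‖y‖ * p₁ ‖y‖)) (ε * (p₁ ‖y‖ * r ‖y‖ / ‖y‖ ^ 2)) := by
  have hs := (h.pos _ hy).ne'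
  ext i j
  simp only [secondFundMatrix, Matrix.of_apply, h.fderiv_coordTangent hy, radialMatrix, hN,
    revolveNormal, Matrix.add_apply,
    Matrix.smul_apply, Matrix.vecMulVec_apply, inner_add_left, inner_sub_right,
    real_inner_smul_left, real_inner_smul_right, inner_hyperplaneInclusion, inner_axisVector,
    inner_axisVector_right, hyperplaneInclusion_zero_apply,
    EuclideanSpace.inner_single_left, Matrix.one_apply,
    real_inner_self_eq_norm_sq, smul_eq_mul, PiLp.smul_apply, conj_trivial]
  by_cases hij : i = j
  · subst hij
    simp
    field_simp
    ring
  · simp [hij]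
    field_simp
    ring

theorem IsProfile.shape_eq (h : IsProfile J p p₁ p₂ r r₁ r₂) (hy : ‖y‖ ∈ J)
    (harc : p₁ ‖y‖ ^ 2 + r₁ ‖y‖ ^ 2 = 1) (hr : r ‖y‖ ≠ 0)
    (hN : N y = ε • revolveNormal p₁ r₁ y) :
    (metricMatrix (revolve p r) y)⁻¹ * secondFundMatrix (revolve p r) N y =
      radialMatrix (‖y‖⁻¹ • y) (ε * (p₂ ‖y‖ * r₁ ‖y‖ - r₂ ‖y‖ * p₁ ‖y‖))
        (ε * (p₁ ‖y‖ / r ‖y‖)) := by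
  have hs := (h.pos _ hy).ne'
  have hw := norm_inv_smul_self_of_ne_zero (h.ne_zero hy)
  rw [h.metricMatrix_eq hy harc, h.secondFundMatrix_eq hy hN,
    radialMatrix_inv hw one_ne_zero (pow_ne_zero 2 (div_ne_zero hr hs)), radialMatrix_mul hw]
  congr 1
  · ring
  · field_simp

theorem IsProfile.meanCurvature_eq (h : IsProfile J p p₁ p₂ r r₁ r₂) (hy : ‖y‖ ∈ J)
    (harc : p₁ ‖y‖ ^ 2 + r₁ ‖y‖ ^ 2 = 1) (hr : r ‖y‖ ≠ 0)
    (hN : N y = ε • revolveNormal p₁ r₁ y) :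
    meanCurvature (revolve p r) N y = (n : ℝ)⁻¹ * (ε * ((p₂ ‖y‖ * r₁ ‖y‖ - r₂ ‖y‖ * p₁ ‖y‖) +
      (n - 1) * (p₁ ‖y‖ / r ‖y‖))) := by
  rw [meanCurvature, h.shape_eq hy harc hr hN,
    trace_radialMatrix (norm_inv_smul_self_of_ne_zero (h.ne_zero hy))]
  ring

theorem IsProfile.secondFundNormSq_eq (h : IsProfile J p p₁ p₂ r r₁ r₂) (hy : ‖y‖ ∈ J)
    (harc : p₁ ‖y‖ ^ 2 + r₁ ‖y‖ ^ 2 = 1) (hr : r ‖y‖ ≠ 0) (hε : ε ^ 2 = 1)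
    (hN : N y = ε • revolveNormal p₁ r₁ y) :
    secondFundNormSq (revolve p r) N y = (p₂ ‖y‖ * r₁ ‖y‖ - r₂ ‖y‖ * p₁ ‖y‖) ^ 2 +
      (n - 1) * (p₁ ‖y‖ / r ‖y‖) ^ 2 := by
  have hw := norm_inv_smul_self_of_ne_zero (h.ne_zero hy)
  rw [secondFundNormSq, h.shape_eq hy harc hr hN, radialMatrix_mul hw, trace_radialMatrix hw]
  linear_combination ((p₂ ‖y‖ * r₁ ‖y‖ - r₂ ‖y‖ * p₁ ‖y‖) ^ 2 +
      (n - 1) * (p₁ ‖y‖ / r ‖y‖) ^ 2) * hε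

theorem IsProfile.areaDensity_eq (hn : 0 < n) (h : IsProfile J p p₁ p₂ r r₁ r₂) (hy : ‖y‖ ∈ J)
    (harc : p₁ ‖y‖ ^ 2 + r₁ ‖y‖ ^ 2 = 1) (hr : 0 < r ‖y‖) :
    areaDensity (revolve p r) y = (r ‖y‖ / ‖y‖) ^ (n - 1) := by
  have hs := h.pos _ hy
  have hw := norm_inv_smul_self_of_ne_zero (h.ne_zero hy)
  have hq : 0 < r ‖y‖ / ‖y‖ := div_pos hr hs
  rw [areaDensity, h.metricMatrix_eq hy harc, det_radialMatrix hn hw _ (pow_ne_zero 2 hq.ne'),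
    one_mul, ← pow_mul, mul_comm 2, pow_mul, Real.sqrt_sq (pow_nonneg hq.le _)]

theorem IsProfile.metricMatrix_inv (h : IsProfile J p p₁ p₂ r r₁ r₂) (hy : ‖y‖ ∈ J)
    (harc : p₁ ‖y‖ ^ 2 + r₁ ‖y‖ ^ 2 = 1) (hr : r ‖y‖ ≠ 0) :
    (metricMatrix (revolve p r) y)⁻¹ = radialMatrix (‖y‖⁻¹ • y) 1 ((‖y‖ / r ‖y‖) ^ 2) := by
  have hs := (h.pos _ hy).ne'
  have hw := norm_inv_smul_self_of_ne_zero (h.ne_zero hy)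
  rw [h.metricMatrix_eq hy harc, radialMatrix_inv hw one_ne_zero (pow_ne_zero 2 (div_ne_zero hr hs)),
    inv_one, ← inv_pow, inv_div]

theorem IsProfile.covectorNormSq_eq (h : IsProfile J p p₁ p₂ r r₁ r₂) (hy : ‖y‖ ∈ J)
    (harc : p₁ ‖y‖ ^ 2 + r₁ ‖y‖ ^ 2 = 1) (hr : r ‖y‖ ≠ 0) (V : EuclideanSpace ℝ (Fin n)) :
    covectorNormSq (revolve p r) y V = inner ℝ (‖y‖⁻¹ • y) V ^ 2 + (‖y‖ / r ‖y‖) ^ 2 *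
      (‖V‖ ^ 2 - inner ℝ (‖y‖⁻¹ • y) V ^ 2) := by
  rw [covectorNormSq, h.metricMatrix_inv hy harc hr, dotProduct_radialMatrix_mulVec, one_mul]

theorem shellNormal_eq (b : ℝ) (y : EuclideanSpace ℝ (Fin n)) :
    ∃ e : ℝ, e ^ 2 = 1 ∧ shellNormal b y = e • (‖y‖⁻¹ • y) := by
  by_cases hb : ‖y‖ = b
  · exact ⟨1, by norm_num, by rw [shellNormal, if_pos hb, one_smul]⟩
  · exact ⟨-1, by norm_num, by rw [shellNormal, if_neg hb, neg_one_smul]⟩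

theorem IsProfile.covectorNormSq_shellNormal (h : IsProfile J p p₁ p₂ r r₁ r₂) (hy : ‖y‖ ∈ J)
    (harc : p₁ ‖y‖ ^ 2 + r₁ ‖y‖ ^ 2 = 1) (hr : r ‖y‖ ≠ 0) (b : ℝ) :
    covectorNormSq (revolve p r) y (shellNormal b y) = 1 := by
  obtain ⟨e, he, hb⟩ := shellNormal_eq b y
  have hw := norm_inv_smul_self_of_ne_zero (h.ne_zero hy)
  rw [h.covectorNormSq_eq hy harc hr, hb, real_inner_smul_right, real_inner_self_eq_norm_sq,
    norm_smul e, hw, Real.norm_eq_abs]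
  simp only [one_pow, mul_one, sq_abs, he]
  ring

theorem IsProfile.boundaryDensity_eq (hn : 0 < n) (h : IsProfile J p p₁ p₂ r r₁ r₂) (hy : ‖y‖ ∈ J)
    (harc : p₁ ‖y‖ ^ 2 + r₁ ‖y‖ ^ 2 = 1) (hr : 0 < r ‖y‖) (b : ℝ) :
    boundaryDensity b (revolve p r) y = (r ‖y‖ / ‖y‖) ^ (n - 1) := by
  rw [boundaryDensity, h.areaDensity_eq hn hy harc hr, h.covectorNormSq_shellNormal hy harc hr.ne',
    Real.sqrt_one, mul_one]

theorem IsProfile.secondFundConormal_eq (h : IsProfile J p p₁ p₂ r r₁ r₂) (hy : ‖y‖ ∈ J)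
    (harc : p₁ ‖y‖ ^ 2 + r₁ ‖y‖ ^ 2 = 1) (hr : r ‖y‖ ≠ 0) (b : ℝ)
    (hN : N y = ε • revolveNormal p₁ r₁ y) :
    secondFundConormal b (revolve p r) N y = ε * (p₂ ‖y‖ * r₁ ‖y‖ - r₂ ‖y‖ * p₁ ‖y‖) := by
  obtain ⟨e, he, hb⟩ := shellNormal_eq b y
  have hw := norm_inv_smul_self_of_ne_zero (h.ne_zero hy)
  have hc : conormalCoord b (revolve p r) y = (e • (‖y‖⁻¹ • y)).ofLp := by
    rw [conormalCoord, h.covectorNormSq_shellNormal hy harc hr, Real.sqrt_one, inv_one, one_smul,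
      h.metricMatrix_inv hy harc hr, radialMatrix_mulVec, hb, real_inner_smul_right,
      real_inner_self_eq_norm_sq, hw]
    ext i
    simp
    ring
  rw [secondFundConormal, hc, h.secondFundMatrix_eq hy hN, dotProduct_radialMatrix_mulVec,
    real_inner_smul_right, real_inner_self_eq_norm_sq, norm_smul e, hw, Real.norm_eq_abs]
  simp only [one_pow, mul_one, sq_abs, he]
  ring

end RevolveCurvature

end

noncomputable section

/-! ### The parameter domain -/

section Shell

variable {n : ℕ} {a b : ℝ} {y : EuclideanSpace ℝ (Fin n)}

theorem isClosed_shell : IsClosed (shell n a b) :=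
  (isClosed_le continuous_const continuous_norm).inter
    (isClosed_le continuous_norm continuous_const)

theorem isCompact_shell : IsCompact (shell n a b) :=
  (isCompact_closedBall (0 : EuclideanSpace ℝ (Fin n)) b).of_isClosed_subset isClosed_shell
    fun y hy => by simpa using hy.2

theorem mem_interior_shell (h1 : a < ‖y‖) (h2 : ‖y‖ < b) : y ∈ interior (shell n a b) :=
  mem_interior.2 ⟨{z | a < ‖z‖ ∧ ‖z‖ < b}, fun _ hz => ⟨hz.1.le, hz.2.le⟩,
    (isOpen_lt continuous_const continuous_norm).inter
      (isOpen_lt continuous_norm continuous_const), h1, h2⟩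

theorem mem_interior_shell_zero (h2 : ‖y‖ < b) : y ∈ interior (shell n 0 b) :=
  mem_interior.2 ⟨{z | ‖z‖ < b}, fun _ hz => ⟨norm_nonneg _, le_of_lt hz⟩,
    isOpen_lt continuous_norm continuous_const, h2⟩

theorem eventually_smul_mem_shell (hy : y ∈ interior (shell n a b)) :
    ∀ᶠ t : ℝ in 𝓝 1, t • y ∈ shell n a b := by
  have h : Tendsto (fun t : ℝ => t • y) (𝓝 1) (𝓝 ((1 : ℝ) • y)) :=
    tendsto_id.smul_const y
  rw [one_smul] at h
  exact h (mem_interior_iff_mem_nhds.1 hy)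

theorem mem_frontier_shell_right (hab : a ≤ b) (hb : 0 < b) (hy : ‖y‖ = b) :
    y ∈ frontier (shell n a b) := by
  rw [isClosed_shell.frontier_eq]
  refine ⟨⟨hy ▸ hab, hy.le⟩, fun hi => ?_⟩
  obtain ⟨t, ht1, ht2⟩ := (((eventually_smul_mem_shell hi).filter_mono
    (nhdsWithin_le_nhds (s := Set.Ioi 1))).and self_mem_nhdsWithin).exists
  have ht2' : (1 : ℝ) < t := ht2
  have h := ht1.2
  rw [norm_smul, hy, Real.norm_eq_abs, abs_of_pos (by linarith)] at h
  nlinarith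

theorem mem_frontier_shell_left (hab : a ≤ b) (ha : 0 < a) (hy : ‖y‖ = a) :
    y ∈ frontier (shell n a b) := by
  rw [isClosed_shell.frontier_eq]
  refine ⟨⟨hy.ge, hy ▸ hab⟩, fun hi => ?_⟩
  have hpos : ∀ᶠ t : ℝ in 𝓝[<] 1, 0 < t :=
    (eventually_gt_nhds one_pos).filter_mono nhdsWithin_le_nhds
  obtain ⟨t, ⟨ht1, ht2⟩, ht3⟩ := ((((eventually_smul_mem_shell hi).filter_mono
    (nhdsWithin_le_nhds (s := Set.Iio 1))).and self_mem_nhdsWithin).and hpos).exists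
  have ht2' : t < (1 : ℝ) := ht2
  have h := ht1.1
  rw [norm_smul, hy, Real.norm_eq_abs, abs_of_pos ht3] at h
  nlinarith

end Shell

/-! ### The generating curve of a Delaunay capillary hypersurface -/

/-- The generating curve `(p, r)`, parametrized by arc length on `[a, b]`, of a hypersurface of
revolution of constant mean curvature `c / n`: its curvature is `c - (n - 1) p' / r`. -/
structure IsDelaunayProfile (n : ℕ) (a b c : ℝ) (J : Set ℝ) (p p₁ p₂ r r₁ r₂ : ℝ → ℝ) : Prop
    extends IsProfile J p p₁ p₂ r r₁ r₂ where
  mem : ∀ s ∈ Set.Icc a b, 0 < s → s ∈ J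
  radius_pos : ∀ s ∈ Set.Icc a b, 0 < s → 0 < r s
  arc : ∀ s ∈ Set.Icc a b, 0 < s → p₁ s ^ 2 + r₁ s ^ 2 = 1
  p₂_eq : ∀ s ∈ Set.Icc a b, 0 < s → p₂ s = (c - (n - 1) * (p₁ s / r s)) * r₁ s
  r₂_eq : ∀ s ∈ Set.Icc a b, 0 < s → r₂ s = -(c - (n - 1) * (p₁ s / r s)) * p₁ s

theorem eq_of_eqOn_Ioo {a b s : ℝ} (hab : a < b) {f : ℝ → ℝ} {C : ℝ} (hs : s ∈ Set.Icc a b)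
    (hf : ContinuousAt f s) (h : ∀ t ∈ Set.Ioo a b, f t = C) : f s = C := by
  have hcl : s ∈ closure (Set.Ioo a b) := by rwa [closure_Ioo hab.ne]
  have := mem_closure_iff_nhdsWithin_neBot.1 hcl
  refine tendsto_nhds_unique (hf.tendsto.mono_left (nhdsWithin_le_nhds (s := Set.Ioo a b))) ?_
  refine tendsto_const_nhds.congr' ?_
  filter_upwards [self_mem_nhdsWithin] with t ht using (h t ht).symm

/-- Pairing the immersion along a ray s w with the axis and with w recovers p and r, which therefore
inherit its smoothness on a neighbourhood of the positive parameters, end points included. -/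
theorem IsImmersedHypersurface.exists_isProfile {n : ℕ} (hn : 0 < n) {a b : ℝ} {p r : ℝ → ℝ}
    {N : EuclideanSpace ℝ (Fin n) → EuclideanSpace ℝ (Fin (n + 1))}
    (h : IsImmersedHypersurface n a b (revolve p r) N) :
    ∃ J : Set ℝ, IsProfile J p (deriv p) (deriv (deriv p)) r (deriv r) (deriv (deriv r)) ∧
      (∀ s ∈ Set.Icc a b, 0 < s → s ∈ J) ∧ ContDiffOn ℝ ∞ p J ∧ ContDiffOn ℝ ∞ r J := by
  obtain ⟨U, hU, hsU, hx⟩ := h.smooth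
  set w : EuclideanSpace ℝ (Fin n) := EuclideanSpace.single ⟨0, hn⟩ 1 with hw
  have hwn : ‖w‖ = 1 := by simp [hw]
  have hline : ContDiff ℝ ∞ fun s : ℝ => s • w := contDiff_id.smul contDiff_const
  set J := Set.Ioi (0 : ℝ) ∩ (fun s : ℝ => s • w) ⁻¹' U with hJ
  have hJo : IsOpen J := isOpen_Ioi.inter (hU.preimage hline.continuous)
  have hnorm : ∀ s ∈ J, ‖s • w‖ = s := fun s hs => by
    rw [norm_smul, hwn, mul_one, Real.norm_eq_abs, abs_of_pos hs.1]
  have hxJ : ContDiffOn ℝ ∞ (fun s : ℝ => revolve p r (s • w)) J :=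
    hx.comp hline.contDiffOn fun s hs => hs.2
  have hp : ContDiffOn ℝ ∞ p J := by
    refine ((contDiffOn_const (c := axisVector n)).inner ℝ hxJ).congr fun s hs => ?_
    rw [revolve_eq, hnorm s hs]
    simp
  have hr : ContDiffOn ℝ ∞ r J := by
    refine ((contDiffOn_const (c := hyperplaneInclusion n w)).inner ℝ hxJ).congr
      fun s hs => ?_
    have : s ≠ 0 := (hs.1 : 0 < s).ne'
    rw [revolve_eq, hnorm s hs]
    simp only [inner_add_right, real_inner_smul_right, inner_axisVector_right,
      hyperplaneInclusion_zero_apply, map_smul, real_inner_self_eq_norm_sq,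
      norm_hyperplaneInclusion, hwn]
    field_simp
    ring
  have key : ∀ f : ℝ → ℝ, ContDiffOn ℝ ∞ f J →
      (∀ s ∈ J, HasDerivAt f (deriv f s) s) ∧ ContDiffOn ℝ ∞ (deriv f) J := by
    intro f hf
    have h2 := (contDiffOn_infty_iff_deriv_of_isOpen hJo).1 hf
    exact ⟨fun s hs => ((h2.1 s hs).differentiableAt (hJo.mem_nhds hs)).hasDerivAt, h2.2⟩
  refine ⟨J, ⟨hJo, fun s hs => hs.1, (key p hp).1, (key _ (key p hp).2).1, (key r hr).1,
    (key _ (key r hr).2).1⟩, fun s hs hs0 => ⟨hs0, hsU ?_⟩, hp, hr⟩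
  have : ‖s • w‖ = s := by rw [norm_smul, hwn, mul_one, Real.norm_eq_abs, abs_of_pos hs0]
  change s • w ∈ shell n a b
  exact ⟨by rw [this]; exact hs.1, by rw [this]; exact hs.2⟩

/-- The normal is known only up to a pointwise sign, so constant mean curvature first gives that the
square of F = κ + (n-1) p'/r is constant. F is continuous on an interval, hence constant.
Differentiating p'² + r'² = 1 turns κ into formulas for p'' and r''. -/
theorem IsDelaunayCapillary.exists_isDelaunayProfile {n : ℕ} (hn : 2 ≤ n) {a b : ℝ} (ha : 0 ≤ a)
    (hab : a < b) {p r : ℝ → ℝ} {N : EuclideanSpace ℝ (Fin n) → EuclideanSpace ℝ (Fin (n + 1))}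
    {θ : ℝ} (hM : IsDelaunayCapillary n a b p r N θ) :
    ∃ (J : Set ℝ) (c : ℝ), IsDelaunayProfile n a b c J p (deriv p) (deriv (deriv p)) r (deriv r)
      (deriv (deriv r)) ∧ ContDiffOn ℝ ∞ p J ∧ ContDiffOn ℝ ∞ r J := by
  have hn0 : 0 < n := by omega
  obtain ⟨J, hJ, hmem, hp, hr⟩ :=
    hM.capillary.toIsImmersedHypersurface.exists_isProfile hn0
  have hcp1 : ∀ s ∈ J, ContinuousAt (deriv p) s := fun s hs => (hJ.hasDerivAt_p₁ s hs).continuousAt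
  have hcr1 : ∀ s ∈ J, ContinuousAt (deriv r) s := fun s hs => (hJ.hasDerivAt_r₁ s hs).continuousAt
  have hcr : ∀ s ∈ J, ContinuousAt r s := fun s hs => (hJ.hasDerivAt_r s hs).continuousAt
  have hcp2 : ∀ s ∈ J, ContinuousAt (deriv (deriv p)) s := by
    have h1 := ((contDiffOn_infty_iff_deriv_of_isOpen hJ.isOpen).1 hp).2
    have h2 := ((contDiffOn_infty_iff_deriv_of_isOpen hJ.isOpen).1 h1).2
    exact fun s hs => h2.continuousOn.continuousAt (hJ.isOpen.mem_nhds hs)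
  have hcr2 : ∀ s ∈ J, ContinuousAt (deriv (deriv r)) s := by
    have h1 := ((contDiffOn_infty_iff_deriv_of_isOpen hJ.isOpen).1 hr).2
    have h2 := ((contDiffOn_infty_iff_deriv_of_isOpen hJ.isOpen).1 h1).2
    exact fun s hs => h2.continuousOn.continuousAt (hJ.isOpen.mem_nhds hs)
  have harc : ∀ s ∈ Set.Icc a b, 0 < s → deriv p s ^ 2 + deriv r s ^ 2 = 1 := fun s hs hs0 =>
    eq_of_eqOn_Ioo (f := fun s => deriv p s ^ 2 + deriv r s ^ 2) hab hs
      (((hcp1 s (hmem s hs hs0)).pow 2).add ((hcr1 s (hmem s hs hs0)).pow 2))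
      hM.arc_length
  have horth : ∀ s ∈ Set.Icc a b, 0 < s →
      deriv p s * deriv (deriv p) s + deriv r s * deriv (deriv r) s = 0 := by
    intro s hs hs0
    have hsJ := hmem s hs hs0
    refine eq_of_eqOn_Ioo (f := fun s => deriv p s * deriv (deriv p) s +
      deriv r s * deriv (deriv r) s) hab hs
      (((hcp1 s hsJ).mul (hcp2 s hsJ)).add ((hcr1 s hsJ).mul (hcr2 s hsJ))) fun t ht => ?_
    have htJ := hmem t ⟨ht.1.le, ht.2.le⟩ (ha.trans_lt ht.1)
    have hd := ((hJ.hasDerivAt_p₁ t htJ).pow 2).add ((hJ.hasDerivAt_r₁ t htJ).pow 2)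
    have hconst : ((deriv p) ^ 2 + (deriv r) ^ 2) =ᶠ[𝓝 t] fun _ => (1 : ℝ) := by
      filter_upwards [Ioo_mem_nhds ht.1 ht.2] with z hz using hM.arc_length z hz
    have := hd.unique ((hasDerivAt_const t (1 : ℝ)).congr_of_eventuallyEq hconst)
    push_cast at this
    linarith
  set T := Set.Icc a b ∩ Set.Ioi 0 with hT
  have hTconn : IsPreconnected T :=
    (Set.ordConnected_Icc.inter Set.ordConnected_Ioi).isPreconnected
  set κ : ℝ → ℝ := fun s => deriv (deriv p) s * deriv r s - deriv (deriv r) s * deriv p s with hκ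
  set F : ℝ → ℝ := fun s => κ s + (n - 1) * (deriv p s / r s) with hF
  obtain ⟨H, hH⟩ := hM.capillary.cmc
  have hnR : (n : ℝ) ≠ 0 := by exact_mod_cast hn0.ne'
  have hsq : ∀ s ∈ T, F s ^ 2 = (n * H) ^ 2 := by
    intro s hs
    set w : EuclideanSpace ℝ (Fin n) := EuclideanSpace.single ⟨0, hn0⟩ 1 with hw
    have hwn : ‖s • w‖ = s := by
      rw [norm_smul, Real.norm_eq_abs, abs_of_pos hs.2]; simp [hw]
    have hsh : s • w ∈ shell n a b := 
      ⟨by rw [hwn]; exact hs.1.1, by rw [hwn]; exact hs.1.2⟩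
    have hsJ : ‖s • w‖ ∈ J := hwn.symm ▸ hmem s hs.1 hs.2
    have hr0 : r ‖s • w‖ ≠ 0 := hwn.symm ▸ (hM.radius_pos s hs.1 hs.2).ne'
    have ha' : deriv p ‖s • w‖ ^ 2 + deriv r ‖s • w‖ ^ 2 = 1 := by
      rw [hwn]; exact harc s hs.1 hs.2
    obtain ⟨ε, hε, hN⟩ := hJ.normal_eq hsJ ha' hr0 (hM.capillary.normal_unit _ hsh)
      (hM.capillary.normal_orthogonal _ hsh)
    have := hJ.meanCurvature_eq hsJ ha' hr0 hN
    rw [hH _ hsh, hwn] at this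
    have e : n * H = ε * F s := by
      rw [this, mul_inv_cancel_left₀ hnR]
    rw [e, mul_pow, hε, one_mul]
  have hFc : ContinuousOn F T := by
    intro s hs
    have hsJ := hmem s hs.1 hs.2
    refine ContinuousAt.continuousWithinAt ?_
    exact (((hcp2 s hsJ).mul (hcr1 s hsJ)).sub ((hcr2 s hsJ).mul (hcp1 s hsJ))).add
      (((hcp1 s hsJ).div (hcr s hsJ) (hM.radius_pos s hs.1 hs.2).ne').const_mul _)
  have hcst : ∃ c, ∀ s ∈ T, F s = c := by
    by_cases h0 : (n : ℝ) * H = 0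
    · refine ⟨0, fun s hs => ?_⟩
      have := hsq s hs
      rw [h0, zero_pow two_ne_zero] at this
      exact pow_eq_zero_iff two_ne_zero |>.1 this
    · rcases hTconn.eq_or_eq_neg_of_sq_eq hFc (continuousOn_const (c := (n : ℝ) * H))
        (fun s hs => hsq s hs) (fun _ => h0) with h1 | h1
      · exact ⟨_, fun s hs => h1 hs⟩
      · exact ⟨_, fun s hs => h1 hs⟩
  obtain ⟨c, hc⟩ := hcst
  have hκc : ∀ s ∈ Set.Icc a b, 0 < s → c - (n - 1) * (deriv p s / r s) = κ s := by
    intro s hs hs0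
    have := hc s ⟨hs, hs0⟩
    simp only [hF] at this
    linarith
  refine ⟨J, c, ⟨hJ, hmem, hM.radius_pos, harc, fun s hs hs0 => ?_, fun s hs hs0 => ?_⟩, hp, hr⟩
  · rw [hκc s hs hs0]
    simp only [hκ]
    linear_combination -(deriv (deriv p) s) * harc s hs hs0 + deriv p s * horth s hs hs0
  · rw [hκc s hs hs0]
    simp only [hκ]
    linear_combination -(deriv (deriv r) s) * harc s hs hs0 + deriv r s * horth s hs hs0

end

noncomputable section

/-! ### Polar coordinates on the parameter domain -/

section PolarShell

variable {n : ℕ}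

theorem integral_shell_eq (hn : 0 < n) {a b : ℝ} (ha : 0 ≤ a) (hab : a ≤ b)
    {G : EuclideanSpace ℝ (Fin n) → ℝ} (hG : IntegrableOn G (shell n a b)) :
    IntegrableOn (fun s : ℝ => s ^ (n - 1) * ∫ w : Metric.sphere (0 : EuclideanSpace ℝ (Fin n)) 1,
      G (s • (w : EuclideanSpace ℝ (Fin n))) ∂volume.toSphere) (Set.Ioc a b) ∧
    ∫ y in shell n a b, G y = ∫ s in a..b, s ^ (n - 1) *
      ∫ w : Metric.sphere (0 : EuclideanSpace ℝ (Fin n)) 1,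
        G (s • (w : EuclideanSpace ℝ (Fin n))) ∂volume.toSphere := by
  have : NeZero n := ⟨hn.ne'⟩
  have hm : MeasurableSet (shell n a b) := isClosed_shell.measurableSet
  obtain ⟨h1, h2⟩ := integral_polar volume ((integrable_indicator_iff hm).2 hG)
  rw [integral_indicator hm] at h2
  rw [finrank_euclideanSpace_fin] at h1 h2
  have hin : ∀ s ∈ Set.Ioi (0 : ℝ), s ^ (n - 1) *
      ∫ w : Metric.sphere (0 : EuclideanSpace ℝ (Fin n)) 1,
        (shell n a b).indicator G (s • (w : EuclideanSpace ℝ (Fin n))) ∂volume.toSphere =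
      (Set.Icc a b).indicator (fun s => s ^ (n - 1) *
        ∫ w : Metric.sphere (0 : EuclideanSpace ℝ (Fin n)) 1,
        G (s • (w : EuclideanSpace ℝ (Fin n))) ∂volume.toSphere) s := by
    intro s hs
    have hnorm : ∀ w : Metric.sphere (0 : EuclideanSpace ℝ (Fin n)) 1,
        ‖s • (w : EuclideanSpace ℝ (Fin n))‖ = s := fun w => by
      rw [norm_smul, norm_eq_of_mem_sphere, mul_one, Real.norm_eq_abs, abs_of_pos hs]
    by_cases h : s ∈ Set.Icc a b
    · rw [Set.indicator_of_mem h]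
      congr 2
      ext w
      rw [Set.indicator_of_mem]
      exact ⟨by rw [hnorm]; exact h.1, by rw [hnorm]; exact h.2⟩
    · rw [Set.indicator_of_notMem h]
      have : ∀ w : Metric.sphere (0 : EuclideanSpace ℝ (Fin n)) 1,
          (shell n a b).indicator G (s • (w : EuclideanSpace ℝ (Fin n))) = 0 := fun w => by
        rw [Set.indicator_of_notMem]
        exact fun hh => h ⟨hnorm w ▸ hh.1, hnorm w ▸ hh.2⟩
      simp [this]
  have h1' := h1.congr_fun hin measurableSet_Ioi
  rw [setIntegral_congr_fun measurableSet_Ioi hin, setIntegral_indicator measurableSet_Icc] at h2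
  have hset : Set.Ioc a b ⊆ Set.Ioi 0 ∩ Set.Icc a b :=
    fun s hs => ⟨ha.trans_lt hs.1, hs.1.le, hs.2⟩
  have hset2 : (Set.Ioi 0 ∩ Set.Icc a b : Set ℝ) =ᵐ[volume] Set.Ioc a b := by
    refine ae_eq_set.2 ⟨measure_mono_null (t := {a}) ?_ (by simp), ?_⟩
    · intro s hs
      by_contra hne
      exact hs.2 ⟨lt_of_le_of_ne hs.1.2.1 (Ne.symm hne), hs.1.2.2⟩
    · rw [Set.sdiff_eq_empty.2 hset, measure_empty]
  constructor
  · rw [IntegrableOn, integrable_indicator_iff measurableSet_Icc, IntegrableOn,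
      Measure.restrict_restrict measurableSet_Icc] at h1'
    refine IntegrableOn.mono_set (t := Set.Icc a b ∩ Set.Ioi 0) h1' ?_
    rw [Set.inter_comm]
    exact hset
  · rw [h2, intervalIntegral.integral_of_le hab, setIntegral_congr_set hset2]

theorem measurableEmbedding_smul_sphere {t : ℝ} (ht : t ≠ 0) :
    MeasurableEmbedding (fun w : Metric.sphere (0 : EuclideanSpace ℝ (Fin n)) 1 =>
      t • (w : EuclideanSpace ℝ (Fin n))) :=
  (MeasurableEquiv.smul₀ t ht).measurableEmbedding.comp
    (MeasurableEmbedding.subtype_coe Metric.isClosed_sphere.measurableSet)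

/-- For a = 0 the inner boundary sphere degenerates to a point and must carry no boundary term. -/
theorem sphereMeasure_zero (hn : 2 ≤ n) : sphereMeasure n 0 = 0 := by
  rw [sphereMeasure, zero_pow (by omega)]
  simp

instance isFiniteMeasure_sphereMeasure (t : ℝ) : IsFiniteMeasure (sphereMeasure n t) := by
  rw [sphereMeasure]
  exact Measure.smul_finite _ ENNReal.ofReal_ne_top

instance isFiniteMeasure_shellBoundaryMeasure (a b : ℝ) :
    IsFiniteMeasure (shellBoundaryMeasure n a b) := by
  rw [shellBoundaryMeasure]
  infer_instance

theorem ae_sphereMeasure {t : ℝ} (ht : 0 ≤ t) {P : EuclideanSpace ℝ (Fin n) → Prop}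
    (h : ∀ y, ‖y‖ = t → P y) : ∀ᵐ y ∂sphereMeasure n t, P y := by
  rw [sphereMeasure]
  refine Measure.ae_smul_measure ?_ _
  have hc : Continuous fun w : Metric.sphere (0 : EuclideanSpace ℝ (Fin n)) 1 =>
      t • (w : EuclideanSpace ℝ (Fin n)) := by fun_prop
  have h1 : ∀ᵐ y ∂Measure.map (fun w : Metric.sphere (0 : EuclideanSpace ℝ (Fin n)) 1 =>
      t • (w : EuclideanSpace ℝ (Fin n))) volume.toSphere, ‖y‖ = t := by
    rw [ae_map_iff hc.measurable.aemeasurable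
      (isClosed_eq continuous_norm continuous_const).measurableSet]
    refine Eventually.of_forall fun w => ?_
    rw [norm_smul, norm_eq_of_mem_sphere, mul_one, Real.norm_eq_abs, abs_of_nonneg ht]
  exact h1.mono h

theorem integral_sphereMeasure (hn : 2 ≤ n) {t : ℝ} (ht : 0 ≤ t)
    (f : EuclideanSpace ℝ (Fin n) → ℝ) :
    ∫ y, f y ∂sphereMeasure n t = t ^ (n - 1) *
      ∫ w : Metric.sphere (0 : EuclideanSpace ℝ (Fin n)) 1,
        f (t • (w : EuclideanSpace ℝ (Fin n))) ∂volume.toSphere := by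
  rcases ht.eq_or_lt with rfl | h
  · rw [sphereMeasure_zero hn, zero_pow (by omega)]
    simp
  · rw [sphereMeasure, integral_smul_measure, (measurableEmbedding_smul_sphere h.ne').integral_map,
      ENNReal.toReal_ofReal (by positivity), smul_eq_mul]

end PolarShell

/-! ### The curvature and the boundary data of a Delaunay capillary hypersurface -/

/-- The principal curvature of the generating curve. -/
def profileCurvature (n : ℕ) (c : ℝ) (p₁ r : ℝ → ℝ) (s : ℝ) : ℝ := c - (n - 1) * (p₁ s / r s)

/-- The tangential component `½ (p² + r²)'` of the position vector. -/
def profileTangential (p p₁ r r₁ : ℝ → ℝ) (s : ℝ) : ℝ := p s * p₁ s + r s * r₁ s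

/-- The normal component of the position vector. -/
def profileSupport (p p₁ r r₁ : ℝ → ℝ) (s : ℝ) : ℝ := p s * r₁ s - r s * p₁ s

section Profile

variable {n : ℕ} {a b c : ℝ} {J : Set ℝ} {p p₁ p₂ r r₁ r₂ : ℝ → ℝ} {s : ℝ}

theorem IsDelaunayProfile.curvature_eq (h : IsDelaunayProfile n a b c J p p₁ p₂ r r₁ r₂)
    (hs : s ∈ Set.Icc a b) (hs0 : 0 < s) :
    p₂ s * r₁ s - r₂ s * p₁ s = profileCurvature n c p₁ r s := by
  rw [h.p₂_eq s hs hs0, h.r₂_eq s hs hs0, profileCurvature]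
  linear_combination (c - (n - 1) * (p₁ s / r s)) * h.arc s hs hs0

theorem IsDelaunayProfile.hasDerivAt_tangential
    (h : IsDelaunayProfile n a b c J p p₁ p₂ r r₁ r₂) (hs : s ∈ Set.Icc a b) (hs0 : 0 < s) :
    HasDerivAt (profileTangential p p₁ r r₁)
      (1 + profileCurvature n c p₁ r s * profileSupport p p₁ r r₁ s) s := by
  have hJ := h.mem s hs hs0
  refine (((h.hasDerivAt_p s hJ).mul (h.hasDerivAt_p₁ s hJ)).add
    ((h.hasDerivAt_r s hJ).mul (h.hasDerivAt_r₁ s hJ))).congr_deriv ?_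
  rw [h.p₂_eq s hs hs0, h.r₂_eq s hs hs0, profileCurvature, profileSupport]
  linear_combination h.arc s hs hs0

theorem IsDelaunayProfile.hasDerivAt_support
    (h : IsDelaunayProfile n a b c J p p₁ p₂ r r₁ r₂) (hs : s ∈ Set.Icc a b) (hs0 : 0 < s) :
    HasDerivAt (profileSupport p p₁ r r₁)
      (-(profileCurvature n c p₁ r s * profileTangential p p₁ r r₁ s)) s := by
  have hJ := h.mem s hs hs0
  refine (((h.hasDerivAt_p s hJ).mul (h.hasDerivAt_r₁ s hJ)).sub
    ((h.hasDerivAt_r s hJ).mul (h.hasDerivAt_p₁ s hJ))).congr_deriv ?_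
  rw [h.p₂_eq s hs hs0, h.r₂_eq s hs hs0, profileCurvature, profileTangential]
  ring

theorem IsDelaunayProfile.hasDerivAt_curvature
    (h : IsDelaunayProfile n a b c J p p₁ p₂ r r₁ r₂) (hs : s ∈ Set.Icc a b) (hs0 : 0 < s) :
    HasDerivAt (profileCurvature n c p₁ r)
      (-((n - 1) * (r₁ s / r s) * (profileCurvature n c p₁ r s - p₁ s / r s))) s := by
  have hJ := h.mem s hs hs0
  have hr := (h.radius_pos s hs hs0).ne'
  refine ((((h.hasDerivAt_p₁ s hJ).div (h.hasDerivAt_r s hJ) hr).const_mul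
    ((n : ℝ) - 1)).const_sub c).congr_deriv ?_
  rw [h.p₂_eq s hs hs0, profileCurvature]
  field_simp

theorem norm_revolve_sq {y : EuclideanSpace ℝ (Fin n)} (hy : y ≠ 0) :
    ‖revolve p r y‖ ^ 2 = p ‖y‖ ^ 2 + r ‖y‖ ^ 2 := by
  have hs := norm_ne_zero_iff.2 hy
  rw [revolve_eq, ← real_inner_self_eq_norm_sq]
  simp only [inner_add_left, inner_add_right, real_inner_smul_left, real_inner_smul_right,
    inner_axisVector_right, hyperplaneInclusion_zero_apply, real_inner_self_eq_norm_sq, norm_smul,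
    norm_axisVector, norm_hyperplaneInclusion, mul_pow, Real.norm_eq_abs, sq_abs, inner_axisVector]
  field_simp
  ring

theorem inner_revolveNormal_revolve {y : EuclideanSpace ℝ (Fin n)} (hy : y ≠ 0) :
    inner ℝ (revolveNormal p₁ r₁ y) (revolve p r y) = profileSupport p p₁ r r₁ ‖y‖ := by
  have hs := norm_ne_zero_iff.2 hy
  rw [revolve_eq, revolveNormal, profileSupport]
  simp only [inner_add_right, inner_sub_left, real_inner_smul_left, real_inner_smul_right,
    inner_axisVector, inner_axisVector_right, hyperplaneInclusion_zero_apply, norm_axisVector,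
    inner_hyperplaneInclusion, real_inner_self_eq_norm_sq]
  field_simp
  ring

variable {N : EuclideanSpace ℝ (Fin n) → EuclideanSpace ℝ (Fin (n + 1))} {θ : ℝ}
  {y : EuclideanSpace ℝ (Fin n)}

theorem IsDelaunayProfile.normal (h : IsDelaunayProfile n a b c J p p₁ p₂ r r₁ r₂)
    (hM : IsImmersedHypersurface n a b (revolve p r) N) (hy : y ∈ shell n a b) (hy0 : 0 < ‖y‖) :
    ∃ ε : ℝ, ε ^ 2 = 1 ∧ N y = ε • revolveNormal p₁ r₁ y :=
  h.normal_eq (h.mem _ hy hy0) (h.arc _ hy hy0) (h.radius_pos _ hy hy0).ne'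
    (hM.normal_unit _ hy) (hM.normal_orthogonal _ hy)

theorem IsDelaunayProfile.secondFundNormSq_eq_curvature (h : IsDelaunayProfile n a b c J p p₁ p₂ r r₁ r₂)
    (hM : IsImmersedHypersurface n a b (revolve p r) N) (hy : y ∈ shell n a b) (hy0 : 0 < ‖y‖) :
    secondFundNormSq (revolve p r) N y =
      profileCurvature n c p₁ r ‖y‖ ^ 2 + (n - 1) * (p₁ ‖y‖ / r ‖y‖) ^ 2 := by
  obtain ⟨ε, hε, hN⟩ := h.normal hM hy hy0
  rw [h.secondFundNormSq_eq (h.mem _ hy hy0) (h.arc _ hy hy0) (h.radius_pos _ hy hy0).ne' hε hN,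
    h.curvature_eq hy hy0]

theorem IsCapillaryInBall.boundary_sq_add_sq (hM : IsCapillaryInBall n a b (revolve p r) N θ)
    (hy : y ∈ frontier (shell n a b)) (hy0 : y ≠ 0) : p ‖y‖ ^ 2 + r ‖y‖ ^ 2 = 1 := by
  rw [← norm_revolve_sq hy0, hM.boundary_mem y hy, one_pow]

theorem IsCapillaryInBall.cos_eq (hM : IsCapillaryInBall n a b (revolve p r) N θ)
    (hy : y ∈ frontier (shell n a b)) : Real.cos θ = inner ℝ (N y) (revolve p r y) := by
  have hys : y ∈ shell n a b := isClosed_shell.frontier_subset hy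
  rw [← hM.contact_angle y hy, InnerProductGeometry.cos_angle, hM.boundary_mem y hy,
    hM.normal_unit y hys]
  simp

/-- Both cos θ = ⟨N, x⟩ and σ(ν, ν) carry the sign ε, so their product does not, and q = (1 +
κβ)/sin θ, the derivative of the tangential component over sin θ. Tangential and normal components
of x have squares adding up to |x|² = 1. -/
theorem IsDelaunayProfile.boundaryCoeff_eq (h : IsDelaunayProfile n a b c J p p₁ p₂ r r₁ r₂)
    (hM : IsCapillaryInBall n a b (revolve p r) N θ) (hy : y ∈ frontier (shell n a b))
    (hy0 : y ≠ 0) :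
    boundaryCoeff b (revolve p r) N θ y =
      (1 + profileCurvature n c p₁ r ‖y‖ * profileSupport p p₁ r r₁ ‖y‖) / Real.sin θ ∧
    profileTangential p p₁ r r₁ ‖y‖ ^ 2 = Real.sin θ ^ 2 := by
  have hys : y ∈ shell n a b := isClosed_shell.frontier_subset hy
  have hpos := norm_pos_iff.2 hy0
  obtain ⟨ε, hε, hN⟩ := h.normal hM.toIsImmersedHypersurface hys hpos
  have hcos := IsCapillaryInBall.cos_eq hM hy
  rw [hN, real_inner_smul_left, inner_revolveNormal_revolve hy0] at hcos
  constructor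
  · rw [boundaryCoeff, h.secondFundConormal_eq (h.mem _ hys hpos) (h.arc _ hys hpos)
      (h.radius_pos _ hys hpos).ne' b hN, h.curvature_eq hys hpos, hcos, add_div]
    congr 1
    linear_combination (profileSupport p p₁ r r₁ ‖y‖ * profileCurvature n c p₁ r ‖y‖ / Real.sin θ) * hε
  · have h1 := Real.sin_sq_add_cos_sq θ
    rw [hcos, mul_pow, hε, one_mul] at h1
    have h2 := IsCapillaryInBall.boundary_sq_add_sq hM hy hy0
    have h3 := h.arc _ hys hpos
    have h4 : profileTangential p p₁ r r₁ ‖y‖ ^ 2 + profileSupport p p₁ r r₁ ‖y‖ ^ 2 =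
        (p ‖y‖ ^ 2 + r ‖y‖ ^ 2) * (p₁ ‖y‖ ^ 2 + r₁ ‖y‖ ^ 2) := by
      rw [profileTangential, profileSupport]; ring
    rw [h2, h3] at h4
    linarith

theorem IsDelaunayProfile.hasDerivAt_sq (h : IsDelaunayProfile n a b c J p p₁ p₂ r r₁ r₂)
    (hs : s ∈ Set.Icc a b) (hs0 : 0 < s) :
    HasDerivAt (fun s => p s ^ 2 + r s ^ 2) (2 * profileTangential p p₁ r r₁ s) s := by
  have hJ := h.mem s hs hs0
  refine (((h.hasDerivAt_p s hJ).pow 2).add ((h.hasDerivAt_r s hJ).pow 2)).congr_deriv ?_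
  rw [profileTangential]
  push_cast
  ring

theorem nonneg_of_hasDerivAt_of_le_left {f : ℝ → ℝ} {f' a b : ℝ} (hab : a < b)
    (hf : HasDerivAt f f' b) (h : ∀ s ∈ Set.Ioo a b, f s ≤ f b) : 0 ≤ f' := by
  refine ge_of_tendsto (hf.tendsto_slope.mono_left (nhdsWithin_mono b (s := Set.Iio b)
    fun x (hx : x < b) => hx.ne)) ?_
  filter_upwards [Ioo_mem_nhdsLT hab] with s hs
  rw [slope_def_field]
  exact div_nonneg_of_nonpos (by linarith [h s hs]) (by linarith [hs.2])

theorem nonpos_of_hasDerivAt_of_le_right {f : ℝ → ℝ} {f' a b : ℝ} (hab : a < b)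
    (hf : HasDerivAt f f' a) (h : ∀ s ∈ Set.Ioo a b, f s ≤ f a) : f' ≤ 0 := by
  refine le_of_tendsto (hf.tendsto_slope.mono_left (nhdsWithin_mono a (s := Set.Ioi a)
    fun x (hx : a < x) => hx.ne')) ?_
  filter_upwards [Ioo_mem_nhdsGT hab] with s hs
  rw [slope_def_field]
  exact div_nonpos_of_nonpos_of_nonneg (by linarith [h s hs]) (by linarith [hs.1])

theorem exists_euclidean_norm_eq (hn : 0 < n) {s : ℝ} (hs : 0 ≤ s) :
    ∃ y : EuclideanSpace ℝ (Fin n), ‖y‖ = s :=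
  ⟨EuclideanSpace.single ⟨0, hn⟩ s, by simp [abs_of_nonneg hs]⟩

theorem IsCapillaryInBall.sq_add_sq_lt (hn : 0 < n) (ha : 0 ≤ a)
    (hM : IsCapillaryInBall n a b (revolve p r) N θ)
    (hs : s ∈ Set.Ioo a b) : p s ^ 2 + r s ^ 2 < 1 := by
  have hs0 : 0 < s := ha.trans_lt hs.1
  obtain ⟨y, rfl⟩ := exists_euclidean_norm_eq hn hs0.le
  rw [← norm_revolve_sq (norm_pos_iff.1 hs0)]
  have := hM.interior_mem y (mem_interior_shell hs.1 hs.2)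
  nlinarith [norm_nonneg (revolve p r y)]

/-- The contact angle determines only the square. The sign comes from |x|² being largest at the end
point, its derivative being twice the tangential component. -/
theorem IsDelaunayProfile.tangential_right (hn : 0 < n) (ha : 0 ≤ a) (hab : a < b)
    (h : IsDelaunayProfile n a b c J p p₁ p₂ r r₁ r₂)
    (hM : IsCapillaryInBall n a b (revolve p r) N θ) :
    profileTangential p p₁ r r₁ b = Real.sin θ := by
  have hb : 0 < b := ha.trans_lt hab
  obtain ⟨y, hy⟩ := exists_euclidean_norm_eq hn hb.le
  have hy0 : y ≠ 0 := norm_pos_iff.1 (hy ▸ hb)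
  have hf := mem_frontier_shell_right hab.le hb hy
  have h1 := (h.boundaryCoeff_eq hM hf hy0).2
  have h2 := IsCapillaryInBall.boundary_sq_add_sq hM hf hy0
  rw [hy] at h1 h2
  have h3 := nonneg_of_hasDerivAt_of_le_left hab (h.hasDerivAt_sq ⟨hab.le, le_rfl⟩ hb)
    fun s hs => by
      rw [h2]; exact (IsCapillaryInBall.sq_add_sq_lt hn ha hM hs).le
  exact (sq_eq_sq₀ (by linarith) (Real.sin_pos_of_pos_of_lt_pi hM.angle_pos hM.angle_lt_pi).le).1 h1

theorem IsDelaunayProfile.tangential_left (hn : 0 < n) (ha : 0 < a) (hab : a < b)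
    (h : IsDelaunayProfile n a b c J p p₁ p₂ r r₁ r₂)
    (hM : IsCapillaryInBall n a b (revolve p r) N θ) :
    profileTangential p p₁ r r₁ a = -Real.sin θ := by
  obtain ⟨y, hy⟩ := exists_euclidean_norm_eq hn ha.le
  have hy0 : y ≠ 0 := norm_pos_iff.1 (hy ▸ ha)
  have hf := mem_frontier_shell_left hab.le ha hy
  have h1 := (h.boundaryCoeff_eq hM hf hy0).2
  have h2 := IsCapillaryInBall.boundary_sq_add_sq hM hf hy0
  rw [hy] at h1 h2
  have h3 := nonpos_of_hasDerivAt_of_le_right hab (h.hasDerivAt_sq ⟨le_rfl, hab.le⟩ ha)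
    fun s hs => by
      rw [h2]; exact (IsCapillaryInBall.sq_add_sq_lt hn ha.le hM hs).le
  have h4 := (sq_eq_sq₀ (a := -profileTangential p p₁ r r₁ a) (by linarith)
    (Real.sin_pos_of_pos_of_lt_pi hM.angle_pos hM.angle_lt_pi).le).1 (by rw [neg_sq]; exact h1)
  linarith

end Profile

end

noncomputable section

/-! ### A destabilizing radial function -/

/-- If `u` solves a Jacobi equation in divergence form and changes sign, then for small `η > 0` the
index form is smaller on `√(u² + η²)` than the boundary terms. -/
theorem exists_jacobi_perturbation_neg {a b m : ℝ} (hab : a < b) (hm : 0 < m) {u v S ρ : ℝ → ℝ}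
    (hu : ∀ s ∈ Set.Icc a b, HasDerivAt u (v s) s)
    (hJ : ∀ s ∈ Set.Icc a b, HasDerivAt (fun s => ρ s * (u s * v s))
      (ρ s * (v s ^ 2 + S s * u s ^ 2)) s)
    (hv : ContinuousOn v (Set.Icc a b)) (hS : ContinuousOn S (Set.Icc a b))
    (hρ : ContinuousOn ρ (Set.Icc a b)) (hρpos : ∀ s ∈ Set.Icc a b, 0 < ρ s)
    (ha : u a = -m) (hb : u b = m) :
    ∃ η : ℝ, 0 < η ∧ ∫ s in a..b, ((u s * v s) ^ 2 / (u s ^ 2 + η ^ 2) +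
        S s * (u s ^ 2 + η ^ 2)) * ρ s <
      v a / m * (m ^ 2 + η ^ 2) * ρ a + v b / m * (m ^ 2 + η ^ 2) * ρ b := by
  have huc : ContinuousOn u (Set.Icc a b) := fun s hs => (hu s hs).continuousAt.continuousWithinAt
  obtain ⟨x₀, hx₀, hmin⟩ := isCompact_Icc.exists_isMinOn ⟨a, le_rfl, hab.le⟩ hρ
  set m₀ := ρ x₀
  have hm₀ : 0 < m₀ := hρpos x₀ hx₀
  obtain ⟨s₀, hs₀, hus₀⟩ : ∃ s ∈ Set.Icc a b, u s = 0 := by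
    have := intermediate_value_Icc hab.le huc (show (0 : ℝ) ∈ Set.Icc (u a) (u b) by
      rw [ha, hb]; constructor <;> linarith)
    obtain ⟨s, hs, h⟩ := this
    exact ⟨s, hs, h⟩
  -- Writing F² = u² + η², one has F'² = v² - η² v²/(u² + η²). The η-independent part integrates to
  -- the boundary terms by the Jacobi equation, so the claim becomes ∫ ρ v²/(u² + η²) > C, and this
  -- integral blows up logarithmically as η → 0.
  set C := (∫ s in a..b, S s * ρ s) - (v a * ρ a + v b * ρ b) / m with hC
  obtain ⟨L, hL⟩ : ∃ L : ℝ, C < m₀ * (L - (b - a)) :=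
    ⟨(C + 1) / m₀ + (b - a), by field_simp; linarith⟩
  -- Chosen so that log(m²/η²) = L.
  set η := m * Real.exp (-L / 2) with hη
  have hηpos : 0 < η := by positivity
  have hη2 : η ^ 2 = m ^ 2 * Real.exp (-L) := by
    rw [hη, mul_pow, ← Real.exp_nat_mul]; congr 2; push_cast; ring
  have hden : ∀ s, 0 < u s ^ 2 + η ^ 2 := fun s => by positivity
  have hq : ContinuousOn (fun s => v s ^ 2 / (u s ^ 2 + η ^ 2)) (Set.Icc a b) :=
    (hv.pow 2).div ((huc.pow 2).add continuousOn_const) fun s _ => (hden s).ne'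
  have hsub : Set.Icc s₀ b ⊆ Set.Icc a b := Set.Icc_subset_Icc_left hs₀.1
  have hI : ∀ {f : ℝ → ℝ}, ContinuousOn f (Set.Icc a b) → IntervalIntegrable f volume a b :=
    fun hf => ContinuousOn.intervalIntegrable_of_Icc hab.le hf
  have hI₀ : ∀ {f : ℝ → ℝ}, ContinuousOn f (Set.Icc a b) → IntervalIntegrable f volume s₀ b :=
    fun hf => ContinuousOn.intervalIntegrable_of_Icc hs₀.2 (hf.mono hsub)
  have hw : ContinuousOn (fun s => 2 * u s * v s / (u s ^ 2 + η ^ 2)) (Set.Icc a b) :=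
    ((continuousOn_const.mul huc).mul hv).div ((huc.pow 2).add continuousOn_const)
      fun s _ => (hden s).ne'
  have hSρ : ContinuousOn (fun s => S s * ρ s) (Set.Icc a b) := hS.mul hρ
  have hqρ : ContinuousOn (fun s => v s ^ 2 / (u s ^ 2 + η ^ 2) * ρ s) (Set.Icc a b) := hq.mul hρ
  have key : m₀ * (L - (b - a)) ≤ ∫ s in a..b, v s ^ 2 / (u s ^ 2 + η ^ 2) * ρ s := by
    have hlog : ∫ s in s₀..b, 2 * u s * v s / (u s ^ 2 + η ^ 2) =
        Real.log (u b ^ 2 + η ^ 2) - Real.log (u s₀ ^ 2 + η ^ 2) := by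
      refine intervalIntegral.integral_eq_sub_of_hasDerivAt
        (f := fun s => Real.log (u s ^ 2 + η ^ 2)) (fun s hs => ?_) ?_
      · rw [Set.uIcc_of_le hs₀.2] at hs
        refine ((((hu s (hsub hs)).pow 2).add_const (η ^ 2)).log (hden s).ne').congr_deriv ?_
        push_cast
        simp
      · exact hI₀ hw
    -- From v² ≥ 2uv - u² the integrand is at least 2uv/(u² + η²) - 1, whose first term is the
    -- derivative of log(u² + η²). Starting from a zero s₀ of u, no assumption on the order of the
    -- zero is needed.
    have h1 : L - (b - a) ≤ ∫ s in s₀..b, v s ^ 2 / (u s ^ 2 + η ^ 2) := by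
      calc L - (b - a) ≤ (Real.log (u b ^ 2 + η ^ 2) - Real.log (u s₀ ^ 2 + η ^ 2)) - (b - s₀) := by
            rw [hus₀, hb, hη2]
            have e1 : Real.log (m ^ 2) ≤ Real.log (m ^ 2 + m ^ 2 * Real.exp (-L)) :=
              Real.log_le_log (by positivity) (by linarith [mul_pos (pow_pos hm 2) (Real.exp_pos (-L))])
            have e2 : Real.log (0 ^ 2 + m ^ 2 * Real.exp (-L)) = Real.log (m ^ 2) - L := by
              rw [zero_pow two_ne_zero, zero_add, Real.log_mul (by positivity) (by positivity),
                Real.log_exp]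
              ring
            rw [e2]
            linarith [hs₀.1]
        _ = ∫ s in s₀..b, (2 * u s * v s / (u s ^ 2 + η ^ 2) - 1) := by
            rw [intervalIntegral.integral_sub (hI₀ hw) intervalIntegrable_const, hlog]
            simp
        _ ≤ _ := by
            refine intervalIntegral.integral_mono_on hs₀.2 ?_ (hI₀ hq) fun s _ => ?_
            · exact (hI₀ hw).sub intervalIntegrable_const
            · rw [div_sub_one (hden s).ne']
              refine div_le_div_of_nonneg_right ?_ (hden s).le
              nlinarith [sq_nonneg (u s - v s), sq_nonneg η]
    have h2 : ∫ s in s₀..b, v s ^ 2 / (u s ^ 2 + η ^ 2) ≤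
        ∫ s in a..b, v s ^ 2 / (u s ^ 2 + η ^ 2) :=
      intervalIntegral.integral_mono_interval hs₀.1 hs₀.2 le_rfl
        (Eventually.of_forall fun s => div_nonneg (sq_nonneg _) (hden s).le) (hI hq)
    calc m₀ * (L - (b - a)) ≤ m₀ * ∫ s in a..b, v s ^ 2 / (u s ^ 2 + η ^ 2) :=
          mul_le_mul_of_nonneg_left (h1.trans h2) hm₀.le
      _ = ∫ s in a..b, m₀ * (v s ^ 2 / (u s ^ 2 + η ^ 2)) := by
          rw [intervalIntegral.integral_const_mul]
      _ ≤ _ := by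
          refine intervalIntegral.integral_mono_on hab.le (hI (continuousOn_const.mul hq))
            (hI hqρ) fun s hs => ?_
          rw [mul_comm]
          exact mul_le_mul_of_nonneg_left (hmin hs) (div_nonneg (sq_nonneg _) (hden s).le)
  refine ⟨η, hηpos, ?_⟩
  have hJc : ContinuousOn (fun s => ρ s * (v s ^ 2 + S s * u s ^ 2)) (Set.Icc a b) :=
    hρ.mul ((hv.pow 2).add (hS.mul (huc.pow 2)))
  have hJint : ∫ s in a..b, ρ s * (v s ^ 2 + S s * u s ^ 2) =
      ρ b * (u b * v b) - ρ a * (u a * v a) :=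
    intervalIntegral.integral_eq_sub_of_hasDerivAt
      (fun s hs => hJ s (by rwa [Set.uIcc_of_le hab.le] at hs)) (hI hJc)
  have hsplit : ∫ s in a..b, ((u s * v s) ^ 2 / (u s ^ 2 + η ^ 2) +
        S s * (u s ^ 2 + η ^ 2)) * ρ s = (∫ s in a..b, ρ s * (v s ^ 2 + S s * u s ^ 2)) +
        η ^ 2 * ((∫ s in a..b, S s * ρ s) -
          ∫ s in a..b, v s ^ 2 / (u s ^ 2 + η ^ 2) * ρ s) := by
    have hD : ContinuousOn (fun s => η ^ 2 * (S s * ρ s - v s ^ 2 / (u s ^ 2 + η ^ 2) * ρ s))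
        (Set.Icc a b) := continuousOn_const.mul (hSρ.sub hqρ)
    rw [← intervalIntegral.integral_sub (hI hSρ) (hI hqρ),
      ← intervalIntegral.integral_const_mul, ← intervalIntegral.integral_add (hI hJc)
        (hI hD)]
    refine intervalIntegral.integral_congr fun s _ => ?_
    have := (hden s).ne'
    field_simp
    ring
  rw [hsplit, hJint, ha, hb]
  have hfin : (∫ s in a..b, S s * ρ s) - (∫ s in a..b, v s ^ 2 / (u s ^ 2 + η ^ 2) * ρ s) <
      (v a * ρ a + v b * ρ b) / m := by linarith
  have h3 := mul_lt_mul_of_pos_left hfin (pow_pos hηpos 2)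
  calc _ < ρ b * (m * v b) - ρ a * (-m * v a) + η ^ 2 * ((v a * ρ a + v b * ρ b) / m) := by
        linarith
    _ = _ := by field_simp; ring

/-! ### Infinitesimal rotations of the ball as Jacobi fields. -/

section Jacobi

variable {n : ℕ} {a b c : ℝ} {J : Set ℝ} {p p₁ p₂ r r₁ r₂ : ℝ → ℝ} {s : ℝ}

/-- The Jacobi equation for the tangential component of the position vector. -/
theorem IsDelaunayProfile.hasDerivAt_jacobi (hn : 2 ≤ n)
    (h : IsDelaunayProfile n a b c J p p₁ p₂ r r₁ r₂) (hs : s ∈ Set.Icc a b) (hs0 : 0 < s) :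
    HasDerivAt (fun s => r s ^ (n - 1) * (profileTangential p p₁ r r₁ s *
        (1 + profileCurvature n c p₁ r s * profileSupport p p₁ r r₁ s)))
      (r s ^ (n - 1) * ((1 + profileCurvature n c p₁ r s * profileSupport p p₁ r r₁ s) ^ 2 +
        ((n - 1) / r s ^ 2 - (profileCurvature n c p₁ r s ^ 2 + (n - 1) * (p₁ s / r s) ^ 2)) *
          profileTangential p p₁ r r₁ s ^ 2)) s := by
  have hr := (h.radius_pos s hs hs0).ne'
  obtain ⟨k, rfl⟩ : ∃ k, n = k + 2 := ⟨n - 2, by omega⟩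
  have e : k + 2 - 1 = k + 1 := by omega
  rw [e]
  refine (((h.hasDerivAt_r s (h.mem s hs hs0)).pow (k + 1)).mul ((h.hasDerivAt_tangential hs hs0).mul
    (((h.hasDerivAt_curvature hs hs0).mul (h.hasDerivAt_support hs hs0)).const_add 1))).congr_deriv ?_
  -- The component of x orthogonal to the axis, expressed in the tangent-normal frame of the curve;
  -- with the Codazzi formula for κ' it closes the equation for u.
  have hu : r₁ s * profileTangential p p₁ r r₁ s - p₁ s * profileSupport p p₁ r r₁ s = r s := by
    rw [profileTangential, profileSupport]
    linear_combination r s * h.arc s hs hs0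
  have harc := h.arc s hs hs0
  simp only [Pi.mul_apply, Pi.pow_apply]
  generalize profileTangential p p₁ r r₁ s = u at *
  generalize profileSupport p p₁ r r₁ s = β at *
  generalize profileCurvature (k + 2) c p₁ r s = κ at *
  have e2 : k + 1 - 1 = k := by omega
  rw [e2]
  push_cast
  rw [pow_succ (r s) k]
  generalize r s ^ k = R
  field_simp
  linear_combination ((k : ℝ) + 1) * R * u * (u * harc - r₁ s * hu)

end Jacobi

end

noncomputable section

/-! ### Smooth functions as elements of `H¹` -/

section SmoothTriple

variable {n : ℕ} {a b : ℝ}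

theorem ae_shellBoundaryMeasure (ha : 0 ≤ a) (hab : a ≤ b) {P : EuclideanSpace ℝ (Fin n) → Prop}
    (h : ∀ y, ‖y‖ = a ∨ ‖y‖ = b → P y) : ∀ᵐ y ∂shellBoundaryMeasure n a b, P y := by
  rw [shellBoundaryMeasure, ae_add_measure_iff]
  exact ⟨ae_sphereMeasure ha fun y hy => h y (Or.inl hy),
    ae_sphereMeasure (ha.trans hab) fun y hy => h y (Or.inr hy)⟩

instance isFiniteMeasure_restrict_shell :
    IsFiniteMeasure ((volume : Measure (EuclideanSpace ℝ (Fin n))).restrict (shell n a b)) :=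
  ⟨by rw [Measure.restrict_apply_univ]; exact isCompact_shell.measure_lt_top⟩

theorem memLp_shell_of_continuous {E : Type*} [NormedAddCommGroup E]
    [SecondCountableTopologyEither (EuclideanSpace ℝ (Fin n)) E]
    {f : EuclideanSpace ℝ (Fin n) → E} (hf : Continuous f) :
    MemLp f 2 (volume.restrict (shell n a b)) := by
  obtain ⟨C, hC⟩ := isCompact_shell.exists_bound_of_continuousOn (s := shell n a b) hf.continuousOn
  exact MemLp.of_bound hf.aestronglyMeasurable C
    ((ae_restrict_iff' isClosed_shell.measurableSet).2 (Eventually.of_forall hC))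

theorem memLp_shellBoundary_of_continuous (ha : 0 ≤ a) (hab : a ≤ b)
    {f : EuclideanSpace ℝ (Fin n) → ℝ} (hf : Continuous f) :
    MemLp f 2 (shellBoundaryMeasure n a b) := by
  obtain ⟨C, hC⟩ := isCompact_shell.exists_bound_of_continuousOn (s := shell n a b) hf.continuousOn
  refine MemLp.of_bound hf.aestronglyMeasurable C (ae_shellBoundaryMeasure ha hab fun y hy =>
    hC y ?_)
  rcases hy with h | h
  · exact ⟨h.ge, h.le.trans hab⟩
  · exact ⟨hab.trans h.ge, h.le⟩

theorem isSobolevTriple_of_contDiff (ha : 0 ≤ a) (hab : a ≤ b)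
    {φ : EuclideanSpace ℝ (Fin n) → ℝ} (hφ : ContDiff ℝ ∞ φ) :
    IsSobolevTriple n a b φ (gradient φ) φ where
  memLp_fun := memLp_shell_of_continuous hφ.continuous
  memLp_grad := memLp_shell_of_continuous (continuous_gradient (hφ.of_le (by simp)))
  memLp_trace := memLp_shellBoundary_of_continuous ha hab hφ.continuous
  approx := ⟨fun _ => φ, fun _ => hφ, by simp, by simp, by simp⟩

end SmoothTriple

/-! ### Functions of degree one on the spheres -/

section DegreeOne

variable {n : ℕ} {a b : ℝ}

theorem exists_contDiff_cutoff {J : Set ℝ} (hJ : IsOpen J) (hab : a ≤ b) (h : Set.Icc a b ⊆ J) :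
    ∃ χ : ℝ → ℝ, ContDiff ℝ ∞ χ ∧ tsupport χ ⊆ J ∧ ∀ s ∈ Set.Icc a b, ∀ᶠ t in 𝓝 s, χ t = 1 := by
  obtain ⟨δ, hδ, hsub⟩ := isCompact_Icc.exists_cthickening_subset_open hJ h
  let f : ContDiffBump ((a + b) / 2 : ℝ) := ⟨(b - a) / 2 + δ / 2, (b - a) / 2 + δ, by linarith,
    by linarith⟩
  refine ⟨f, f.contDiff, ?_, fun s hs => f.eventuallyEq_one_of_mem_ball ?_⟩
  · rw [f.tsupport_eq]
    refine Set.Subset.trans ?_ hsub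
    intro t ht
    rw [Metric.mem_closedBall, Real.dist_eq, abs_le] at ht
    obtain ⟨h1, h2⟩ := ht
    change -((b - a) / 2 + δ) ≤ _ at h1
    change _ ≤ (b - a) / 2 + δ at h2
    rcases lt_or_ge t a with hta | hta
    · refine Metric.mem_cthickening_of_dist_le t a δ _ ⟨le_rfl, hab⟩ ?_
      rw [Real.dist_eq, abs_le]
      constructor <;> linarith
    rcases lt_or_ge b t with htb | htb
    · refine Metric.mem_cthickening_of_dist_le t b δ _ ⟨hab, le_rfl⟩ ?_
      rw [Real.dist_eq, abs_le]
      constructor <;> linarith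
    · exact Metric.self_subset_cthickening _ ⟨hta, htb⟩
  · rw [Metric.mem_ball, Real.dist_eq, abs_lt]
    change -((b - a) / 2 + δ / 2) < _ ∧ _ < (b - a) / 2 + δ / 2
    constructor <;> linarith [hs.1, hs.2]

/-- The cutoff removes the singularity at the origin, since H¹ is tested with functions smooth on
all of ℝⁿ. Equality holds near each point of the shell, so gradients agree up to the boundary, and
oddness gives mean zero. -/
theorem exists_contDiff_degreeOne {J : Set ℝ} (hJ : IsOpen J) (hpos : ∀ s ∈ J, 0 < s) (hab : a ≤ b)
    (h : Set.Icc a b ⊆ J) {F : ℝ → ℝ} (hF : ContDiffOn ℝ ∞ F J) (j : Fin n) :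
    ∃ φ : EuclideanSpace ℝ (Fin n) → ℝ, ContDiff ℝ ∞ φ ∧ (∀ y, φ (-y) = -φ y) ∧
      ∀ y ∈ shell n a b, φ =ᶠ[𝓝 y] fun z => F ‖z‖ / ‖z‖ * z j := by
  obtain ⟨χ, hχ, hsupp, hone⟩ := exists_contDiff_cutoff hJ hab h
  refine ⟨fun z => χ ‖z‖ * (F ‖z‖ / ‖z‖ * z j), contDiff_iff_contDiffAt.2 fun y => ?_, fun y => ?_,
    fun y hy => ?_⟩
  · by_cases hy : ‖y‖ ∈ J
    · have hy0 : y ≠ 0 := norm_pos_iff.1 (hpos _ hy)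
      have hN : ContDiffAt ℝ ∞ (fun z : EuclideanSpace ℝ (Fin n) => ‖z‖) y := contDiffAt_norm ℝ hy0
      have hj : ContDiffAt ℝ ∞ (fun z : EuclideanSpace ℝ (Fin n) => z j) y :=
        (EuclideanSpace.proj (𝕜 := ℝ) j).contDiff.contDiffAt
      have hFy : ContDiffAt ℝ ∞ F ‖y‖ := hF.contDiffAt (hJ.mem_nhds hy)
      exact (hχ.contDiffAt.comp y hN).mul
        (((hFy.comp y hN).div hN (norm_ne_zero_iff.2 hy0)).mul hj)
    · have h0 : ∀ᶠ t in 𝓝 ‖y‖, χ t = 0 :=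
        notMem_tsupport_iff_eventuallyEq.1 fun hh => hy (hsupp hh)
      refine (contDiffAt_const (c := (0 : ℝ))).congr_of_eventuallyEq ?_
      filter_upwards [continuous_norm.continuousAt.eventually h0] with z hz
      rw [hz, zero_mul]
  · simp only [norm_neg, PiLp.neg_apply]
    ring
  · filter_upwards [continuous_norm.continuousAt.eventually (hone ‖y‖ hy)] with z hz
    rw [hz, one_mul]

theorem gradient_degreeOne {F : ℝ → ℝ} {F' : ℝ} {φ : EuclideanSpace ℝ (Fin n) → ℝ} {j : Fin n}
    {y : EuclideanSpace ℝ (Fin n)} (hy : y ≠ 0) (hF : HasDerivAt F F' ‖y‖)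
    (hφ : φ =ᶠ[𝓝 y] fun z => F ‖z‖ / ‖z‖ * z j) :
    gradient φ y = (F ‖y‖ / ‖y‖) • EuclideanSpace.single j 1 +
      (y j * ((F' * ‖y‖ - F ‖y‖) / ‖y‖ ^ 3)) • y := by
  have hs := norm_ne_zero_iff.2 hy
  have h1 := (hasFDerivAt_comp_norm hy (hasDerivAt_div_self hF hs)).mul
    ((EuclideanSpace.proj j : EuclideanSpace ℝ (Fin n) →L[ℝ] ℝ).hasFDerivAt (x := y))
  refine HasGradientAt.gradient (hasGradientAt_iff_hasFDerivAt.2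
    ((h1.congr_of_eventuallyEq hφ).congr_fderiv ?_))
  ext v
  simp [EuclideanSpace.inner_single_left]
  field_simp

end DegreeOne

/-! ### The index form on functions F(s) wⱼ. -/

section Variation

variable {n : ℕ} {a b c : ℝ} {J : Set ℝ} {p p₁ p₂ r r₁ r₂ : ℝ → ℝ}
  {N : EuclideanSpace ℝ (Fin n) → EuclideanSpace ℝ (Fin (n + 1))} {θ : ℝ}

/-- The gradient of F(s) wⱼ splits orthogonally into F' wⱼ along the generating curve and F/r times
the tangential gradient of wⱼ, of squared length 1 - wⱼ². -/
theorem IsDelaunayProfile.integrand_degreeOne (hn : 2 ≤ n)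
    (h : IsDelaunayProfile n a b c J p p₁ p₂ r r₁ r₂)
    (hM : IsImmersedHypersurface n a b (revolve p r) N) {F : ℝ → ℝ} {F' : ℝ}
    {φ : EuclideanSpace ℝ (Fin n) → ℝ} {j : Fin n} {y : EuclideanSpace ℝ (Fin n)}
    (hy : y ∈ shell n a b) (hy0 : y ≠ 0) (hF : HasDerivAt F F' ‖y‖)
    (hφ : φ =ᶠ[𝓝 y] fun z => F ‖z‖ / ‖z‖ * z j) :
    (covectorNormSq (revolve p r) y (gradient φ y) - secondFundNormSq (revolve p r) N y * φ y ^ 2) *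
        areaDensity (revolve p r) y =
      ((F' ^ 2 - (profileCurvature n c p₁ r ‖y‖ ^ 2 + (n - 1) * (p₁ ‖y‖ / r ‖y‖) ^ 2) * F ‖y‖ ^ 2) *
          (r ‖y‖ / ‖y‖) ^ (n - 1)) * (y j / ‖y‖) ^ 2 +
      (F ‖y‖ ^ 2 / r ‖y‖ ^ 2 * (r ‖y‖ / ‖y‖) ^ (n - 1)) * (1 - (y j / ‖y‖) ^ 2) := by
  have hpos := norm_pos_iff.2 hy0
  have hJ := h.mem _ hy hpos
  have hr := h.radius_pos _ hy hpos
  have hs := hpos.ne'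
  rw [h.covectorNormSq_eq hJ (h.arc _ hy hpos) hr.ne', h.secondFundNormSq_eq_curvature hM hy hpos,
    h.areaDensity_eq (by omega) hJ (h.arc _ hy hpos) hr, gradient_degreeOne hy0 hF hφ, hφ.self_of_nhds]
  have e1 : inner ℝ (‖y‖⁻¹ • y) ((F ‖y‖ / ‖y‖) • EuclideanSpace.single j (1 : ℝ) +
      (y j * ((F' * ‖y‖ - F ‖y‖) / ‖y‖ ^ 3)) • y) = y j / ‖y‖ * F' := by
    simp only [inner_add_right, real_inner_smul_left, real_inner_smul_right,
      EuclideanSpace.inner_single_right, conj_trivial, one_mul, real_inner_self_eq_norm_sq,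
      PiLp.smul_apply, smul_eq_mul]
    field_simp
    ring
  have e2 : ‖(F ‖y‖ / ‖y‖) • EuclideanSpace.single j (1 : ℝ) +
      (y j * ((F' * ‖y‖ - F ‖y‖) / ‖y‖ ^ 3)) • y‖ ^ 2 =
      (F ‖y‖ / ‖y‖) ^ 2 * (1 - (y j / ‖y‖) ^ 2) + (y j / ‖y‖ * F') ^ 2 := by
    rw [norm_add_sq_real, norm_smul, norm_smul, real_inner_smul_left, real_inner_smul_right,
      EuclideanSpace.inner_single_left]
    simp only [mul_pow, Real.norm_eq_abs, sq_abs, PiLp.norm_single, abs_one, one_pow, map_one, one_mul]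
    field_simp
    ring
  rw [e1, e2]
  generalize (r ‖y‖ / ‖y‖) ^ (n - 1) = A
  have := hr.ne'
  field_simp
  ring

/-- The second variation on a function `F(s) wⱼ`, in polar coordinates `y = s w`. -/
theorem IsDelaunayProfile.secondVariation_degreeOne (hn : 2 ≤ n) (ha : 0 < a) (hab : a < b)
    (h : IsDelaunayProfile n a b c J p p₁ p₂ r r₁ r₂)
    (hM : IsCapillaryInBall n a b (revolve p r) N θ) {F F₁ : ℝ → ℝ}
    (hF : ∀ s ∈ Set.Icc a b, HasDerivAt F (F₁ s) s) (hF₁ : ContinuousOn F₁ (Set.Icc a b))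
    {φ : EuclideanSpace ℝ (Fin n) → ℝ} {j : Fin n}
    (hφ : ∀ y ∈ shell n a b, φ =ᶠ[𝓝 y] fun z => F ‖z‖ / ‖z‖ * z j) :
    secondVariation n a b (revolve p r) N θ φ (gradient φ) φ =
      (∫ w : Metric.sphere (0 : EuclideanSpace ℝ (Fin n)) 1,
          (w : EuclideanSpace ℝ (Fin n)) j ^ 2 ∂volume.toSphere) *
        ((∫ s in a..b, (F₁ s ^ 2 - (profileCurvature n c p₁ r s ^ 2 +
            (n - 1) * (p₁ s / r s) ^ 2) * F s ^ 2) * r s ^ (n - 1)) -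
          ((1 + profileCurvature n c p₁ r a * profileSupport p p₁ r r₁ a) / Real.sin θ *
              F a ^ 2 * r a ^ (n - 1) +
            (1 + profileCurvature n c p₁ r b * profileSupport p p₁ r r₁ b) / Real.sin θ *
              F b ^ 2 * r b ^ (n - 1))) +
      ((volume : Measure (EuclideanSpace ℝ (Fin n))).toSphere.real Set.univ -
        ∫ w : Metric.sphere (0 : EuclideanSpace ℝ (Fin n)) 1,
          (w : EuclideanSpace ℝ (Fin n)) j ^ 2 ∂volume.toSphere) *
        ∫ s in a..b, F s ^ 2 / r s ^ 2 * r s ^ (n - 1) := by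
  set W := ∫ w : Metric.sphere (0 : EuclideanSpace ℝ (Fin n)) 1,
          (w : EuclideanSpace ℝ (Fin n)) j ^ 2 ∂volume.toSphere with hW
  set τ := (volume : Measure (EuclideanSpace ℝ (Fin n))).toSphere.real Set.univ with hτ
  have hn0 : 0 < n := by omega
  have hs0 : ∀ s ∈ Set.Icc a b, 0 < s := fun s hs => ha.trans_le hs.1
  have hpos : ∀ y ∈ shell n a b, 0 < ‖y‖ := fun y hy => ha.trans_le hy.1
  have hy0 : ∀ y ∈ shell n a b, y ≠ 0 := fun y hy => norm_pos_iff.1 (hpos y hy)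
  have hWint : Integrable (fun w : Metric.sphere (0 : EuclideanSpace ℝ (Fin n)) 1 =>
      (w : EuclideanSpace ℝ (Fin n)) j ^ 2) volume.toSphere := by
    refine Continuous.integrable_of_hasCompactSupport (by fun_prop) ?_
    exact HasCompactSupport.of_compactSpace _
  have hnorm : ∀ s, 0 < s → ∀ w : Metric.sphere (0 : EuclideanSpace ℝ (Fin n)) 1,
      ‖s • (w : EuclideanSpace ℝ (Fin n))‖ = s := fun s hs w => by
    rw [norm_smul, norm_eq_of_mem_sphere, mul_one, Real.norm_eq_abs, abs_of_pos hs]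
  have hcoord : ∀ s, 0 < s → ∀ w : Metric.sphere (0 : EuclideanSpace ℝ (Fin n)) 1,
      (s • (w : EuclideanSpace ℝ (Fin n))) j / s = (w : EuclideanSpace ℝ (Fin n)) j :=
    fun s hs w => by
      rw [PiLp.smul_apply, smul_eq_mul]; field_simp
  set A : ℝ → ℝ := fun s => (F₁ s ^ 2 - (profileCurvature n c p₁ r s ^ 2 +
            (n - 1) * (p₁ s / r s) ^ 2) * F s ^ 2) with hA
  set B : ℝ → ℝ := fun s => F s ^ 2 / r s ^ 2 with hB
  have hFc : ContinuousOn F (Set.Icc a b) := fun s hs => (hF s hs).continuousAt.continuousWithinAt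
  have hrc : ContinuousOn r (Set.Icc a b) := fun s hs =>
    (h.hasDerivAt_r s (h.mem s hs (hs0 s hs))).continuousAt.continuousWithinAt
  have hpc : ContinuousOn p₁ (Set.Icc a b) := fun s hs =>
    (h.hasDerivAt_p₁ s (h.mem s hs (hs0 s hs))).continuousAt.continuousWithinAt
  have hr0 : ∀ s ∈ Set.Icc a b, r s ≠ 0 := fun s hs => (h.radius_pos s hs (hs0 s hs)).ne'
  have hκc : ContinuousOn (profileCurvature n c p₁ r) (Set.Icc a b) := fun s hs =>
    (h.hasDerivAt_curvature hs (hs0 s hs)).continuousAt.continuousWithinAt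
  have hAc : ContinuousOn A (Set.Icc a b) := (hF₁.pow 2).sub (((hκc.pow 2).add
    (continuousOn_const.mul ((hpc.div hrc hr0).pow 2))).mul (hFc.pow 2))
  have hBc : ContinuousOn B (Set.Icc a b) :=
    (hFc.pow 2).div (hrc.pow 2) fun s hs => pow_ne_zero 2 (hr0 s hs)
  have hq : ContinuousOn (fun s => (r s / s) ^ (n - 1)) (Set.Icc a b) :=
    (hrc.div continuousOn_id fun s hs => (hs0 s hs).ne').pow _
  have hmaps : Set.MapsTo (fun y : EuclideanSpace ℝ (Fin n) => ‖y‖) (shell n a b) (Set.Icc a b) :=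
    fun y hy => hy
  set E : EuclideanSpace ℝ (Fin n) → ℝ := fun y => A ‖y‖ * (r ‖y‖ / ‖y‖) ^ (n - 1) * (y j / ‖y‖) ^ 2 +
      B ‖y‖ * (r ‖y‖ / ‖y‖) ^ (n - 1) * (1 - (y j / ‖y‖) ^ 2) with hE
  have hEc : ContinuousOn E (shell n a b) := by
    have hcn : ContinuousOn (fun y : EuclideanSpace ℝ (Fin n) => ‖y‖) (shell n a b) :=
      continuous_norm.continuousOn
    have hd : ContinuousOn (fun y : EuclideanSpace ℝ (Fin n) => (y j / ‖y‖) ^ 2) (shell n a b) :=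
      ((by fun_prop : Continuous fun y : EuclideanSpace ℝ (Fin n) => y j).continuousOn.div hcn
        fun y hy => (hpos y hy).ne').pow 2
    exact (((hAc.mul hq).comp hcn hmaps).mul hd).add
      (((hBc.mul hq).comp hcn hmaps).mul (continuousOn_const.sub hd))
  have hint : ∫ y in shell n a b, (covectorNormSq (revolve p r) y (gradient φ y) -
      secondFundNormSq (revolve p r) N y * φ y ^ 2) * areaDensity (revolve p r) y =
      W * (∫ s in a..b, A s * r s ^ (n - 1)) + (τ - W) * ∫ s in a..b, B s * r s ^ (n - 1) := by
    rw [setIntegral_congr_fun (g := E) isClosed_shell.measurableSet fun y hy =>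
      h.integrand_degreeOne hn hM.toIsImmersedHypersurface hy (hy0 y hy) (hF _ hy) (hφ y hy),
      (integral_shell_eq hn0 ha.le hab.le (hEc.integrableOn_compact isCompact_shell)).2,
      ← intervalIntegral.integral_const_mul, ← intervalIntegral.integral_const_mul,
      ← intervalIntegral.integral_add]
    · refine intervalIntegral.integral_congr fun s hs => ?_
      rw [Set.uIcc_of_le hab.le] at hs
      have hsp := hs0 s hs
      have : ∀ w : Metric.sphere (0 : EuclideanSpace ℝ (Fin n)) 1,
          E (s • (w : EuclideanSpace ℝ (Fin n))) =
          (A s - B s) * (r s / s) ^ (n - 1) * (w : EuclideanSpace ℝ (Fin n)) j ^ 2 +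
            B s * (r s / s) ^ (n - 1) := fun w => by
        simp only [hE, hnorm s hsp, hcoord s hsp]
        ring
      simp only [this]
      rw [integral_add (hWint.const_mul _) (integrable_const _), integral_const_mul, integral_const,
        smul_eq_mul, ← hW, ← hτ, div_pow]
      have := pow_ne_zero (n - 1) hsp.ne'
      field_simp
      ring
    · exact (ContinuousOn.intervalIntegrable_of_Icc hab.le (hAc.mul (hrc.pow _))).const_mul _
    · exact (ContinuousOn.intervalIntegrable_of_Icc hab.le (hBc.mul (hrc.pow _))).const_mul _
  have hbd : ∀ t ∈ Set.Icc a b, (∀ y : EuclideanSpace ℝ (Fin n), ‖y‖ = t →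
      y ∈ frontier (shell n a b)) → Integrable (fun y => boundaryCoeff b (revolve p r) N θ y *
        φ y ^ 2 * boundaryDensity b (revolve p r) y) (sphereMeasure n t) ∧
      ∫ y, boundaryCoeff b (revolve p r) N θ y * φ y ^ 2 * boundaryDensity b (revolve p r) y
        ∂sphereMeasure n t = W * ((1 + profileCurvature n c p₁ r t * profileSupport p p₁ r r₁ t) /
          Real.sin θ * F t ^ 2 * r t ^ (n - 1)) := by
    intro t ht hfr
    have htp := hs0 t ht
    have hval : ∀ w : Metric.sphere (0 : EuclideanSpace ℝ (Fin n)) 1,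
        boundaryCoeff b (revolve p r) N θ (t • (w : EuclideanSpace ℝ (Fin n))) *
          φ (t • (w : EuclideanSpace ℝ (Fin n))) ^ 2 *
          boundaryDensity b (revolve p r) (t • (w : EuclideanSpace ℝ (Fin n))) =
        ((1 + profileCurvature n c p₁ r t * profileSupport p p₁ r r₁ t) / Real.sin θ * F t ^ 2 *
          (r t / t) ^ (n - 1)) * (w : EuclideanSpace ℝ (Fin n)) j ^ 2 := fun w => by
      have hnt := hnorm t htp w
      have hsh : t • (w : EuclideanSpace ℝ (Fin n)) ∈ shell n a b :=
        ⟨by rw [hnt]; exact ht.1, by rw [hnt]; exact ht.2⟩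
      have hφt : φ (t • (w : EuclideanSpace ℝ (Fin n))) = F t * (w : EuclideanSpace ℝ (Fin n)) j := by
        rw [(hφ _ hsh).self_of_nhds]
        simp only [hnt]
        rw [div_mul_eq_mul_div, mul_div_assoc, hcoord t htp]
      rw [(h.boundaryCoeff_eq hM (hfr _ hnt) (hy0 _ hsh)).1,
        h.boundaryDensity_eq hn0 (h.mem _ hsh (hpos _ hsh)) (h.arc _ hsh (hpos _ hsh))
          (h.radius_pos _ hsh (hpos _ hsh)), hφt, hnt]
      ring
    constructor
    · rw [sphereMeasure]
      refine Integrable.smul_measure ?_ ENNReal.ofReal_ne_top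
      rw [(measurableEmbedding_smul_sphere htp.ne').integrable_map_iff]
      exact (hWint.const_mul _).congr (Eventually.of_forall fun w => (hval w).symm)
    · rw [integral_sphereMeasure hn htp.le]
      simp only [hval]
      rw [integral_const_mul, ← hW, div_pow]
      have := pow_ne_zero (n - 1) htp.ne'
      field_simp
  obtain ⟨ia, va⟩ := hbd a ⟨le_rfl, hab.le⟩ fun y hy => mem_frontier_shell_left hab.le ha hy
  obtain ⟨ib, vb⟩ := hbd b ⟨hab.le, le_rfl⟩
    fun y hy => mem_frontier_shell_right hab.le (ha.trans hab) hy
  rw [secondVariation, hint, shellBoundaryMeasure, integral_add_measure ia ib, va, vb]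
  ring

end Variation

end

noncomputable section

/-! ### Instability off the axis. -/

section Unstable

variable {n : ℕ} {a b : ℝ}

theorem toSphere_real_univ_pos (hn : 0 < n) :
    0 < (volume : Measure (EuclideanSpace ℝ (Fin n))).toSphere.real Set.univ := by
  have : NeZero n := ⟨hn.ne'⟩
  refine ENNReal.toReal_pos ?_ (measure_ne_top _ _)
  rw [Measure.toSphere_apply_univ, finrank_euclideanSpace_fin]
  exact mul_ne_zero (by exact_mod_cast hn.ne')
    (Metric.measure_ball_pos volume (0 : EuclideanSpace ℝ (Fin n)) one_pos).ne'

/-- Summing over all coordinates makes it unnecessary to evaluate the individual second moments ∫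
wⱼ². -/
theorem sum_integral_sphere_coord_sq :
    ∑ j : Fin n, ∫ w : Metric.sphere (0 : EuclideanSpace ℝ (Fin n)) 1,
      (w : EuclideanSpace ℝ (Fin n)) j ^ 2 ∂volume.toSphere =
    (volume : Measure (EuclideanSpace ℝ (Fin n))).toSphere.real Set.univ := by
  rw [← integral_finsetSum]
  · have : ∀ w : Metric.sphere (0 : EuclideanSpace ℝ (Fin n)) 1,
        ∑ j : Fin n, (w : EuclideanSpace ℝ (Fin n)) j ^ 2 = 1 := fun w => by
      rw [← EuclideanSpace.real_norm_sq_eq, norm_eq_of_mem_sphere, one_pow]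
    simp [this]
  · intro j _
    refine Continuous.integrable_of_hasCompactSupport (by fun_prop) ?_
    exact HasCompactSupport.of_compactSpace _

theorem integral_shell_eq_zero_of_odd {f : EuclideanSpace ℝ (Fin n) → ℝ}
    (hf : ∀ y ∈ shell n a b, f (-y) = -f y) : ∫ y in shell n a b, f y = 0 := by
  have h1 := integral_neg_eq_self ((shell n a b).indicator f) volume
  have h2 : ∀ y, (shell n a b).indicator f (-y) = -(shell n a b).indicator f y := fun y => by
    by_cases hy : y ∈ shell n a b
    · have hy' : -y ∈ shell n a b := by simpa [shell] using hy
      rw [Set.indicator_of_mem hy, Set.indicator_of_mem hy', hf y hy]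
    · have hy' : -y ∉ shell n a b := by simpa [shell] using hy
      rw [Set.indicator_of_notMem hy, Set.indicator_of_notMem hy', neg_zero]
  simp only [h2] at h1
  rw [integral_neg, integral_indicator isClosed_shell.measurableSet] at h1
  linarith

/-- The functions √(u² + η²) wⱼ have mean zero by oddness. If all their second variations were
nonnegative, so would be the sum, but the sum is τ times the radial index form, which
`exists_jacobi_perturbation_neg` makes negative. -/
theorem IsDelaunayCapillary.not_isStable (hn : 2 ≤ n) (ha : 0 < a) (hab : a < b) {p r : ℝ → ℝ}
    {N : EuclideanSpace ℝ (Fin n) → EuclideanSpace ℝ (Fin (n + 1))} {θ : ℝ}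
    (hM : IsDelaunayCapillary n a b p r N θ) : ¬ IsStable n a b (revolve p r) N θ := by
  intro hst
  have hn0 : 0 < n := by omega
  obtain ⟨J, c, h, hp, hr⟩ := hM.exists_isDelaunayProfile hn ha.le hab
  have hcap := hM.capillary
  have hsin := Real.sin_pos_of_pos_of_lt_pi hcap.angle_pos hcap.angle_lt_pi
  have hs0 : ∀ s ∈ Set.Icc a b, 0 < s := fun s hs => ha.trans_le hs.1
  have hJ : ∀ s ∈ Set.Icc a b, s ∈ J := fun s hs => h.mem s hs (hs0 s hs)
  set u := profileTangential p (deriv p) r (deriv r) with hu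
  set v : ℝ → ℝ := fun s => 1 + profileCurvature n c (deriv p) r s *
    profileSupport p (deriv p) r (deriv r) s with hv
  set S : ℝ → ℝ := fun s => (n - 1) / r s ^ 2 - (profileCurvature n c (deriv p) r s ^ 2 +
    (n - 1) * (deriv p s / r s) ^ 2) with hS
  have hrc : ContinuousOn r (Set.Icc a b) := fun s hs =>
    (h.hasDerivAt_r s (hJ s hs)).continuousAt.continuousWithinAt
  have hpc : ContinuousOn (deriv p) (Set.Icc a b) := fun s hs =>
    (h.hasDerivAt_p₁ s (hJ s hs)).continuousAt.continuousWithinAt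
  have hr0 : ∀ s ∈ Set.Icc a b, r s ≠ 0 := fun s hs => (h.radius_pos s hs (hs0 s hs)).ne'
  have hκc : ContinuousOn (profileCurvature n c (deriv p) r) (Set.Icc a b) := fun s hs =>
    (h.hasDerivAt_curvature hs (hs0 s hs)).continuousAt.continuousWithinAt
  have hβc : ContinuousOn (profileSupport p (deriv p) r (deriv r)) (Set.Icc a b) := fun s hs =>
    (h.hasDerivAt_support hs (hs0 s hs)).continuousAt.continuousWithinAt
  have huc : ContinuousOn u (Set.Icc a b) := fun s hs =>
    (h.hasDerivAt_tangential hs (hs0 s hs)).continuousAt.continuousWithinAt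
  have hvc : ContinuousOn v (Set.Icc a b) := continuousOn_const.add (hκc.mul hβc)
  have hSc : ContinuousOn S (Set.Icc a b) :=
    (continuousOn_const.div (hrc.pow 2) fun s hs => pow_ne_zero 2 (hr0 s hs)).sub
      ((hκc.pow 2).add (continuousOn_const.mul ((hpc.div hrc hr0).pow 2)))
  obtain ⟨η, hη, hneg⟩ := exists_jacobi_perturbation_neg (ρ := fun s => r s ^ (n - 1)) (S := S)
    (v := v) hab hsin
    (fun s hs => h.hasDerivAt_tangential hs (hs0 s hs))
    (fun s hs => h.hasDerivAt_jacobi hn hs (hs0 s hs)) hvc hSc (hrc.pow _)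
    (fun s hs => pow_pos (h.radius_pos s hs (hs0 s hs)) _) (h.tangential_left hn0 ha hab hcap)
    (h.tangential_right hn0 ha.le hab hcap)
  set F : ℝ → ℝ := fun s => √(u s ^ 2 + η ^ 2) with hF
  have hden : ∀ s, 0 < u s ^ 2 + η ^ 2 := fun s => by positivity
  have hFsq : ∀ s, F s ^ 2 = u s ^ 2 + η ^ 2 := fun s => Real.sq_sqrt (hden s).le
  have hFpos : ∀ s, 0 < F s := fun s => Real.sqrt_pos.2 (hden s)
  have hFd : ∀ s ∈ Set.Icc a b, HasDerivAt F (u s * v s / F s) s := fun s hs => by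
    refine ((((h.hasDerivAt_tangential hs (hs0 s hs)).pow 2).add_const (η ^ 2)).sqrt
      (hden s).ne').congr_deriv ?_
    have := (hFpos s).ne'
    simp only [hF, hv, ← hu] at this ⊢
    push_cast
    simp only [Pi.pow_apply]
    field_simp
  have hFc : ContinuousOn F (Set.Icc a b) := fun s hs => (hFd s hs).continuousAt.continuousWithinAt
  have hF₁ : ContinuousOn (fun s => u s * v s / F s) (Set.Icc a b) :=
    (huc.mul hvc).div hFc fun s _ => (hFpos s).ne'
  have hFsm : ContDiffOn ℝ ∞ F J := by
    have hdp := ((contDiffOn_infty_iff_deriv_of_isOpen h.isOpen).1 hp).2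
    have hdr := ((contDiffOn_infty_iff_deriv_of_isOpen h.isOpen).1 hr).2
    exact ((((hp.mul hdp).add (hr.mul hdr)).pow 2).add contDiffOn_const).sqrt
      fun s _ => (hden s).ne'
  choose φ hφsm hφodd hφ using fun j : Fin n =>
    exists_contDiff_degreeOne (n := n) h.isOpen h.pos hab.le hJ hFsm j
  have hQ : ∀ j, 0 ≤ secondVariation n a b (revolve p r) N θ (φ j) (gradient (φ j)) (φ j) := by
    intro j
    refine hst _ _ _ (isSobolevTriple_of_contDiff ha.le hab.le (hφsm j)) ?_
    refine integral_shell_eq_zero_of_odd fun y hy => ?_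
    have hy' : -y ∈ shell n a b := by simpa [shell] using hy
    have hpos : 0 < ‖y‖ := ha.trans_le hy.1
    have hpos' : 0 < ‖-y‖ := by rwa [norm_neg]
    rw [h.areaDensity_eq hn0 (h.mem _ hy hpos) (h.arc _ hy hpos) (h.radius_pos _ hy hpos),
      h.areaDensity_eq hn0 (h.mem _ hy' hpos') (h.arc _ hy' hpos') (h.radius_pos _ hy' hpos'),
      norm_neg, hφodd]
    ring
  have hsum := Finset.sum_nonneg fun j (_ : j ∈ Finset.univ) => hQ j
  simp only [fun j => h.secondVariation_degreeOne hn ha hab hcap hFd hF₁ (hφ j)] at hsum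
  -- The weights ∫ wⱼ² add up to τ and the weights τ - ∫ wⱼ² to (n-1)τ, so the angular energy enters
  -- with the first spherical eigenvalue n - 1.
  rw [Finset.sum_add_distrib, ← Finset.sum_mul, ← Finset.sum_mul, Finset.sum_sub_distrib,
    sum_integral_sphere_coord_sq, Finset.sum_const, Finset.card_univ, Fintype.card_fin,
    nsmul_eq_mul] at hsum
  set τ := (volume : Measure (EuclideanSpace ℝ (Fin n))).toSphere.real Set.univ with hτ
  have hτpos : 0 < τ := toSphere_real_univ_pos hn0
  have hI : ∀ {f : ℝ → ℝ}, ContinuousOn f (Set.Icc a b) → IntervalIntegrable f volume a b :=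
    fun hf => ContinuousOn.intervalIntegrable_of_Icc hab.le hf
  set A : ℝ → ℝ := fun s => ((u s * v s / F s) ^ 2 - (profileCurvature n c (deriv p) r s ^ 2 +
            (n - 1) * (deriv p s / r s) ^ 2) * F s ^ 2) * r s ^ (n - 1) with hA
  set B : ℝ → ℝ := fun s => F s ^ 2 / r s ^ 2 * r s ^ (n - 1) with hB
  have hAc : ContinuousOn A (Set.Icc a b) := ((hF₁.pow 2).sub (((hκc.pow 2).add
    (continuousOn_const.mul ((hpc.div hrc hr0).pow 2))).mul (hFc.pow 2))).mul (hrc.pow _)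
  have hBc : ContinuousOn B (Set.Icc a b) :=
    ((hFc.pow 2).div (hrc.pow 2) fun s hs => pow_ne_zero 2 (hr0 s hs)).mul (hrc.pow _)
  have hAB : (∫ s in a..b, A s) + (n - 1) * ∫ s in a..b, B s = ∫ s in a..b,
      ((u s * v s) ^ 2 / (u s ^ 2 + η ^ 2) + S s * (u s ^ 2 + η ^ 2)) * r s ^ (n - 1) := by
    rw [← intervalIntegral.integral_const_mul,
      ← intervalIntegral.integral_add (hI hAc) ((hI hBc).const_mul _)]
    refine intervalIntegral.integral_congr fun s _ => ?_
    simp only [hA, hB, hS, div_pow (u s * v s), hFsq]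
    ring
  rw [← hAB] at hneg
  have hua : u a ^ 2 = Real.sin θ ^ 2 := by
    rw [hu, h.tangential_left hn0 ha hab hcap, neg_sq]
  have hub : u b ^ 2 = Real.sin θ ^ 2 := by
    rw [hu, h.tangential_right hn0 ha.le hab hcap]
  rw [hFsq a, hFsq b, hua, hub] at hsum
  have hfin := mul_lt_mul_of_pos_left hneg hτpos
  simp only [hv] at hfin
  nlinarith

end Unstable

end

noncomputable section

/-! ### Hypersurfaces of revolution that do not meet the axis -/

section OffAxis

variable {n : ℕ} {a b : ℝ} {p r : ℝ → ℝ}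

theorem revolve_ne_smul_axisVector {y : EuclideanSpace ℝ (Fin n)} (hy : y ≠ 0) (hr : r ‖y‖ ≠ 0)
    (k : ℝ) : revolve p r y ≠ k • axisVector n := by
  intro h
  have h1 := norm_revolve_sq (p := p) (r := r) hy
  have h2 : p ‖y‖ = k := by
    have := congrArg (fun z : EuclideanSpace ℝ (Fin (n + 1)) => z 0) h
    simpa [revolve_eq] using this
  rw [h, norm_smul, norm_axisVector, mul_one, Real.norm_eq_abs, sq_abs, h2] at h1
  exact hr (pow_eq_zero_iff two_ne_zero |>.1 (by linarith))

/-- The midpoint of x(y) and x(-y) lies on the axis and, by convexity, in the disk, whereas x avoids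
the axis. -/
theorem not_isTotallyGeodesicDisk (hn : 0 < n) (ha : 0 < a) (hab : a < b)
    (hr : ∀ s ∈ Set.Icc a b, 0 < s → 0 < r s) : ¬ IsTotallyGeodesicDisk n a b (revolve p r) := by
  rintro ⟨v, c, -, h⟩
  obtain ⟨y, hy⟩ := exists_euclidean_norm_eq hn ha.le
  have hysh : y ∈ shell n a b := ⟨hy.ge, hy.le.trans hab.le⟩
  have hysh' : -y ∈ shell n a b := by simpa [shell] using hysh
  have h1 : revolve p r y ∈ {z | inner ℝ v z = c} ∩ Metric.closedBall 0 1 :=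
    h ▸ Set.mem_image_of_mem _ hysh
  have h2 : revolve p r (-y) ∈ {z | inner ℝ v z = c} ∩ Metric.closedBall 0 1 :=
    h ▸ Set.mem_image_of_mem _ hysh'
  have hmid : p ‖y‖ • axisVector n =
      (1 / 2 : ℝ) • revolve p r y + (1 / 2 : ℝ) • revolve p r (-y) := by
    rw [revolve_eq, revolve_eq, norm_neg, map_neg]
    module
  have h3 : p ‖y‖ • axisVector n ∈ {z | inner ℝ v z = c} ∩ Metric.closedBall 0 1 := by
    rw [hmid]
    refine ⟨?_, (convex_closedBall 0 1) h1.2 h2.2 (by norm_num) (by norm_num) (by norm_num)⟩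
    have e1 : inner ℝ v (revolve p r y) = c := h1.1
    have e2 : inner ℝ v (revolve p r (-y)) = c := h2.1
    simp only [Set.mem_ofPred_eq, inner_add_right, real_inner_smul_right, e1, e2]
    ring
  rw [← h] at h3
  obtain ⟨z, hz, hz2⟩ := h3
  have hz0 : 0 < ‖z‖ := ha.trans_le hz.1
  exact revolve_ne_smul_axisVector (norm_pos_iff.1 hz0) (hr _ hz hz0).ne' _ hz2

/-- Equidistance of z₀ from x(y) and x(-y) puts the centre on the axis. The pole of the sphere
nearest to the origin is then no farther from it than any point of M, hence in the ball and in the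
cap, whereas x avoids the axis. -/
theorem not_isSphericalCap (hn : 0 < n) (ha : 0 < a) (hab : a < b)
    (hr : ∀ s ∈ Set.Icc a b, 0 < s → 0 < r s) : ¬ IsSphericalCap n a b (revolve p r) := by
  rintro ⟨z₀, R, hR, h⟩
  have hmem : ∀ y ∈ shell n a b, ‖revolve p r y - z₀‖ ^ 2 = R ^ 2 ∧ ‖revolve p r y‖ ≤ 1 := by
    intro y hy
    have : revolve p r y ∈ Metric.sphere z₀ R ∩ Metric.closedBall 0 1 :=
      h ▸ Set.mem_image_of_mem _ hy
    exact ⟨by rw [mem_sphere_iff_norm.1 this.1], by simpa using this.2⟩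
  have hcoord : ∀ j : Fin n, z₀ j.succ = 0 := by
    intro j
    set y : EuclideanSpace ℝ (Fin n) := EuclideanSpace.single j a with hy
    have hya : ‖y‖ = a := by simp [hy, abs_of_pos ha]
    have hy0 : y ≠ 0 := norm_pos_iff.1 (hya ▸ ha)
    have hysh : y ∈ shell n a b := ⟨hya.ge, hya.le.trans hab.le⟩
    have hysh' : -y ∈ shell n a b := by simpa [shell] using hysh
    have h1 := (hmem y hysh).1
    have h2 := (hmem (-y) hysh').1
    rw [norm_sub_sq_real, norm_revolve_sq hy0] at h1
    rw [norm_sub_sq_real, norm_revolve_sq (neg_ne_zero.2 hy0), norm_neg] at h2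
    have hin : inner ℝ (hyperplaneInclusion n y) z₀ = a * z₀ j.succ := by
      simp [PiLp.inner_apply, Fin.sum_univ_succ, hy, PiLp.single_apply, mul_comm]
    rw [revolve_eq, inner_add_left, real_inner_smul_left, real_inner_smul_left, hin] at h1
    rw [revolve_eq, inner_add_left, real_inner_smul_left, real_inner_smul_left, map_neg,
      inner_neg_left, hin, norm_neg] at h2
    have h3 : r ‖y‖ / ‖y‖ * (a * z₀ j.succ) = 0 := by linarith
    have h4 := (hr _ hysh (hya ▸ ha)).ne'
    rw [hya] at h3 h4
    have := ha.ne'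
    field_simp at h3
    exact (mul_eq_zero.1 h3).resolve_left h4
  set t := z₀ 0 with ht
  have hz₀ : z₀ = t • axisVector n := by
    ext i
    refine Fin.cases ?_ (fun j => ?_) i
    · simp [ht]
    · simp [hcoord j]
  obtain ⟨y, hy⟩ := exists_euclidean_norm_eq hn ha.le
  have hy0 : y ≠ 0 := norm_pos_iff.1 (hy ▸ ha)
  have hysh : y ∈ shell n a b := ⟨hy.ge, hy.le.trans hab.le⟩
  obtain ⟨h1, h2⟩ := hmem y hysh
  have h3 : ‖revolve p r y‖ ^ 2 ≤ 1 := by nlinarith [norm_nonneg (revolve p r y)]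
  have hv0 : (revolve p r y) 0 = p ‖y‖ := by simp [revolve_eq]
  rw [norm_sub_sq_real, hz₀, real_inner_smul_right, inner_axisVector_right, hv0, norm_smul,
    norm_axisVector, mul_one, Real.norm_eq_abs, sq_abs] at h1
  rw [norm_revolve_sq hy0] at h1 h3
  -- The pole on the side of the origin: t - R for t ≥ 0 and t + R for t ≤ 0.
  obtain ⟨k, hk1, hk2⟩ : ∃ k : ℝ, (k - t) ^ 2 = R ^ 2 ∧ k ^ 2 ≤ 1 := by
    have h5 : (p ‖y‖ - t) ^ 2 ≤ R ^ 2 := by nlinarith [sq_nonneg (r ‖y‖)]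
    have h6 := abs_le.1 (abs_le_of_sq_le_sq h5 hR.le)
    rcases le_total 0 t with h4 | h4
    · exact ⟨t - R, by ring, by nlinarith [mul_nonneg h4 (by linarith : 0 ≤ p ‖y‖ - t + R)]⟩
    · exact ⟨t + R, by ring,
        by nlinarith [mul_nonneg (neg_nonneg.2 h4) (by linarith : 0 ≤ R - (p ‖y‖ - t))]⟩
  have hpole : k • axisVector n ∈ Metric.sphere z₀ R ∩ Metric.closedBall 0 1 := by
    constructor
    · rw [mem_sphere_iff_norm, hz₀, ← sub_smul, norm_smul, norm_axisVector, mul_one,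
        Real.norm_eq_abs]
      rwa [← sq_eq_sq₀ (abs_nonneg _) hR.le, sq_abs]
    · rw [mem_closedBall_zero_iff, norm_smul, norm_axisVector, mul_one, Real.norm_eq_abs]
      exact abs_le_one_iff_mul_self_le_one.2 (by nlinarith)
  rw [← h] at hpole
  obtain ⟨z, hz, hz2⟩ := hpole
  have hzpos : 0 < ‖z‖ := ha.trans_le hz.1
  exact revolve_ne_smul_axisVector (norm_pos_iff.1 hzpos) (hr _ hz hzpos).ne' _ hz2

end OffAxis

/-! ### Hypersurfaces of revolution that meet the axis -/

section OnAxis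

variable {n : ℕ} {b c : ℝ} {J : Set ℝ} {p p₁ p₂ r r₁ r₂ : ℝ → ℝ}

theorem eq_of_hasDerivAt_zero_of_tendsto {f : ℝ → ℝ} {l : ℝ}
    (hf : ∀ s ∈ Set.Ioc 0 b, HasDerivAt f 0 s) (hl : Tendsto f (𝓝[>] 0) (𝓝 l)) :
    ∀ s ∈ Set.Ioc 0 b, f s = l := by
  intro s hs
  have hconst : ∀ t ∈ Set.Ioc 0 s, f t = f s := by
    intro t ht
    have := constant_of_has_deriv_right_zero (f := f) (a := t) (b := s)
      (fun x hx => (hf x ⟨ht.1.trans_le hx.1, hx.2.trans hs.2⟩).continuousAt.continuousWithinAt)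
      (fun x hx => (hf x ⟨ht.1.trans_le hx.1, hx.2.le.trans hs.2⟩).hasDerivWithinAt)
    exact (this s ⟨ht.2, le_rfl⟩).symm
  refine tendsto_nhds_unique (tendsto_const_nhds.congr' ?_) hl
  filter_upwards [Ioc_mem_nhdsGT hs.1] with t ht using (hconst t ht).symm

/-- Continuity of the immersion at the pole. The value r 0 itself is invisible to `revolve`, so only
the limit of r is meaningful. -/
theorem IsImmersedHypersurface.tendsto_profile (hn : 0 < n) (hb : 0 < b)
    {N : EuclideanSpace ℝ (Fin n) → EuclideanSpace ℝ (Fin (n + 1))}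
    (hM : IsImmersedHypersurface n 0 b (revolve p r) N) :
    Tendsto p (𝓝[>] 0) (𝓝 (p 0)) ∧ Tendsto r (𝓝[>] 0) (𝓝 0) := by
  obtain ⟨U, hU, hsU, hx⟩ := hM.smooth
  have h0 : (0 : EuclideanSpace ℝ (Fin n)) ∈ U := hsU (by simp [shell, hb.le])
  have hc : ContinuousAt (revolve (n := n) p r) 0 := hx.continuousOn.continuousAt (hU.mem_nhds h0)
  set w : EuclideanSpace ℝ (Fin n) := EuclideanSpace.single ⟨0, hn⟩ 1 with hw
  have hwn : ‖w‖ = 1 := by simp [hw]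
  have hline : Tendsto (fun s : ℝ => s • w) (𝓝[>] 0) (𝓝 0) := by
    have : Continuous fun s : ℝ => s • w := by fun_prop
    have h := this.tendsto 0
    rw [zero_smul] at h
    exact h.mono_left nhdsWithin_le_nhds
  have hlim := hc.tendsto.comp hline
  have hzero : revolve p r (0 : EuclideanSpace ℝ (Fin n)) = p 0 • axisVector n := by
    simp [revolve_eq]
  rw [hzero] at hlim
  have hnorm : ∀ s : ℝ, 0 < s → ‖s • w‖ = s := fun s hs => by
    rw [norm_smul, hwn, mul_one, Real.norm_eq_abs, abs_of_pos hs]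
  constructor
  · have h1 := (tendsto_const_nhds (x := axisVector n)).inner (𝕜 := ℝ) hlim
    rw [real_inner_smul_right, real_inner_self_eq_norm_sq, norm_axisVector, one_pow, mul_one] at h1
    refine h1.congr' ?_
    filter_upwards [self_mem_nhdsWithin] with s hs
    simp only [Function.comp_apply, revolve_eq, hnorm s hs, inner_axisVector, PiLp.add_apply,
      PiLp.smul_apply, axisVector_zero_apply, hyperplaneInclusion_zero_apply, smul_eq_mul]
    ring
  · have h1 := (tendsto_const_nhds (x := hyperplaneInclusion n w)).inner (𝕜 := ℝ) hlim
    rw [real_inner_smul_right, inner_axisVector_right, hyperplaneInclusion_zero_apply,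
      mul_zero] at h1
    refine h1.congr' ?_
    filter_upwards [self_mem_nhdsWithin] with s hs
    have hs0 : s ≠ 0 := ne_of_gt hs
    simp only [Function.comp_apply, revolve_eq, hnorm s hs, map_smul, inner_add_right,
      real_inner_smul_right, inner_axisVector_right, hyperplaneInclusion_zero_apply,
      real_inner_self_eq_norm_sq, norm_hyperplaneInclusion, hwn]
    field_simp
    ring

/-- `sin (h s) / h`, the radius at distance `s` from the pole of a sphere of curvature `h`. -/
def capRadius (h s : ℝ) : ℝ := if h = 0 then s else Real.sin (h * s) / h

/-- The primitive `(1 - cos (h s)) / h²` of `capRadius`. -/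
def capPrimitive (h s : ℝ) : ℝ := if h = 0 then s ^ 2 / 2 else (1 - Real.cos (h * s)) / h ^ 2

theorem hasDerivAt_capRadius (h s : ℝ) : HasDerivAt (capRadius h) (Real.cos (h * s)) s := by
  by_cases h0 : h = 0
  · have : capRadius h = id := by ext; simp [capRadius, h0]
    rw [this, h0, zero_mul, Real.cos_zero]
    exact hasDerivAt_id s
  · have : capRadius h = fun s => Real.sin (h * s) / h := by ext; simp [capRadius, h0]
    rw [this]
    refine ((((hasDerivAt_id s).const_mul h).sin).div_const h).congr_deriv ?_
    simp only [id_eq, mul_one]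
    field_simp

theorem hasDerivAt_capPrimitive (h s : ℝ) : HasDerivAt (capPrimitive h) (capRadius h s) s := by
  by_cases h0 : h = 0
  · have : capPrimitive h = fun s => s ^ 2 / 2 := by ext; simp [capPrimitive, h0]
    rw [this, capRadius, if_pos h0]
    refine (((hasDerivAt_id s).pow 2).div_const 2).congr_deriv ?_
    simp
  · have : capPrimitive h = fun s => (1 - Real.cos (h * s)) / h ^ 2 := by
      ext; simp [capPrimitive, h0]
    rw [this, capRadius, if_neg h0]
    refine (((((hasDerivAt_id s).const_mul h).cos).const_sub 1).div_const (h ^ 2)).congr_deriv ?_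
    simp only [id_eq, mul_one]
    field_simp

theorem cos_eq_capPrimitive (h s : ℝ) : Real.cos (h * s) = 1 - h ^ 2 * capPrimitive h s := by
  by_cases h0 : h = 0
  · simp [h0]
  · rw [capPrimitive, if_neg h0]
    field_simp
    ring

/-- The generating curve of a hypersurface of revolution of constant mean curvature that meets the
axis is a line segment orthogonal to the axis or an arc of a circle centred on the axis. -/
theorem IsDelaunayProfile.eq_cap (hn : 2 ≤ n) (hb : 0 < b)
    (h : IsDelaunayProfile n 0 b c J p p₁ p₂ r r₁ r₂)
    (hp0 : Tendsto p (𝓝[>] 0) (𝓝 (p 0))) (hr0 : Tendsto r (𝓝[>] 0) (𝓝 0)) :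
    ∃ (h : ℝ) (R ρ : ℝ → ℝ), c = n * h ∧ IsCapProfile (h ^ 2) b R ρ ∧ ∀ s ∈ Set.Ioc 0 b,
      r s = R s ∧ p s = p 0 + h * ρ s ∧ p₁ s = h * R s ∧ r₁ s = 1 - h ^ 2 * ρ s := by
  have hnR : (n : ℝ) ≠ 0 := by exact_mod_cast (by omega : n ≠ 0)
  have hIcc : ∀ s ∈ Set.Ioc 0 b, s ∈ Set.Icc 0 b := fun s hs => ⟨hs.1.le, hs.2⟩
  have hJ : ∀ s ∈ Set.Ioc 0 b, s ∈ J := fun s hs => h.mem s (hIcc s hs) hs.1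
  have hpos : ∀ s ∈ Set.Ioc 0 b, 0 < r s := fun s hs => h.radius_pos s (hIcc s hs) hs.1
  have harc : ∀ s ∈ Set.Ioc 0 b, p₁ s ^ 2 + r₁ s ^ 2 = 1 := fun s hs => h.arc s (hIcc s hs) hs.1
  have hnear : ∀ᶠ s in 𝓝[>] (0 : ℝ), s ∈ Set.Ioc 0 b := Ioc_mem_nhdsGT hb
  set k := c / n with hk
  have hp₁ : ∀ s ∈ Set.Ioc 0 b, p₁ s = k * r s := by
    -- The force of the generating curve, a first integral of the constant mean curvature equation.
    -- It tends to 0 at the pole, since r → 0 while |p'| ≤ 1.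
    have hconst : ∀ s ∈ Set.Ioc 0 b, r s ^ (n - 1) * p₁ s - k * r s ^ n = 0 := by
      refine eq_of_hasDerivAt_zero_of_tendsto (fun s hs => ?_) ?_
      · obtain ⟨m, rfl⟩ : ∃ m, n = m + 2 := ⟨n - 2, by omega⟩
        have e1 : m + 2 - 1 = m + 1 := by omega
        rw [e1]
        refine ((((h.hasDerivAt_r s (hJ s hs)).pow (m + 1)).mul (h.hasDerivAt_p₁ s (hJ s hs))).sub
          (((h.hasDerivAt_r s (hJ s hs)).pow (m + 2)).const_mul k)).congr_deriv ?_
        have e2 : m + 1 - 1 = m := by omega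
        simp only [Pi.pow_apply]
        rw [h.p₂_eq s (hIcc s hs) hs.1, e1, e2, hk]
        have := (hpos s hs).ne'
        push_cast at hnR ⊢
        field_simp
        ring
      · have h1 : Tendsto (fun s => r s ^ (n - 1) * p₁ s) (𝓝[>] 0) (𝓝 0) := by
          have hz : Tendsto (fun s => r s ^ (n - 1)) (𝓝[>] 0) (𝓝 0) := by
            simpa [zero_pow (by omega : n - 1 ≠ 0)] using hr0.pow (n - 1)
          have hz' := hz.norm
          rw [norm_zero] at hz'
          refine squeeze_zero_norm' ?_ hz'
          filter_upwards [hnear] with s hs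
          rw [norm_mul]
          refine mul_le_of_le_one_right (norm_nonneg _) ?_
          rw [Real.norm_eq_abs]
          exact abs_le_one_iff_mul_self_le_one.2 (by nlinarith [harc s hs, sq_nonneg (r₁ s)])
        have h2 : Tendsto (fun s => k * r s ^ n) (𝓝[>] 0) (𝓝 0) := by
          simpa [zero_pow (by omega : n ≠ 0)] using (hr0.pow n).const_mul k
        simpa using h1.sub h2
    intro s hs
    have h1 := hconst s hs
    have h2 : r s ^ (n - 1) * (p₁ s - k * r s) = 0 := by
      rw [← h1]
      conv_rhs => rw [show n = n - 1 + 1 by omega, pow_succ]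
      simp only [Nat.add_sub_cancel]
      ring
    linarith [(mul_eq_zero.1 h2).resolve_left (pow_pos (hpos s hs) _).ne']
  have hc : c = n * k := by rw [hk]; field_simp
  have hr₂ : ∀ s ∈ Set.Ioc 0 b, r₂ s = -(k ^ 2 * r s) := by
    intro s hs
    rw [h.r₂_eq s (hIcc s hs) hs.1, hp₁ s hs, hc, mul_div_assoc, div_self (hpos s hs).ne']
    ring
  have hr₁b : ∀ s ∈ Set.Ioc 0 b, |r₁ s| ≤ 1 := fun s hs =>
    abs_le_one_iff_mul_self_le_one.2 (by nlinarith [harc s hs, sq_nonneg (p₁ s)])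
  have hsin : ∀ s, HasDerivAt (fun s => Real.sin (k * s)) (k * Real.cos (k * s)) s := fun s =>
    (((hasDerivAt_id s).const_mul k).sin).congr_deriv (by simp [mul_comm])
  have hcos : ∀ s, HasDerivAt (fun s => Real.cos (k * s)) (-(k * Real.sin (k * s))) s := fun s =>
    (((hasDerivAt_id s).const_mul k).cos).congr_deriv (by simp [mul_comm])
  -- Now r'' = -k² r. This Wronskian with the sine vanishes because r does at the pole; the one with
  -- the cosine is some constant A, with A² = 1 by arc length and A = 1 by positivity of r.
  have hE₂ : ∀ s ∈ Set.Ioc 0 b, k * r s * Real.cos (k * s) - r₁ s * Real.sin (k * s) = 0 := by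
    refine eq_of_hasDerivAt_zero_of_tendsto (fun s hs => ?_) ?_
    · refine ((((h.hasDerivAt_r s (hJ s hs)).const_mul k).mul (hcos s)).sub
        ((h.hasDerivAt_r₁ s (hJ s hs)).mul (hsin s))).congr_deriv ?_
      rw [hr₂ s hs]
      ring
    · have hct : Tendsto (fun s => Real.cos (k * s)) (𝓝[>] 0) (𝓝 (Real.cos (k * 0))) :=
        ((by fun_prop : Continuous fun s => Real.cos (k * s)).tendsto 0).mono_left
          nhdsWithin_le_nhds
      have hst : Tendsto (fun s => Real.sin (k * s)) (𝓝[>] 0) (𝓝 0) := by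
        have := ((by fun_prop : Continuous fun s => Real.sin (k * s)).tendsto 0).mono_left
          (nhdsWithin_le_nhds (s := Set.Ioi 0))
        simpa using this
      have h1 : Tendsto (fun s => k * r s * Real.cos (k * s)) (𝓝[>] 0) (𝓝 0) := by
        simpa using (hr0.const_mul k).mul hct
      have h2 : Tendsto (fun s => r₁ s * Real.sin (k * s)) (𝓝[>] 0) (𝓝 0) := by
        have hz' := hst.norm
        rw [norm_zero] at hz'
        refine squeeze_zero_norm' ?_ hz'
        filter_upwards [hnear] with s hs
        rw [norm_mul]
        exact mul_le_of_le_one_left (norm_nonneg _) (hr₁b s hs)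
      simpa using h1.sub h2
  obtain ⟨A, hA⟩ : ∃ A, ∀ s ∈ Set.Ioc 0 b, r₁ s * Real.cos (k * s) + k * r s * Real.sin (k * s) = A := by
    refine ⟨r₁ b * Real.cos (k * b) + k * r b * Real.sin (k * b), fun s hs => ?_⟩
    have hd : ∀ x ∈ Set.Ioc 0 b, HasDerivAt (fun s => r₁ s * Real.cos (k * s) +
        k * r s * Real.sin (k * s)) 0 x := fun x hx => by
      refine (((h.hasDerivAt_r₁ x (hJ x hx)).mul (hcos x)).add
        (((h.hasDerivAt_r x (hJ x hx)).const_mul k).mul (hsin x))).congr_deriv ?_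
      rw [hr₂ x hx]
      ring
    exact (constant_of_has_deriv_right_zero (a := s) (b := b)
      (fun x hx => (hd x ⟨hs.1.trans_le hx.1, hx.2⟩).continuousAt.continuousWithinAt)
      (fun x hx => (hd x ⟨hs.1.trans_le hx.1, hx.2.le⟩).hasDerivWithinAt) b ⟨hs.2, le_rfl⟩).symm
  have hr₁A : ∀ s ∈ Set.Ioc 0 b, r₁ s = A * Real.cos (k * s) := fun s hs => by
    linear_combination Real.cos (k * s) * hA s hs - Real.sin (k * s) * hE₂ s hs -
      r₁ s * Real.sin_sq_add_cos_sq (k * s)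
  have hrA : ∀ s ∈ Set.Ioc 0 b, r s = A * capRadius k s := by
    intro s hs
    have := eq_of_hasDerivAt_zero_of_tendsto (f := fun s => r s - A * capRadius k s) (l := 0)
      (fun s hs => (((h.hasDerivAt_r s (hJ s hs)).sub
        ((hasDerivAt_capRadius k s).const_mul A)).congr_deriv (by rw [hr₁A s hs]; ring))) ?_ s hs
    · linarith
    · have hcr : Tendsto (capRadius k) (𝓝[>] 0) (𝓝 0) := by
        have := (hasDerivAt_capRadius k 0).continuousAt.tendsto.mono_left
          (nhdsWithin_le_nhds (s := Set.Ioi 0))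
        simpa [capRadius] using this
      simpa using hr0.sub (hcr.const_mul A)
  have hA2 : A ^ 2 = 1 := by
    have hbI : b ∈ Set.Ioc 0 b := ⟨hb, le_rfl⟩
    have e1 := harc b hbI
    rw [hp₁ b hbI] at e1
    have e2 := hA b hbI
    have e3 := hE₂ b hbI
    have e4 := Real.sin_sq_add_cos_sq (k * b)
    have : A ^ 2 = (r₁ b * Real.cos (k * b) + k * r b * Real.sin (k * b)) ^ 2 +
        (k * r b * Real.cos (k * b) - r₁ b * Real.sin (k * b)) ^ 2 := by rw [e2, e3]; ring
    rw [this]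
    linear_combination ((k * r b) ^ 2 + r₁ b ^ 2) * e4 + e1
  have hA1 : A = 1 := by
    have hpos' : ∀ᶠ s in 𝓝[>] (0 : ℝ), 0 < capRadius k s := by
      have hd := (hasDerivAt_capRadius k 0).tendsto_slope.mono_left
        (nhdsWithin_mono 0 (s := Set.Ioi 0) fun x (hx : 0 < x) => hx.ne')
      rw [mul_zero, Real.cos_zero] at hd
      filter_upwards [hd.eventually (lt_mem_nhds one_pos), self_mem_nhdsWithin] with s h1 h2
      rw [slope_def_field] at h1
      have h3 : capRadius k 0 = 0 := by simp [capRadius]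
      rw [h3, sub_zero, sub_zero] at h1
      exact (div_pos_iff_of_pos_right h2).1 h1
    obtain ⟨s, h1, h2⟩ := (hpos'.and hnear).exists
    have h3 := hpos s h2
    rw [hrA s h2] at h3
    have h4 := (pos_iff_pos_of_mul_pos h3).2 h1
    nlinarith
  refine ⟨k, capRadius k, capPrimitive k, hc, ⟨sq_nonneg k, hb, hasDerivAt_capPrimitive k,
    fun s => cos_eq_capPrimitive k s ▸ hasDerivAt_capRadius k s, by simp [capPrimitive],
    by simp [capRadius], fun s hs => ?_⟩, fun s hs => ?_⟩
  · have := hpos s hs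
    rwa [hrA s hs, hA1, one_mul] at this
  · have hrs : r s = capRadius k s := by rw [hrA s hs, hA1, one_mul]
    refine ⟨hrs, ?_, by rw [hp₁ s hs, hrs], by rw [hr₁A s hs, hA1, one_mul, cos_eq_capPrimitive]⟩
    have := eq_of_hasDerivAt_zero_of_tendsto (f := fun s => p s - k * capPrimitive k s) (l := p 0)
      (fun s hs => (((h.hasDerivAt_p s (hJ s hs)).sub
        ((hasDerivAt_capPrimitive k s).const_mul k)).congr_deriv
          (by rw [hp₁ s hs, hrA s hs, hA1]; ring))) ?_ s hs
    · linarith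
    · have hcr : Tendsto (capPrimitive k) (𝓝[>] 0) (𝓝 0) := by
        have := (hasDerivAt_capPrimitive k 0).continuousAt.tendsto.mono_left
          (nhdsWithin_le_nhds (s := Set.Ioi 0))
        simpa [capPrimitive] using this
      simpa using hp0.sub (hcr.const_mul k)

end OnAxis

end

noncomputable section

/-! ### Convergence in `L²` -/

/-- The square-integrable functions `u k` converge to `u₀` in `L²`. -/
structure TendstoLpTwo {α : Type*} {m : MeasurableSpace α} (μ : Measure α) (u : ℕ → α → ℝ)
    (u₀ : α → ℝ) : Prop where
  memLp : ∀ k, MemLp (u k) 2 μ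
  memLp_limit : MemLp u₀ 2 μ
  tendsto : Tendsto (fun k => eLpNorm (fun x => u k x - u₀ x) 2 μ) atTop (𝓝 0)

namespace TendstoLpTwo

variable {α : Type*} {m : MeasurableSpace α} {μ : Measure α} {u v : ℕ → α → ℝ} {u₀ v₀ c : α → ℝ}

/-- Continuity of the inner product of L², read on representatives. -/
theorem integral_mul (hu : TendstoLpTwo μ u u₀) (hv : TendstoLpTwo μ v v₀) :
    Tendsto (fun k => ∫ x, u k x * v k x ∂μ) atTop (𝓝 (∫ x, u₀ x * v₀ x ∂μ)) := by
  have hu' := (Lp.tendsto_Lp_iff_tendsto_eLpNorm'' u hu.memLp u₀ hu.memLp_limit).2 hu.tendsto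
  have hv' := (Lp.tendsto_Lp_iff_tendsto_eLpNorm'' v hv.memLp v₀ hv.memLp_limit).2 hv.tendsto
  have key : ∀ {f g : α → ℝ} (hf : MemLp f 2 μ) (hg : MemLp g 2 μ),
      inner ℝ (hg.toLp g) (hf.toLp f) = ∫ x, f x * g x ∂μ := by
    intro f g hf hg
    rw [L2.inner_def]
    refine integral_congr_ae ?_
    filter_upwards [hf.coeFn_toLp, hg.coeFn_toLp] with x h1 h2
    rw [h1, h2]
    rfl
  have := hv'.inner (𝕜 := ℝ) hu'
  rw [key hu.memLp_limit hv.memLp_limit] at this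
  exact this.congr fun k => key (hu.memLp k) (hv.memLp k)

theorem bounded_mul (hu : TendstoLpTwo μ u u₀) (hc : AEStronglyMeasurable c μ) {C : ℝ}
    (hC : ∀ᵐ x ∂μ, ‖c x‖ ≤ C) : TendstoLpTwo μ (fun k x => c x * u k x) fun x => c x * u₀ x := by
  have hmem : ∀ {f : α → ℝ}, MemLp f 2 μ → MemLp (fun x => c x * f x) 2 μ := fun hf =>
    hf.of_le_mul (c := C) (hc.mul hf.aestronglyMeasurable) (hC.mono fun x hx => by
      rw [norm_mul]; exact mul_le_mul_of_nonneg_right hx (norm_nonneg _))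
  refine ⟨fun k => hmem (hu.memLp k), hmem hu.memLp_limit, ?_⟩
  have hlim : Tendsto (fun k => ENNReal.ofReal C * eLpNorm (fun x => u k x - u₀ x) 2 μ) atTop
      (𝓝 0) := by
    simpa using ENNReal.Tendsto.const_mul hu.tendsto (Or.inr (ENNReal.ofReal_ne_top (r := C)))
  refine tendsto_of_tendsto_of_tendsto_of_le_of_le tendsto_const_nhds hlim (fun _ => zero_le)
    fun k => eLpNorm_le_mul_eLpNorm_of_ae_le_mul (hC.mono fun x hx => ?_) 2
  rw [← mul_sub, norm_mul]
  exact mul_le_mul_of_nonneg_right hx (norm_nonneg _)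

/-- Allows smooth approximants to be corrected to mean zero. -/
theorem sub_const [IsFiniteMeasure μ] (hu : TendstoLpTwo μ u u₀) {l : ℕ → ℝ}
    (hl : Tendsto l atTop (𝓝 0)) : TendstoLpTwo μ (fun k x => u k x - l k) u₀ := by
  refine ⟨fun k => (hu.memLp k).sub (memLp_const _), hu.memLp_limit, ?_⟩
  have h1 : Tendsto (fun k => eLpNorm (fun _ : α => l k) 2 μ) atTop (𝓝 0) := by
    rcases eq_or_ne μ 0 with rfl | hμ
    · simp
    · simp only [eLpNorm_const _ two_ne_zero hμ]
      have h2 : Tendsto (fun k => ‖l k‖ₑ) atTop (𝓝 0) := by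
        simpa using hl.enorm
      simpa using ENNReal.Tendsto.mul_const h2 (Or.inr (ENNReal.rpow_ne_top_of_nonneg
        (by positivity) (measure_ne_top μ Set.univ)))
  have h2 := hu.tendsto.add h1
  rw [add_zero] at h2
  refine tendsto_of_tendsto_of_tendsto_of_le_of_le tendsto_const_nhds h2 (fun _ => zero_le)
    fun k => ?_
  have h3 := eLpNorm_sub_le (μ := μ) (p := 2) (f := fun x => u k x - u₀ x) (g := fun _ => l k)
    ((hu.memLp k).sub hu.memLp_limit).aestronglyMeasurable aestronglyMeasurable_const
    (by norm_num)
  have h4 : (fun x => u k x - l k - u₀ x) = (fun x => u k x - u₀ x) - fun _ => l k := by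
    funext x
    rw [Pi.sub_apply]
    ring
  exact h4 ▸ h3

end TendstoLpTwo

/-! ### Continuity of the geometric coefficients -/

namespace IsImmersedHypersurface

variable {n : ℕ} {a b : ℝ} {x N : EuclideanSpace ℝ (Fin n) → EuclideanSpace ℝ (Fin (n + 1))}

theorem continuousOn_coordTangent (h : IsImmersedHypersurface n a b x N) (i : Fin n) :
    ContinuousOn (coordTangent x i) (shell n a b) := by
  obtain ⟨U, hU, hsU, hx⟩ := h.smooth
  exact ((hx.continuousOn_fderiv_of_isOpen hU (by simp)).clm_apply continuousOn_const).mono hsU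

theorem continuousOn_metricMatrix (h : IsImmersedHypersurface n a b x N) :
    ContinuousOn (metricMatrix x) (shell n a b) :=
  continuousOn_pi.2 fun i => continuousOn_pi.2 fun j =>
    (h.continuousOn_coordTangent i).inner (𝕜 := ℝ) (h.continuousOn_coordTangent j)

theorem continuousOn_secondFundMatrix (h : IsImmersedHypersurface n a b x N) :
    ContinuousOn (secondFundMatrix x N) (shell n a b) := by
  obtain ⟨U, hU, hsU, hx⟩ := h.smooth
  refine continuousOn_pi.2 fun i => continuousOn_pi.2 fun j => ?_
  have h1 : ContDiffOn ℝ 1 (coordTangent x j) U :=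
    (hx.fderiv_of_isOpen (m := 1) hU (by norm_cast)).clm_apply contDiffOn_const
  have h2 : ContinuousOn (fun y => fderiv ℝ (coordTangent x j) y (EuclideanSpace.single i 1))
      (shell n a b) :=
    ((h1.continuousOn_fderiv_of_isOpen hU le_rfl).clm_apply continuousOn_const).mono hsU
  exact h2.inner (𝕜 := ℝ) h.normal_continuous

/-- The metric is a Gram matrix: a vector in its kernel is killed by the differential, which is
injective. -/
theorem det_metricMatrix_ne_zero (h : IsImmersedHypersurface n a b x N)
    {y : EuclideanSpace ℝ (Fin n)} (hy : y ∈ shell n a b) : (metricMatrix x y).det ≠ 0 := by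
  intro hdet
  obtain ⟨v, hv, hv0⟩ := Matrix.exists_mulVec_eq_zero_iff.2 hdet
  have hsum : fderiv ℝ x y (WithLp.toLp 2 v) = ∑ i, v i • coordTangent x i y := by
    have : WithLp.toLp 2 v = ∑ i, v i • EuclideanSpace.single i (1 : ℝ) := by
      ext j
      simp [Pi.single_apply]
    rw [this, map_sum]
    simp [coordTangent]
  have h1 : inner ℝ (fderiv ℝ x y (WithLp.toLp 2 v)) (fderiv ℝ x y (WithLp.toLp 2 v)) =
      v ⬝ᵥ (metricMatrix x y).mulVec v := by
    rw [hsum, sum_inner]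
    simp only [inner_sum, real_inner_smul_left, real_inner_smul_right, dotProduct, Matrix.mulVec,
      metricMatrix, Matrix.of_apply, Finset.mul_sum]
    refine Finset.sum_congr rfl fun i _ => Finset.sum_congr rfl fun j _ => ?_
    ring
  rw [hv0, dotProduct_zero, inner_self_eq_zero] at h1
  have h2 := h.immersion y hy (h1.trans (map_zero _).symm)
  exact hv (congrArg WithLp.ofLp h2)

theorem continuousOn_metricMatrix_inv (h : IsImmersedHypersurface n a b x N) :
    ContinuousOn (fun y => (metricMatrix x y)⁻¹) (shell n a b) := by
  intro y hy
  refine ContinuousAt.comp_continuousWithinAt (g := fun A : Matrix (Fin n) (Fin n) ℝ => A⁻¹)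
    (continuousAt_matrix_inv _ ?_) (h.continuousOn_metricMatrix y hy)
  simpa [Ring.inverse_eq_inv'] using
    continuousAt_inv₀ (h.det_metricMatrix_ne_zero hy)

theorem continuousOn_areaDensity (h : IsImmersedHypersurface n a b x N) :
    ContinuousOn (areaDensity x) (shell n a b) :=
  Real.continuous_sqrt.comp_continuousOn
    ((continuous_id.matrix_det).comp_continuousOn h.continuousOn_metricMatrix)

theorem continuousOn_secondFundNormSq (h : IsImmersedHypersurface n a b x N) :
    ContinuousOn (secondFundNormSq x N) (shell n a b) := by
  have h1 : ContinuousOn (fun y => (metricMatrix x y)⁻¹ * secondFundMatrix x N y) (shell n a b) :=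
    h.continuousOn_metricMatrix_inv.mul h.continuousOn_secondFundMatrix
  exact (continuous_id.matrix_trace).comp_continuousOn (h1.mul h1)

end IsImmersedHypersurface

theorem covectorNormSq_eq_sum {n : ℕ} (x : EuclideanSpace ℝ (Fin n) → EuclideanSpace ℝ (Fin (n + 1)))
    (y V : EuclideanSpace ℝ (Fin n)) :
    covectorNormSq x y V = ∑ i, ∑ j, (metricMatrix x y)⁻¹ i j * V i * V j := by
  simp only [covectorNormSq, dotProduct, Matrix.mulVec, Finset.mul_sum]
  exact Finset.sum_congr rfl fun i _ => Finset.sum_congr rfl fun j _ => by ring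

/-! ### Reduction of stability to smooth functions -/

section Density

variable {n : ℕ} {a b : ℝ} {x N : EuclideanSpace ℝ (Fin n) → EuclideanSpace ℝ (Fin (n + 1))} {θ : ℝ}

theorem exists_ae_bound_shell {c : EuclideanSpace ℝ (Fin n) → ℝ}
    (hc : ContinuousOn c (shell n a b)) :
    AEStronglyMeasurable c (volume.restrict (shell n a b)) ∧
      ∃ C, ∀ᵐ y ∂(volume.restrict (shell n a b)), ‖c y‖ ≤ C := by
  obtain ⟨C, hC⟩ := isCompact_shell.exists_bound_of_continuousOn hc
  exact ⟨hc.aestronglyMeasurable isClosed_shell.measurableSet, C,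
    (ae_restrict_iff' isClosed_shell.measurableSet).2 (Eventually.of_forall hC)⟩

theorem TendstoLpTwo.integral_mul_mul {c : EuclideanSpace ℝ (Fin n) → ℝ}
    (hc : ContinuousOn c (shell n a b)) {u v : ℕ → EuclideanSpace ℝ (Fin n) → ℝ}
    {u₀ v₀ : EuclideanSpace ℝ (Fin n) → ℝ} (hu : TendstoLpTwo (volume.restrict (shell n a b)) u u₀)
    (hv : TendstoLpTwo (volume.restrict (shell n a b)) v v₀) :
    Tendsto (fun k => ∫ y in shell n a b, c y * u k y * v k y) atTop
      (𝓝 (∫ y in shell n a b, c y * u₀ y * v₀ y)) := by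
  obtain ⟨h1, C, h2⟩ := exists_ae_bound_shell hc
  exact (hu.bounded_mul h1 h2).integral_mul hv

theorem integrable_mul_mul_shell {c u v : EuclideanSpace ℝ (Fin n) → ℝ}
    (hc : ContinuousOn c (shell n a b)) (hu : MemLp u 2 (volume.restrict (shell n a b)))
    (hv : MemLp v 2 (volume.restrict (shell n a b))) :
    Integrable (fun y => c y * u y * v y) (volume.restrict (shell n a b)) := by
  obtain ⟨h1, C, h2⟩ := exists_ae_bound_shell hc
  have := (TendstoLpTwo.mk (fun _ => hu) hu (by simp)).bounded_mul h1 h2 |>.memLp_limit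
  exact this.integrable_mul hv

/-- A finite sum of weighted L² products with weights continuous on the shell, and a constant
multiple of the boundary L² form: the shape in which L² convergence of f, G and τ passes to the
limit. -/
theorem secondVariation_eq (h : IsImmersedHypersurface n a b x N) {e : ℝ}
    (he : ∀ᵐ y ∂shellBoundaryMeasure n a b, boundaryCoeff b x N θ y * boundaryDensity b x y = e)
    {f τ : EuclideanSpace ℝ (Fin n) → ℝ} {G : EuclideanSpace ℝ (Fin n) → EuclideanSpace ℝ (Fin n)}
    (hf : MemLp f 2 (volume.restrict (shell n a b)))
    (hG : ∀ i, MemLp (fun y => G y i) 2 (volume.restrict (shell n a b))) :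
    secondVariation n a b x N θ f G τ =
      (∑ i, ∑ j, ∫ y in shell n a b,
        ((metricMatrix x y)⁻¹ i j * areaDensity x y) * G y i * G y j) -
      (∫ y in shell n a b, (secondFundNormSq x N y * areaDensity x y) * f y * f y) -
      e * ∫ y, τ y * τ y ∂shellBoundaryMeasure n a b := by
  have hA := h.continuousOn_areaDensity
  have hc : ∀ i j, ContinuousOn (fun y => (metricMatrix x y)⁻¹ i j * areaDensity x y)
      (shell n a b) := fun i j =>
    (continuousOn_pi.1 (continuousOn_pi.1 h.continuousOn_metricMatrix_inv i) j).mul hA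
  have hint := fun i j => integrable_mul_mul_shell (hc i j) (hG i) (hG j)
  have hd : Integrable (fun y => (secondFundNormSq x N y * areaDensity x y) * f y * f y)
      (volume.restrict (shell n a b)) :=
    integrable_mul_mul_shell (h.continuousOn_secondFundNormSq.mul hA) hf hf
  rw [secondVariation]
  congr 1
  · simp only [← integral_finsetSum _ fun j _ => hint _ j]
    rw [← integral_finsetSum _ fun i _ => integrable_finsetSum _ fun j _ => hint i j,
      ← integral_sub (integrable_finsetSum _ fun i _ => integrable_finsetSum _ fun j _ => hint i j) hd]
    refine integral_congr_ae (Eventually.of_forall fun y => ?_)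
    simp only [covectorNormSq_eq_sum, sub_mul, Finset.sum_mul]
    congr 1
    · exact Finset.sum_congr rfl fun i _ => Finset.sum_congr rfl fun j _ => by ring
    · ring
  · rw [← integral_const_mul]
    refine integral_congr_ae (he.mono fun y hy => ?_)
    simp only
    rw [← hy]
    ring

theorem gradient_sub_const {φ : EuclideanSpace ℝ (Fin n) → ℝ} (c : ℝ)
    (y : EuclideanSpace ℝ (Fin n)) : gradient (fun z => φ z - c) y = gradient φ y := by
  rw [gradient, gradient, fderiv_sub_const]

/-- Stability need only be tested on functions that are smooth up to the boundary. -/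
theorem isStable_of_contDiff (ha : 0 ≤ a) (hab : a ≤ b) (h : IsImmersedHypersurface n a b x N)
    (hpos : 0 < ∫ y in shell n a b, areaDensity x y) {e : ℝ}
    (he : ∀ᵐ y ∂shellBoundaryMeasure n a b, boundaryCoeff b x N θ y * boundaryDensity b x y = e)
    (hst : ∀ φ : EuclideanSpace ℝ (Fin n) → ℝ, ContDiff ℝ ∞ φ →
      ∫ y in shell n a b, φ y * areaDensity x y = 0 →
      0 ≤ secondVariation n a b x N θ φ (gradient φ) φ) :
    IsStable n a b x N θ := by
  intro f G τ hS hmean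
  obtain ⟨φ, hφ, h1, h2, h3⟩ := hS.approx
  have hA := h.continuousOn_areaDensity
  obtain ⟨hAm, C, hAC⟩ := exists_ae_bound_shell hA
  have hu : TendstoLpTwo (volume.restrict (shell n a b)) φ f :=
    ⟨fun k => memLp_shell_of_continuous (hφ k).continuous, hS.memLp_fun, h1⟩
  have ht : TendstoLpTwo (shellBoundaryMeasure n a b) φ τ :=
    ⟨fun k => memLp_shellBoundary_of_continuous ha hab (hφ k).continuous, hS.memLp_trace, h3⟩
  have hcomp : ∀ {V : EuclideanSpace ℝ (Fin n) → EuclideanSpace ℝ (Fin n)} (i : Fin n),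
      MemLp V 2 (volume.restrict (shell n a b)) →
      MemLp (fun y => V y i) 2 (volume.restrict (shell n a b)) := fun i hV =>
    (EuclideanSpace.proj i : EuclideanSpace ℝ (Fin n) →L[ℝ] ℝ).comp_memLp' hV
  have hG : ∀ i, TendstoLpTwo (volume.restrict (shell n a b)) (fun k y => gradient (φ k) y i)
      fun y => G y i := fun i => by
    refine ⟨fun k => hcomp i (memLp_shell_of_continuous (continuous_gradient ((hφ k).of_le
      (by simp)))), hcomp i hS.memLp_grad, ?_⟩
    refine tendsto_of_tendsto_of_tendsto_of_le_of_le tendsto_const_nhds h2 (fun _ => zero_le)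
      fun k => eLpNorm_mono fun y => ?_
    exact PiLp.norm_apply_le (gradient (φ k) y - G y) i
  have hone : TendstoLpTwo (volume.restrict (shell n a b)) (fun _ => areaDensity x)
      (areaDensity x) :=
    ⟨fun _ => MemLp.of_bound hAm C hAC, MemLp.of_bound hAm C hAC, by simp⟩
  set A := ∫ y in shell n a b, areaDensity x y
  have hl : Tendsto (fun k => (∫ y in shell n a b, φ k y * areaDensity x y) / A) atTop (𝓝 0) := by
    have := (hu.integral_mul hone).div_const A
    rwa [hmean, zero_div] at this
  -- The weighted mean of the approximant. It tends to the mean of f, which is 0, so subtracting it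
  -- changes neither the limit nor the gradients.
  set l : ℕ → ℝ := fun k => (∫ y in shell n a b, φ k y * areaDensity x y) / A with hldef
  set ψ : ℕ → EuclideanSpace ℝ (Fin n) → ℝ := fun k y => φ k y - l k with hψ
  have hψu : TendstoLpTwo (volume.restrict (shell n a b)) ψ f := hu.sub_const hl
  have hψt : TendstoLpTwo (shellBoundaryMeasure n a b) ψ τ := ht.sub_const hl
  have hψG : ∀ k y, gradient (ψ k) y = gradient (φ k) y := fun k y => gradient_sub_const _ y
  have hψsm : ∀ k, ContDiff ℝ ∞ (ψ k) := fun k => (hφ k).sub contDiff_const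
  have hnonneg : ∀ k, 0 ≤ secondVariation n a b x N θ (ψ k) (gradient (ψ k)) (ψ k) := by
    intro k
    refine hst _ (hψsm k) ?_
    have i1 : Integrable (fun y => φ k y * areaDensity x y) (volume.restrict (shell n a b)) :=
      (hu.memLp k).integrable_mul (hone.memLp k)
    have i2 : Integrable (fun y => l k * areaDensity x y) (volume.restrict (shell n a b)) :=
      (hA.integrableOn_compact isCompact_shell).const_mul _
    simp only [hψ, sub_mul]
    rw [integral_sub i1 i2, integral_const_mul]
    simp only [hldef]
    change _ - _ / A * A = 0
    rw [div_mul_cancel₀ _ hpos.ne', sub_self]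
  have hc : ∀ i j, ContinuousOn (fun y => (metricMatrix x y)⁻¹ i j * areaDensity x y)
      (shell n a b) := fun i j =>
    (continuousOn_pi.1 (continuousOn_pi.1 h.continuousOn_metricMatrix_inv i) j).mul hA
  have hlim : Tendsto (fun k => secondVariation n a b x N θ (ψ k) (gradient (ψ k)) (ψ k)) atTop
      (𝓝 (secondVariation n a b x N θ f G τ)) := by
    rw [secondVariation_eq h he hS.memLp_fun fun i => hcomp i hS.memLp_grad]
    simp only [funext (hψG _), fun k => secondVariation_eq h he (hψu.memLp k) (τ := ψ k)
      fun i => (hG i).memLp k]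
    refine ((tendsto_finsetSum _ fun i _ => tendsto_finsetSum _ fun j _ =>
      TendstoLpTwo.integral_mul_mul (hc i j) (hG i) (hG j)).sub ?_).sub ?_
    · exact TendstoLpTwo.integral_mul_mul (h.continuousOn_secondFundNormSq.mul hA) hψu hψu
    · exact (hψt.integral_mul hψt).const_mul e
  exact ge_of_tendsto' hlim hnonneg

end Density

end

noncomputable section

/-! ### Disks and spherical caps -/

section Cap

variable {n : ℕ} {b c k : ℝ} {J : Set ℝ} {p p₁ p₂ r r₁ r₂ R ρ : ℝ → ℝ}
  {N : EuclideanSpace ℝ (Fin n) → EuclideanSpace ℝ (Fin (n + 1))} {θ : ℝ}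

theorem norm_smul_axisVector_add_sq (t : ℝ) (v : EuclideanSpace ℝ (Fin n)) :
    ‖t • axisVector n + hyperplaneInclusion n v‖ ^ 2 = t ^ 2 + ‖v‖ ^ 2 := by
  rw [norm_add_sq_real, real_inner_smul_left, inner_axisVector, hyperplaneInclusion_zero_apply,
    norm_smul, norm_axisVector, norm_hyperplaneInclusion, Real.norm_eq_abs, mul_one, sq_abs]
  ring

theorem exists_eq_smul_axisVector_add (z : EuclideanSpace ℝ (Fin (n + 1))) :
    ∃ v : EuclideanSpace ℝ (Fin n), z = z 0 • axisVector n + hyperplaneInclusion n v := by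
  refine ⟨WithLp.toLp 2 fun i => z i.succ, ?_⟩
  ext i
  refine Fin.cases ?_ (fun j => ?_) i <;> simp

theorem IsCapProfile.exists_primitive_eq {K : ℝ} (h : IsCapProfile K b R ρ) {t : ℝ} (ht0 : 0 ≤ t)
    (htb : t ≤ ρ b) : ∃ s ∈ Set.Icc 0 b, ρ s = t := by
  have := intermediate_value_Icc h.length_pos.le h.continuous_primitive.continuousOn
    (show t ∈ Set.Icc (ρ 0) (ρ b) from ⟨by rwa [h.primitive_zero], htb⟩)
  obtain ⟨s, hs, e⟩ := this
  exact ⟨s, hs, e⟩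

/-- Every point of `ℝⁿ` at distance at most `R s` from the origin, as image under the polar map. -/
theorem IsCapProfile.exists_polar_eq {K : ℝ} (h : IsCapProfile K b R ρ) {s : ℝ}
    (hs : s ∈ Set.Icc 0 b) {v : EuclideanSpace ℝ (Fin n)} (hv : ‖v‖ ^ 2 = R s ^ 2) :
    ∃ y : EuclideanSpace ℝ (Fin n), ‖y‖ = s ∧ (R ‖y‖ / ‖y‖) • y = v := by
  rcases hs.1.eq_or_lt with rfl | hs0
  · rw [h.radius_zero, zero_pow two_ne_zero, pow_eq_zero_iff two_ne_zero, norm_eq_zero] at hv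
    exact ⟨0, norm_zero, by rw [hv, smul_zero]⟩
  · have hR := h.radius_pos s ⟨hs0, hs.2⟩
    have hv' : ‖v‖ = R s := (sq_eq_sq₀ (norm_nonneg _) hR.le).1 hv
    have hn : ‖(s / R s) • v‖ = s := by
      rw [norm_smul, hv', Real.norm_eq_abs, abs_of_pos (div_pos hs0 hR), div_mul_cancel₀ _ hR.ne']
    refine ⟨(s / R s) • v, hn, ?_⟩
    have := hR.ne'
    have := hs0.ne'
    rw [hn, smul_smul, show R s / s * (s / R s) = 1 by field_simp, one_smul]

theorem norm_le_one_of_mem_shell {a : ℝ} {x : EuclideanSpace ℝ (Fin n) → EuclideanSpace ℝ (Fin (n + 1))}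
    (hM : IsCapillaryInBall n a b x N θ) {y : EuclideanSpace ℝ (Fin n)} (hy : y ∈ shell n a b) :
    ‖x y‖ ≤ 1 := by
  by_cases h : y ∈ interior (shell n a b)
  · exact (hM.interior_mem y h).le
  · refine (hM.boundary_mem y ?_).le
    rw [isClosed_shell.frontier_eq]
    exact ⟨hy, h⟩

theorem revolve_eq_cap (hR : IsCapProfile (k ^ 2) b R ρ) (h : ∀ s ∈ Set.Ioc 0 b,
      r s = R s ∧ p s = p 0 + k * ρ s ∧ p₁ s = k * R s ∧ r₁ s = 1 - k ^ 2 * ρ s)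
    {y : EuclideanSpace ℝ (Fin n)} (hy : y ∈ shell n 0 b) :
    revolve p r y = (p 0 + k * ρ ‖y‖) • axisVector n +
      hyperplaneInclusion n ((R ‖y‖ / ‖y‖) • y) := by
  rcases eq_or_ne y 0 with rfl | hy0
  · simp [revolve_eq, hR.primitive_zero]
  · obtain ⟨h1, h2, -, -⟩ := h ‖y‖ ⟨norm_pos_iff.2 hy0, hy.2⟩
    rw [revolve_eq, h1, h2, map_smul]

/-- Along a cap |x|² = p(0)² + 2(1 + p(0)k)ρ. It equals 1 at the boundary and is less than 1 at the
pole, which forces the slope to be positive. -/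
theorem cap_boundary (hn : 0 < n) (hM : IsCapillaryInBall n 0 b (revolve p r) N θ)
    (hR : IsCapProfile (k ^ 2) b R ρ) (h : ∀ s ∈ Set.Ioc 0 b,
      r s = R s ∧ p s = p 0 + k * ρ s ∧ p₁ s = k * R s ∧ r₁ s = 1 - k ^ 2 * ρ s) :
    p 0 ^ 2 + 2 * (1 + p 0 * k) * ρ b = 1 ∧ 0 < 1 + p 0 * k := by
  have hb := hR.length_pos
  obtain ⟨h1, h2, -, -⟩ := h b ⟨hb, le_rfl⟩
  obtain ⟨y, hy⟩ := exists_euclidean_norm_eq hn hb.le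
  have e1 := IsCapillaryInBall.boundary_sq_add_sq hM (mem_frontier_shell_right hb.le hb hy)
    (norm_pos_iff.1 (hy ▸ hb))
  rw [hy, h1, h2, hR.radius_sq] at e1
  have e2 : p 0 ^ 2 + 2 * (1 + p 0 * k) * ρ b = 1 := by linear_combination e1
  refine ⟨e2, ?_⟩
  have e3 := hM.interior_mem 0 (mem_interior_shell_zero (by rwa [norm_zero]))
  have e4 : ‖revolve p r (0 : EuclideanSpace ℝ (Fin n))‖ = |p 0| := by
    simp [revolve_eq, norm_smul]
  rw [e4] at e3
  have e5 : p 0 ^ 2 < 1 := by rw [← sq_abs]; nlinarith [abs_nonneg (p 0)]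
  have e6 := hR.primitive_pos ⟨hb, le_rfl⟩
  by_contra hneg
  nlinarith [mul_nonneg (by linarith : 0 ≤ -(1 + p 0 * k)) e6.le]

/-- Since |x|² increases with ρ by `cap_boundary`, a point of the full plane or sphere lies in the
closed ball exactly when its height above the pole corresponds to ρ ≤ ρ(b), hence to a parameter in
[0, b]. -/
theorem isTotallyGeodesicDisk_or_isSphericalCap (hn : 0 < n)
    (hM : IsCapillaryInBall n 0 b (revolve p r) N θ)
    (hR : IsCapProfile (k ^ 2) b R ρ) (h : ∀ s ∈ Set.Ioc 0 b,
      r s = R s ∧ p s = p 0 + k * ρ s ∧ p₁ s = k * R s ∧ r₁ s = 1 - k ^ 2 * ρ s) :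
    IsTotallyGeodesicDisk n 0 b (revolve p r) ∨ IsSphericalCap n 0 b (revolve p r) := by
  obtain ⟨hbd, hpos⟩ := cap_boundary hn hM hR h
  have hpolar : ∀ y ∈ shell n 0 b, ‖(R ‖y‖ / ‖y‖) • y‖ ^ 2 = R ‖y‖ ^ 2 := fun y _ => by
    rcases eq_or_ne y 0 with rfl | hy0
    · simp [hR.radius_zero]
    · have := norm_ne_zero_iff.2 hy0
      rw [norm_smul, mul_pow, Real.norm_eq_abs, sq_abs]
      field_simp
  by_cases hk : k = 0
  · refine Or.inl ⟨axisVector n, p 0, fun h0 => ?_, Set.Subset.antisymm ?_ ?_⟩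
    · have := norm_axisVector (n := n)
      rw [h0, norm_zero] at this
      exact zero_ne_one this
    · rintro _ ⟨y, hy, rfl⟩
      refine ⟨?_, by simpa using norm_le_one_of_mem_shell hM hy⟩
      simp [revolve_eq_cap hR h hy, hk]
    · rintro z ⟨hz1, hz2⟩
      have hz1' : z 0 = p 0 := by simpa using hz1
      rw [mem_closedBall_zero_iff] at hz2
      obtain ⟨v, hv⟩ := exists_eq_smul_axisVector_add z
      have e1 := norm_smul_axisVector_add_sq (z 0) v
      rw [← hv, hz1'] at e1
      have e2 : ‖v‖ ^ 2 / 2 ≤ ρ b := by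
        rw [hk] at hbd
        nlinarith [norm_nonneg z]
      obtain ⟨s, hs, hρ⟩ := hR.exists_primitive_eq (by positivity) e2
      obtain ⟨y, hy, hyv⟩ := hR.exists_polar_eq (v := v) hs (by
        rw [hR.radius_sq, hρ, hk]; ring)
      have hysh : y ∈ shell n 0 b := ⟨norm_nonneg _, by rw [hy]; exact hs.2⟩
      refine ⟨y, hysh, ?_⟩
      rw [revolve_eq_cap hR h hysh, hyv, hk, zero_mul, add_zero, ← hz1', ← hv]
  · refine Or.inr ⟨(p 0 + 1 / k) • axisVector n, 1 / |k|, by positivity,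
      Set.Subset.antisymm ?_ ?_⟩
    · rintro _ ⟨y, hy, rfl⟩
      refine ⟨?_, by simpa using norm_le_one_of_mem_shell hM hy⟩
      rw [mem_sphere_iff_norm, ← sq_eq_sq₀ (norm_nonneg _) (by positivity), revolve_eq_cap hR h hy]
      have : (p 0 + k * ρ ‖y‖) • axisVector n + hyperplaneInclusion n ((R ‖y‖ / ‖y‖) • y) -
          (p 0 + 1 / k) • axisVector n =
          (k * ρ ‖y‖ - 1 / k) • axisVector n + hyperplaneInclusion n ((R ‖y‖ / ‖y‖) • y) := by
        module
      rw [this, norm_smul_axisVector_add_sq, hpolar y hy, hR.radius_sq, div_pow, sq_abs]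
      field_simp
      ring
    · rintro z ⟨hz1, hz2⟩
      rw [mem_closedBall_zero_iff] at hz2
      obtain ⟨v, hv⟩ := exists_eq_smul_axisVector_add z
      -- The value of ρ that the point z would have on the sphere.
      set t := (z 0 - p 0) / k with ht
      have hz0 : z 0 = p 0 + k * t := by rw [ht]; field_simp; ring
      have hz3 : (k * t - 1 / k) ^ 2 + ‖v‖ ^ 2 = (1 / |k|) ^ 2 := by
        rw [mem_sphere_iff_norm, hv] at hz1
        have : z 0 • axisVector n + hyperplaneInclusion n v - (p 0 + 1 / k) • axisVector n =
            (k * t - 1 / k) • axisVector n + hyperplaneInclusion n v := by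
          rw [hz0]; module
        rw [← norm_smul_axisVector_add_sq, ← this, hz1]
      have hvt : ‖v‖ ^ 2 = 2 * t - k ^ 2 * t ^ 2 := by
        rw [div_pow, sq_abs] at hz3
        have : ‖v‖ ^ 2 = 1 ^ 2 / k ^ 2 - (k * t - 1 / k) ^ 2 := by linarith
        rw [this]
        field_simp
        ring
      have hz4 : p 0 ^ 2 + 2 * (1 + p 0 * k) * t ≤ 1 := by
        have e1 := norm_smul_axisVector_add_sq (z 0) v
        rw [← hv, hvt, hz0] at e1
        have e2 : ‖z‖ ^ 2 ≤ 1 := by nlinarith [norm_nonneg z]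
        linarith
      have ht0 : 0 ≤ t := by nlinarith [sq_nonneg ‖v‖, sq_nonneg (k * t)]
      have htb : t ≤ ρ b := by
        by_contra hlt
        nlinarith [mul_pos hpos (by linarith : 0 < t - ρ b)]
      obtain ⟨s, hs, hρ⟩ := hR.exists_primitive_eq ht0 htb
      obtain ⟨y, hy, hyv⟩ := hR.exists_polar_eq (v := v) hs (by rw [hR.radius_sq, hρ, hvt])
      have hysh : y ∈ shell n 0 b := ⟨norm_nonneg _, by rw [hy]; exact hs.2⟩
      refine ⟨y, hysh, ?_⟩
      rw [revolve_eq_cap hR h hysh, hyv, hy, hρ, ← hz0, ← hv]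

/-- The coefficient `q` of a spherical cap. -/
theorem boundaryCoeff_cap (hn : 0 < n) (hJ : IsDelaunayProfile n 0 b c J p p₁ p₂ r r₁ r₂)
    (hc : c = n * k) (hM : IsCapillaryInBall n 0 b (revolve p r) N θ)
    (hR : IsCapProfile (k ^ 2) b R ρ) (h : ∀ s ∈ Set.Ioc 0 b,
      r s = R s ∧ p s = p 0 + k * ρ s ∧ p₁ s = k * R s ∧ r₁ s = 1 - k ^ 2 * ρ s)
    {y : EuclideanSpace ℝ (Fin n)} (hy : ‖y‖ = b) :
    boundaryCoeff b (revolve p r) N θ y = (1 - k ^ 2 * ρ b) / R b := by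
  have hb := hR.length_pos
  have hbI : b ∈ Set.Ioc 0 b := ⟨hb, le_rfl⟩
  obtain ⟨-, hpos⟩ := cap_boundary hn hM hR h
  obtain ⟨h1, h2, h3, h4⟩ := h b hbI
  have hRb := hR.radius_pos b hbI
  have hsin := hJ.tangential_right hn le_rfl hb hM
  rw [(hJ.boundaryCoeff_eq hM (mem_frontier_shell_right hb.le hb hy) (norm_pos_iff.1 (hy ▸ hb))).1,
    ← hsin, hy]
  -- The rotation field is R times the constant 1 + p(0)k. Hence q is the logarithmic derivative
  -- R'(b)/R(b): R wⱼ satisfies the Robin condition.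
  have hu : profileTangential p p₁ r r₁ b = R b * (1 + p 0 * k) := by
    rw [profileTangential, h1, h2, h3, h4]
    ring
  have hκ : profileCurvature n c p₁ r b = k := by
    rw [profileCurvature, h1, h3, hc, mul_div_assoc, div_self hRb.ne']
    ring
  have hβ : 1 + k * profileSupport p p₁ r r₁ b = (1 - k ^ 2 * ρ b) * (1 + p 0 * k) := by
    rw [profileSupport, h1, h2, h3, h4]
    linear_combination -k ^ 2 * hR.radius_sq b
  rw [hu, hκ, hβ, mul_div_mul_right _ _ hpos.ne']

/-- A cap is umbilical with |σ|² = n k², so in geodesic polar coordinates the interior and boundary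
terms are those of `cap_inequality_of_contDiff` with K = k². -/
theorem secondVariation_cap_nonneg (hn : 2 ≤ n)
    (hJ : IsDelaunayProfile n 0 b c J p p₁ p₂ r r₁ r₂)
    (hc : c = n * k) (hM : IsCapillaryInBall n 0 b (revolve p r) N θ)
    (hR : IsCapProfile (k ^ 2) b R ρ) (h : ∀ s ∈ Set.Ioc 0 b,
      r s = R s ∧ p s = p 0 + k * ρ s ∧ p₁ s = k * R s ∧ r₁ s = 1 - k ^ 2 * ρ s)
    {φ : EuclideanSpace ℝ (Fin n) → ℝ} (hφ : ContDiff ℝ ∞ φ)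
    (hmean : ∫ y in shell n 0 b, φ y * areaDensity (revolve p r) y = 0) :
    0 ≤ secondVariation n 0 b (revolve p r) N θ φ (gradient φ) φ := by
  have hn0 : 0 < n := by omega
  have hb := hR.length_pos
  have hbI : b ∈ Set.Ioc 0 b := ⟨hb, le_rfl⟩
  have hIm := hM.toIsImmersedHypersurface
  have hA := hIm.continuousOn_areaDensity
  have hφ1 : ContDiff ℝ 1 φ := hφ.of_le (by simp)
  have hnorm : ∀ s, 0 < s → ∀ w : Metric.sphere (0 : EuclideanSpace ℝ (Fin n)) 1,
      ‖s • (w : EuclideanSpace ℝ (Fin n))‖ = s := fun s hs w => by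
    rw [norm_smul, norm_eq_of_mem_sphere, mul_one, Real.norm_eq_abs, abs_of_pos hs]
  have hsh : ∀ s ∈ Set.Ioc 0 b, ∀ w : Metric.sphere (0 : EuclideanSpace ℝ (Fin n)) 1,
      s • (w : EuclideanSpace ℝ (Fin n)) ∈ shell n 0 b := fun s hs w =>
    ⟨norm_nonneg _, by rw [hnorm s hs.1]; exact hs.2⟩
  have harea : ∀ s ∈ Set.Ioc 0 b, ∀ w : Metric.sphere (0 : EuclideanSpace ℝ (Fin n)) 1,
      areaDensity (revolve p r) (s • (w : EuclideanSpace ℝ (Fin n))) = (R s / s) ^ (n - 1) :=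
    fun s hs w => by
      have hpos : 0 < ‖s • (w : EuclideanSpace ℝ (Fin n))‖ := by rw [hnorm s hs.1]; exact hs.1
      rw [hJ.areaDensity_eq hn0 (hJ.mem _ (hsh s hs w) hpos) (hJ.arc _ (hsh s hs w) hpos)
        (hJ.radius_pos _ (hsh s hs w) hpos), hnorm s hs.1, (h s hs).1]
  have hmean' : ∫ s in (0 : ℝ)..b, R s ^ (n - 1) *
      ∫ w : Metric.sphere (0 : EuclideanSpace ℝ (Fin n)) 1,
        φ (s • (w : EuclideanSpace ℝ (Fin n))) ∂volume.toSphere = 0 := by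
    have hint : IntegrableOn (fun y => φ y * areaDensity (revolve p r) y) (shell n 0 b) :=
      (hφ.continuous.continuousOn.mul hA).integrableOn_compact isCompact_shell
    rw [(integral_shell_eq hn0 le_rfl hb.le hint).2] at hmean
    refine Eq.trans ?_ hmean
    rw [intervalIntegral.integral_of_le hb.le, intervalIntegral.integral_of_le hb.le]
    refine setIntegral_congr_fun measurableSet_Ioc fun s hs => ?_
    simp only [harea s hs]
    rw [integral_mul_const, div_pow]
    have := pow_ne_zero (n - 1) hs.1.ne'
    field_simp
  set E : EuclideanSpace ℝ (Fin n) → ℝ := fun y =>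
    (covectorNormSq (revolve p r) y (gradient φ y) - secondFundNormSq (revolve p r) N y * φ y ^ 2) *
      areaDensity (revolve p r) y with hE
  have hEint : IntegrableOn E (shell n 0 b) := by
    have hg := continuous_gradient hφ1
    have hcov : ContinuousOn (fun y => covectorNormSq (revolve p r) y (gradient φ y))
        (shell n 0 b) := by
      simp only [covectorNormSq_eq_sum]
      have hgi : ∀ i, ContinuousOn (fun y => gradient φ y i) (shell n 0 b) := fun i =>
        ((EuclideanSpace.proj i : EuclideanSpace ℝ (Fin n) →L[ℝ] ℝ).continuous.comp hg).continuousOn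
      exact continuousOn_finsetSum _ fun i _ => continuousOn_finsetSum _ fun j _ =>
        ((continuousOn_pi.1 (continuousOn_pi.1 hIm.continuousOn_metricMatrix_inv i) j).mul
          (hgi i)).mul (hgi j)
    exact ((hcov.sub (hIm.continuousOn_secondFundNormSq.mul
      (hφ.continuous.continuousOn.pow 2))).mul hA).integrableOn_compact isCompact_shell
  obtain ⟨hI1, hI2⟩ := integral_shell_eq hn0 le_rfl hb.le hEint
  have hval : ∀ s ∈ Set.Ioo 0 b, s ^ (n - 1) *
      ∫ w : Metric.sphere (0 : EuclideanSpace ℝ (Fin n)) 1,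
        E (s • (w : EuclideanSpace ℝ (Fin n))) ∂volume.toSphere = R s ^ (n - 1) *
      ∫ w : Metric.sphere (0 : EuclideanSpace ℝ (Fin n)) 1,
        (inner ℝ (gradient φ (s • (w : EuclideanSpace ℝ (Fin n))))
          (w : EuclideanSpace ℝ (Fin n)) ^ 2 + (s / R s) ^ 2 *
          (‖gradient φ (s • (w : EuclideanSpace ℝ (Fin n)))‖ ^ 2 -
          inner ℝ (gradient φ (s • (w : EuclideanSpace ℝ (Fin n))))
          (w : EuclideanSpace ℝ (Fin n)) ^ 2) -
          n * k ^ 2 * φ (s • (w : EuclideanSpace ℝ (Fin n))) ^ 2) ∂volume.toSphere := by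
    intro s hs
    have hs' : s ∈ Set.Ioc 0 b := ⟨hs.1, hs.2.le⟩
    obtain ⟨h1, -, h3, -⟩ := h s hs'
    have hRs := hR.radius_pos s hs'
    rw [← integral_const_mul, ← integral_const_mul]
    refine integral_congr_ae (Eventually.of_forall fun w => ?_)
    have hpos : 0 < ‖s • (w : EuclideanSpace ℝ (Fin n))‖ := by rw [hnorm s hs.1]; exact hs.1
    simp only [hE]
    rw [harea s hs', hJ.covectorNormSq_eq (hJ.mem _ (hsh s hs' w) hpos)
      (hJ.arc _ (hsh s hs' w) hpos) (hJ.radius_pos _ (hsh s hs' w) hpos).ne',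
      hJ.secondFundNormSq_eq_curvature hIm (hsh s hs' w) hpos, hnorm s hs.1, smul_smul,
      inv_mul_cancel₀ hs.1.ne', one_smul, profileCurvature, h1, h3, hc, mul_div_assoc,
      div_self hRs.ne', mul_one, div_pow (R s) s (n - 1), real_inner_comm]
    have := pow_ne_zero (n - 1) hs.1.ne'
    rw [mul_div_assoc', mul_div_cancel₀ _ this]
    ring
  have hIint : IntegrableOn (fun s => s ^ (n - 1) *
      ∫ w : Metric.sphere (0 : EuclideanSpace ℝ (Fin n)) 1,
        E (s • (w : EuclideanSpace ℝ (Fin n))) ∂volume.toSphere) (Set.Icc 0 b) :=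
    (integrableOn_Icc_iff_integrableOn_Ioc (by finiteness)).2 hI1
  have hmain := cap_inequality_of_contDiff hn hR hφ1 hval hIint hmean'
  rw [← hI2] at hmain
  have hbdry : ∫ y, boundaryCoeff b (revolve p r) N θ y * φ y ^ 2 * boundaryDensity b (revolve p r) y
      ∂(shellBoundaryMeasure n 0 b) = (1 - k ^ 2 * ρ b) * R b ^ (n - 2) *
      ∫ w : Metric.sphere (0 : EuclideanSpace ℝ (Fin n)) 1,
        φ (b • (w : EuclideanSpace ℝ (Fin n))) ^ 2 ∂volume.toSphere := by
    rw [shellBoundaryMeasure, sphereMeasure_zero hn, zero_add, integral_sphereMeasure hn hb.le,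
      ← integral_const_mul, ← integral_const_mul]
    refine integral_congr_ae (Eventually.of_forall fun w => ?_)
    have hpos : 0 < ‖b • (w : EuclideanSpace ℝ (Fin n))‖ := by rw [hnorm b hb]; exact hb
    have hRb := hR.radius_pos b hbI
    simp only
    rw [boundaryCoeff_cap hn0 hJ hc hM hR h (hnorm b hb w),
      hJ.boundaryDensity_eq hn0 (hJ.mem _ (hsh b hbI w) hpos) (hJ.arc _ (hsh b hbI w) hpos)
        (hJ.radius_pos _ (hsh b hbI w) hpos), hnorm b hb, (h b hbI).1, div_pow,
      show n - 1 = n - 2 + 1 by omega, pow_succ (R b)]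
    have := pow_ne_zero (n - 2 + 1) hb.ne'
    field_simp
  rw [secondVariation, hbdry]
  linarith

theorem IsDelaunayCapillary.isStable (hn : 2 ≤ n) (hb : 0 < b)
    (hM : IsDelaunayCapillary n 0 b p r N θ) :
    IsStable n 0 b (revolve p r) N θ ∧
      (IsTotallyGeodesicDisk n 0 b (revolve p r) ∨ IsSphericalCap n 0 b (revolve p r)) := by
  have hn0 : 0 < n := by omega
  obtain ⟨J, c, hJ, -, -⟩ := hM.exists_isDelaunayProfile hn le_rfl hb
  have hIm := hM.capillary.toIsImmersedHypersurface
  obtain ⟨hp0, hr0⟩ := hIm.tendsto_profile hn0 hb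
  obtain ⟨k, R, ρ, hc, hR, h⟩ := hJ.eq_cap hn hb hp0 hr0
  refine ⟨?_, isTotallyGeodesicDisk_or_isSphericalCap hn0 hM.capillary hR h⟩
  have hbI : b ∈ Set.Ioc 0 b := ⟨hb, le_rfl⟩
  refine isStable_of_contDiff (e := (1 - k ^ 2 * ρ b) / R b * (R b / b) ^ (n - 1)) le_rfl hb.le hIm
    ?_ ?_ fun φ hφ hmean => secondVariation_cap_nonneg hn hJ hc hM.capillary hR h hφ hmean
  · have hint := hIm.continuousOn_areaDensity.integrableOn_compact isCompact_shell (μ := volume)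
    rw [setIntegral_pos_iff_support_of_nonneg_ae
      (f := areaDensity (revolve p r)) (Eventually.of_forall fun y => Real.sqrt_nonneg _) hint]
    -- The density is computed only away from the origin, so positivity of the area is tested on a
    -- ball of radius b/2 centred at distance b/2, which avoids it.
    refine lt_of_lt_of_le (Metric.measure_ball_pos volume
      (EuclideanSpace.single ⟨0, hn0⟩ (b / 2)) (by positivity : 0 < b / 2)) (measure_mono ?_)
    intro y hy
    have hx : ‖(EuclideanSpace.single ⟨0, hn0⟩ (b / 2) : EuclideanSpace ℝ (Fin n))‖ = b / 2 := by
      simp [abs_of_pos hb]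
    rw [mem_ball_iff_norm] at hy
    have h1 := norm_le_norm_add_norm_sub' y (EuclideanSpace.single ⟨0, hn0⟩ (b / 2))
    have h2 := norm_sub_norm_le (EuclideanSpace.single ⟨0, hn0⟩ (b / 2)) y
    rw [norm_sub_rev] at h2
    rw [hx] at h1 h2
    have hpos : 0 < ‖y‖ := by linarith
    have hysh : y ∈ shell n 0 b := ⟨norm_nonneg _, by linarith⟩
    refine ⟨?_, hysh⟩
    rw [Function.mem_support, hJ.areaDensity_eq hn0 (hJ.mem _ hysh hpos) (hJ.arc _ hysh hpos)
      (hJ.radius_pos _ hysh hpos)]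
    exact pow_ne_zero _ (div_pos (hJ.radius_pos _ hysh hpos) hpos).ne'
  · rw [shellBoundaryMeasure, sphereMeasure_zero hn, zero_add]
    refine ae_sphereMeasure hb.le fun y hy => ?_
    have hpos : 0 < ‖y‖ := hy ▸ hb
    have hysh : y ∈ shell n 0 b := ⟨norm_nonneg _, hy.le⟩
    rw [boundaryCoeff_cap hn0 hJ hc hM.capillary hR h hy, hJ.boundaryDensity_eq hn0
      (hJ.mem _ hysh hpos) (hJ.arc _ hysh hpos) (hJ.radius_pos _ hysh hpos), hy, (h b hbI).1]

end Cap

end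

/-- Meeting the axis decides everything: for a = 0 both sides hold, for a > 0 both fail. -/
theorem corollary1 (n : ℕ) (hn : 2 ≤ n) (a b : ℝ) (ha : 0 ≤ a) (hab : a < b) (p r : ℝ → ℝ)
    (N : EuclideanSpace ℝ (Fin n) → EuclideanSpace ℝ (Fin (n + 1))) (θ : ℝ)
    (hM : IsDelaunayCapillary n a b p r N θ) :
    IsStable n a b (revolve p r) N θ ↔
      IsTotallyGeodesicDisk n a b (revolve p r) ∨ IsSphericalCap n a b (revolve p r) := by
  rcases ha.eq_or_lt with rfl | ha'
  · exact iff_of_true (hM.isStable hn hab).1 (hM.isStable hn hab).2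
  · have hn0 : 0 < n := by omega
    refine iff_of_false (hM.not_isStable hn ha' hab) ?_
    rintro (h | h)
    · exact not_isTotallyGeodesicDisk hn0 ha' hab hM.radius_pos h
    · exact not_isSphericalCap hn0 ha' hab hM.radius_pos h
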